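/- Theorem. A literal is a variable or a negated variable, a clause is a finite set of literals, a 2-CNF formula is a finite set of clauses with at most two literals each, and the length of a formula $F$ is $\ell=\sum_{C\in F}|C|$. Running times are numbers of steps on a random access machine with finitely many registers and arrays, whose instructions (assigning a constant, copying, adding or subtracting $1$, reading or writing an array cell by indirect addressing, comparing two registers) take one step each; $F$ is given by listing its clauses in any order, each once, and variables are natural numbers. (1) (Almost 2-SAT) There is an algorithm that, given a 2-CNF formula $F$ of length $\ell$ and an integer $k\ge 0$, runs in time $O(4^k k^4\ell)$ and either returns a truth assignment satisfying all but at most $k$ clauses of $F$ or correctly concludes that no such assignment exists. (2) (Almost 2-SAT(v), the variable version) There is an algorithm that, given a 2-CNF formula $F$ of length $\ell$ and an integer $k\ge 0$, runs in time $O(4^k k^4\ell)$ and either returns a set $S$ of at most $k$ variables of $F$ together with a truth assignment satisfying every clause of $F$ in which no variable of $S$ occurs, or correctly concludes that no such set and assignment exist. In both parts the constant in $O(\cdot)$ is absolute, and in the bound $k$ is read as $1$ in the factor $k^4$ when $k=0$, and $\ell$ is read as $1$ when $\ell=0$. -/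

import Mathlib

/-! ## CNF formulas -/

namespace TwoSat

/-- A literal: `(x, true)` is the variable `x`, and `(x, false)` is its negation. -/
abbrev Literal := ℕ × Bool

/-- A clause is a finite set of literals (read as their disjunction). -/
abbrev Clause := Finset Literal

/-- A CNF formula is a finite set of clauses (read as their conjunction). -/
abbrev CNF := Finset Clause

/-- Every clause has at most two literals. -/
def Is2CNF (F : CNF) : Prop := ∀ C ∈ F, C.card ≤ 2

/-- The length of a formula: the sum of the sizes of its clauses. -/
def len (F : CNF) : ℕ := ∑ C ∈ F, C.card

/-- The variables that occur in a formula. -/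
def vars (F : CNF) : Finset ℕ := F.biUnion fun C => C.image Prod.fst

/-- The truth assignment `τ` satisfies the clause `C`: some literal of `C` is true. -/
def SatClause (τ : ℕ → Bool) (C : Clause) : Prop := ∃ l ∈ C, τ l.1 = l.2

instance (τ : ℕ → Bool) : DecidablePred (SatClause τ) := fun C =>
  inferInstanceAs (Decidable (∃ l ∈ C, τ l.1 = l.2))

/-- The truth assignment `τ` satisfies the formula `F`. -/
def SatCNF (τ : ℕ → Bool) (F : CNF) : Prop := ∀ C ∈ F, SatClause τ C

/-- The clauses of `F` that `τ` does not satisfy. -/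
def violated (τ : ℕ → Bool) (F : CNF) : CNF := F.filter fun C => ¬ SatClause τ C

/-- The formula that remains when all clauses in which a variable of `S` occurs are deleted. -/
def deleteVars (F : CNF) (S : Finset ℕ) : CNF := F.filter fun C => ∀ l ∈ C, l.1 ∉ S

/-- `τ` is a solution of the instance `(F, k)` of the clause version: it satisfies all but at most
`k` clauses. -/
def ClauseSolution (F : CNF) (k : ℕ) (τ : ℕ → Bool) : Prop := (violated τ F).card ≤ k

/-- `(S, τ)` is a solution of the instance `(F, k)` of the variable version: `S` is a set of at most
`k` variables of `F`, and `τ` satisfies what is left of `F` when all clauses in which a variable of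
`S` occurs are deleted. -/
def VarSolution (F : CNF) (k : ℕ) (S : Finset ℕ) (τ : ℕ → Bool) : Prop :=
  S ⊆ vars F ∧ S.card ≤ k ∧ SatCNF τ (deleteVars F S)

/-! ## Inputs and outputs as sequences of numbers -/

/-- `L` lists the clauses of `F`, each exactly once, and each clause is given by a list of its
literals, each exactly once. The order is arbitrary. -/
def IsListing (L : List (List Literal)) (F : CNF) : Prop :=
  (∀ C ∈ L, C.Nodup) ∧ (L.map List.toFinset).Nodup ∧ (L.map List.toFinset).toFinset = F

/-- A clause as a sequence of numbers: its size, and then, for each literal, its variable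
and its sign (`1` for a positive and `0` for a negated variable). -/
def encodeClause (C : List Literal) : List ℕ :=
  C.length :: C.flatMap fun l => [l.1, l.2.toNat]

/-- An instance as a sequence of numbers: `k`, the number of clauses, and then the clauses. -/
def encode (L : List (List Literal)) (k : ℕ) : List ℕ :=
  k :: L.length :: L.flatMap encodeClause

/-- The truth assignment that makes exactly the listed variables true. -/
def assignmentOf (T : List ℕ) : ℕ → Bool := fun x => decide (x ∈ T)

/-- `out` is a correct answer to the instance `(F, k)` of the clause version: `1` followed by the
true variables of an assignment that satisfies all but at most `k` clauses, or `0`, and then there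
is no such assignment. -/
def CorrectClauseAnswer (F : CNF) (k : ℕ) (out : List ℕ) : Prop :=
  (∃ T : List ℕ, out = 1 :: T ∧ ClauseSolution F k (assignmentOf T)) ∨
  (out = [0] ∧ ¬ ∃ τ : ℕ → Bool, ClauseSolution F k τ)

/-- `out` is a correct answer to the instance `(F, k)` of the variable version: `1` followed by the
number of entries of a list `S`, that list, and the true variables of an assignment, which together
form a solution, or `0`, and then there is no solution. -/
def CorrectVarAnswer (F : CNF) (k : ℕ) (out : List ℕ) : Prop :=
  (∃ S T : List ℕ, out = 1 :: S.length :: (S ++ T) ∧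
    VarSolution F k S.toFinset (assignmentOf T)) ∨
  (out = [0] ∧ ¬ ∃ (S : Finset ℕ) (τ : ℕ → Bool), VarSolution F k S τ)

end TwoSat

/-! ## A random access machine with a step count

The machine has registers, and one-dimensional arrays that are read and written by indirect
addressing; a program uses finitely many of either, fixed in its text. The only arithmetic
operations are the addition and the subtraction of one, so that after `t` steps no number
exceeds the largest number in the input and in the program by more than `t`: nothing is gained by
charging one unit for an operation on numbers of any size. -/

namespace RAM

/-- The contents `reg x` of register `x`, and the contents `arr a i` of cell `i` of array `a`. -/
structure State where
  reg : ℕ → ℕ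
  arr : ℕ → ℕ → ℕ

/-- Register `x` gets the value `v`. -/
def State.setReg (s : State) (x v : ℕ) : State :=
  { s with reg := Function.update s.reg x v }

/-- Cell `i` of array `a` gets the value `v`. -/
def State.setArr (s : State) (a i v : ℕ) : State :=
  { s with arr := Function.update s.arr a (Function.update (s.arr a) i v) }

/-- Comparisons of the contents of two registers. -/
inductive Test where
  | eq (x y : ℕ)
  | lt (x y : ℕ)

/-- The comparison is true in the state `s`. -/
def Test.Holds : Test → State → Prop
  | .eq x y, s => s.reg x = s.reg y
  | .lt x y, s => s.reg x < s.reg y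

/-- Programs. -/
inductive Prog where
  | skip
  | const (x n : ℕ)
  | copy (x y : ℕ)
  | succ (x : ℕ)
  | pred (x : ℕ)
  | load (x a i : ℕ)
  | store (a i x : ℕ)
  | seq (p q : Prog)
  | ite (b : Test) (p q : Prog)
  | loop (b : Test) (p : Prog)

/-- `Exec p s s' t`: started in the state `s`, the program `p` halts in the state `s'` after exactly
`t` steps. Each elementary instruction and each evaluation of a test takes one step. -/
inductive Exec : Prog → State → State → ℕ → Prop where
  | skip (s : State) : Exec .skip s s 1
  | const (s : State) (x n : ℕ) : Exec (.const x n) s (s.setReg x n) 1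
  | copy (s : State) (x y : ℕ) : Exec (.copy x y) s (s.setReg x (s.reg y)) 1
  | succ (s : State) (x : ℕ) : Exec (.succ x) s (s.setReg x (s.reg x + 1)) 1
  | pred (s : State) (x : ℕ) : Exec (.pred x) s (s.setReg x (s.reg x - 1)) 1
  | load (s : State) (x a i : ℕ) : Exec (.load x a i) s (s.setReg x (s.arr a (s.reg i))) 1
  | store (s : State) (a i x : ℕ) : Exec (.store a i x) s (s.setArr a (s.reg i) (s.reg x)) 1
  | seq {p q : Prog} {s s₁ s₂ : State} {t₁ t₂ : ℕ} :
      Exec p s s₁ t₁ → Exec q s₁ s₂ t₂ → Exec (.seq p q) s s₂ (t₁ + t₂)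
  | ite_true {b : Test} {p q : Prog} {s s₁ : State} {t : ℕ} :
      b.Holds s → Exec p s s₁ t → Exec (.ite b p q) s s₁ (t + 1)
  | ite_false {b : Test} {p q : Prog} {s s₁ : State} {t : ℕ} :
      ¬ b.Holds s → Exec q s s₁ t → Exec (.ite b p q) s s₁ (t + 1)
  | loop_true {b : Test} {p : Prog} {s s₁ s₂ : State} {t₁ t₂ : ℕ} :
      b.Holds s → Exec p s s₁ t₁ → Exec (.loop b p) s₁ s₂ t₂ →
      Exec (.loop b p) s s₂ (t₁ + t₂ + 1)
  | loop_false {b : Test} {p : Prog} {s : State} :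
      ¬ b.Holds s → Exec (.loop b p) s s 1

/-- The initial state: the input is in array `0`, its length in register `0`, and everything else
is `0`. -/
def initState (inp : List ℕ) : State where
  reg := fun x => if x = 0 then inp.length else 0
  arr := fun a i => if a = 0 then inp.getD i 0 else 0

/-- The output: the first cells of array `1`, as many as register `0` says. -/
def output (s : State) : List ℕ := (List.range (s.reg 0)).map (s.arr 1)

/-- On the input `inp`, the program `p` halts after exactly `t` steps with the output `out`. -/
def Computes (p : Prog) (inp out : List ℕ) (t : ℕ) : Prop :=
  ∃ s : State, Exec p (initState inp) s t ∧ output s = out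

end RAM

/-!
Both versions are reduced to one cut problem, which is solved by a bounded search tree over a flow
algorithm; everything is carried out as a program of the random access machine.

*Reduction.* Every variable `x` gets two nodes with their negations, the first for the positive and
the second for the negated occurrences of `x`, and a link clause "first implies second". A set of
nodes that contains exactly one of any two opposite ones (a complete set) pays for the clauses it
violates, and for the links it violates, that is, for the variables it breaks: `cost_instClauses`.
In the clause version links have multiplicity `k + 1`, so that no variable can be broken
at cost `k`; in the variable version the clauses have multiplicity `k + 1`, and the broken variables
are the deleted ones. An instance is solvable iff some complete set has cost at most `k`
(`clauseSolution_of_cost`, `exists_cost_of_clauseSolution`, and the same for `VarSolution`). A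
clause `a ∨ b` is the pair of arcs from `¬ a` to `b` and from `¬ b` to `a`, so that the cost is half
of the number of arcs that leave the complete set (`cut_netOf`). The network is skew-symmetric:
negation reverses all arcs, and the star of `X`, the set of the nodes whose negations are not in
`X`, has the same cut as `X` (`Net.cut_star`).

*Search tree.* At a node of the tree some literals `A` are decided, and a maximum flow from `A` to
the negations of `A` bounds from below the cut of every set that contains `A` and avoids its
negations. If the bound exceeds `2 * k`, the node is pruned. Otherwise the set `Y` reachable in the
residual network is a minimum cut, and it is consistent because its star is a minimum cut as well
(`Srch.Inv.partial_found`). For every literal `x` not settled by `Y`, the nodes reachable from `x`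
are added to `Y` if they are consistent, and `Y` remains a minimum cut (`Srch.Inv.partial_union`);
the same is tried with `¬ x`. If both fail, then deciding `x` either way increases the minimum cut
(`Srch.Inv.lt_cut`), and the tree branches. If every literal gets settled, then `Y` is a complete
set of minimum cut, hence a solution. As the flow value grows along every branch, the depth is at
most `2 * k + 1`, and the tree has `O(4 ^ k)` nodes.

*Running time.* The flow takes at most `2 * k + 1` augmentations of linear time each. The searches
from `x` and from `¬ x` are run in lockstep and stop when one succeeds, so that the work of the
failing one is charged to the nodes that are settled by the other, and settling all literals takes
linear time (`wp_extendProg`). The network has `O((k + 1) ℓ)` nodes and arcs.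

Programs are verified with a weakest precondition calculus that counts steps. As the statements
about a program mention only what it changes, all other registers and arrays are handled
by `Prog.Agree`, which is decided by inspection of the program text.
-/

namespace RAM

/-! ### Weakest preconditions with a step count -/

@[simp] theorem State.reg_setReg (s : State) (x v y : ℕ) :
    (s.setReg x v).reg y = if y = x then v else s.reg y := by
  simp [State.setReg, Function.update_apply]

@[simp] theorem State.arr_setReg (s : State) (x v : ℕ) : (s.setReg x v).arr = s.arr := rfl

@[simp] theorem State.reg_setArr (s : State) (a i v : ℕ) : (s.setArr a i v).reg = s.reg := rfl

@[simp] theorem State.arr_setArr (s : State) (a i v b : ℕ) :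
    (s.setArr a i v).arr b = if b = a then Function.update (s.arr a) i v else s.arr b := by
  simp [State.setArr, Function.update_apply]

/-- Started in `s`, the program `p` halts in some state `s'` after some number `t` of steps with
`Q s' t`. -/
def WP (p : Prog) (s : State) (Q : State → ℕ → Prop) : Prop :=
  ∃ s' t, Exec p s s' t ∧ Q s' t

theorem WP.mono {p : Prog} {s : State} {Q Q' : State → ℕ → Prop} (h : WP p s Q)
    (hQ : ∀ s' t, Exec p s s' t → Q s' t → Q' s' t) : WP p s Q' := by
  obtain ⟨s', t, he, hq⟩ := h
  exact ⟨s', t, he, hQ s' t he hq⟩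

@[simp] theorem wp_skip (s : State) (Q : State → ℕ → Prop) : WP .skip s Q ↔ Q s 1 :=
  ⟨fun ⟨_, _, h, hq⟩ => by cases h; exact hq, fun h => ⟨_, _, .skip s, h⟩⟩

@[simp] theorem wp_const (s : State) (x n : ℕ) (Q : State → ℕ → Prop) :
    WP (.const x n) s Q ↔ Q (s.setReg x n) 1 :=
  ⟨fun ⟨_, _, h, hq⟩ => by cases h; exact hq, fun h => ⟨_, _, .const s x n, h⟩⟩

@[simp] theorem wp_copy (s : State) (x y : ℕ) (Q : State → ℕ → Prop) :
    WP (.copy x y) s Q ↔ Q (s.setReg x (s.reg y)) 1 :=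
  ⟨fun ⟨_, _, h, hq⟩ => by cases h; exact hq, fun h => ⟨_, _, .copy s x y, h⟩⟩

@[simp] theorem wp_succ (s : State) (x : ℕ) (Q : State → ℕ → Prop) :
    WP (.succ x) s Q ↔ Q (s.setReg x (s.reg x + 1)) 1 :=
  ⟨fun ⟨_, _, h, hq⟩ => by cases h; exact hq, fun h => ⟨_, _, .succ s x, h⟩⟩

@[simp] theorem wp_pred (s : State) (x : ℕ) (Q : State → ℕ → Prop) :
    WP (.pred x) s Q ↔ Q (s.setReg x (s.reg x - 1)) 1 :=
  ⟨fun ⟨_, _, h, hq⟩ => by cases h; exact hq, fun h => ⟨_, _, .pred s x, h⟩⟩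

@[simp] theorem wp_load (s : State) (x a i : ℕ) (Q : State → ℕ → Prop) :
    WP (.load x a i) s Q ↔ Q (s.setReg x (s.arr a (s.reg i))) 1 :=
  ⟨fun ⟨_, _, h, hq⟩ => by cases h; exact hq, fun h => ⟨_, _, .load s x a i, h⟩⟩

@[simp] theorem wp_store (s : State) (a i x : ℕ) (Q : State → ℕ → Prop) :
    WP (.store a i x) s Q ↔ Q (s.setArr a (s.reg i) (s.reg x)) 1 :=
  ⟨fun ⟨_, _, h, hq⟩ => by cases h; exact hq, fun h => ⟨_, _, .store s a i x, h⟩⟩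

@[simp] theorem wp_seq (p q : Prog) (s : State) (Q : State → ℕ → Prop) :
    WP (.seq p q) s Q ↔ WP p s fun s₁ t₁ => WP q s₁ fun s₂ t₂ => Q s₂ (t₁ + t₂) := by
  constructor
  · rintro ⟨_, _, h, hq⟩
    cases h with
    | seq h₁ h₂ => exact ⟨_, _, h₁, _, _, h₂, hq⟩
  · rintro ⟨_, _, h₁, _, _, h₂, hq⟩
    exact ⟨_, _, .seq h₁ h₂, hq⟩

@[simp] theorem wp_ite (b : Test) (p q : Prog) (s : State) (Q : State → ℕ → Prop) :
    WP (.ite b p q) s Q ↔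
      (b.Holds s → WP p s fun s' t => Q s' (t + 1)) ∧
      (¬ b.Holds s → WP q s fun s' t => Q s' (t + 1)) := by
  constructor
  · rintro ⟨_, _, h, hq⟩
    cases h with
    | ite_true hb h => exact ⟨fun _ => ⟨_, _, h, hq⟩, fun hn => absurd hb hn⟩
    | ite_false hb h => exact ⟨fun hn => absurd hn hb, fun _ => ⟨_, _, h, hq⟩⟩
  · rintro ⟨h₁, h₂⟩
    by_cases hb : b.Holds s
    · obtain ⟨_, _, h, hq⟩ := h₁ hb
      exact ⟨_, _, .ite_true hb h, hq⟩
    · obtain ⟨_, _, h, hq⟩ := h₂ hb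
      exact ⟨_, _, .ite_false hb h, hq⟩

@[simp] theorem holds_eq (x y : ℕ) (s : State) : (Test.eq x y).Holds s ↔ s.reg x = s.reg y :=
  Iff.rfl

@[simp] theorem holds_lt (x y : ℕ) (s : State) : (Test.lt x y).Holds s ↔ s.reg x < s.reg y :=
  Iff.rfl

/-! ### Frames -/

/-- The program text contains no assignment to register `x`. -/
def Prog.keepsReg (x : ℕ) : Prog → Bool
  | .skip => true
  | .const y _ => y != x
  | .copy y _ => y != x
  | .succ y => y != x
  | .pred y => y != x
  | .load y _ _ => y != x
  | .store _ _ _ => true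
  | .seq p q => p.keepsReg x && q.keepsReg x
  | .ite _ p q => p.keepsReg x && q.keepsReg x
  | .loop _ p => p.keepsReg x

/-- The program text contains no assignment to a cell of array `a`. -/
def Prog.keepsArr (a : ℕ) : Prog → Bool
  | .store b _ _ => b != a
  | .seq p q => p.keepsArr a && q.keepsArr a
  | .ite _ p q => p.keepsArr a && q.keepsArr a
  | .loop _ p => p.keepsArr a
  | _ => true

/-- The program text contains no assignment to a register in `R` or to an array in `A`. -/
def Prog.keeps (R A : List ℕ) (p : Prog) : Bool :=
  R.all (fun x => p.keepsReg x) && A.all (fun a => p.keepsArr a)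

/-- The states agree on all registers and arrays to which `p` has no assignment. -/
structure Prog.Agree (p : Prog) (s s' : State) : Prop where
  reg : ∀ x, p.keepsReg x = true → s'.reg x = s.reg x
  arr : ∀ a, p.keepsArr a = true → s'.arr a = s.arr a

theorem Prog.Agree.refl (p : Prog) (s : State) : p.Agree s s := ⟨fun _ _ => rfl, fun _ _ => rfl⟩

theorem Prog.Agree.trans {p : Prog} {s₁ s₂ s₃ : State} (h : p.Agree s₁ s₂) (h' : p.Agree s₂ s₃) :
    p.Agree s₁ s₃ :=
  ⟨fun x hx => (h'.reg x hx).trans (h.reg x hx), fun a ha => (h'.arr a ha).trans (h.arr a ha)⟩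

theorem Exec.agree {p : Prog} {s s' : State} {t : ℕ} (h : Exec p s s' t) : p.Agree s s' := by
  induction h with
  | skip => exact .refl _ _
  | const s y | copy s y | succ s y | pred s y | load s y =>
    refine ⟨fun x hx => ?_, fun a _ => rfl⟩
    have : x ≠ y := by
      rintro rfl
      simp [Prog.keepsReg] at hx
    simp [State.reg_setReg, this]
  | store s b =>
    refine ⟨fun x hx => rfl, fun a ha => ?_⟩
    have : a ≠ b := by
      rintro rfl
      simp [Prog.keepsArr] at ha
    simp [State.arr_setArr, this]
  | seq _ _ h₁ h₂ =>
    refine ⟨fun x hx => ?_, fun a ha => ?_⟩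
    · simp only [Prog.keepsReg, Bool.and_eq_true] at hx
      exact (h₂.reg x hx.2).trans (h₁.reg x hx.1)
    · simp only [Prog.keepsArr, Bool.and_eq_true] at ha
      exact (h₂.arr a ha.2).trans (h₁.arr a ha.1)
  | ite_true _ _ h =>
    refine ⟨fun x hx => ?_, fun a ha => ?_⟩
    · simp only [Prog.keepsReg, Bool.and_eq_true] at hx
      exact h.reg x hx.1
    · simp only [Prog.keepsArr, Bool.and_eq_true] at ha
      exact h.arr a ha.1
  | ite_false _ _ h =>
    refine ⟨fun x hx => ?_, fun a ha => ?_⟩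
    · simp only [Prog.keepsReg, Bool.and_eq_true] at hx
      exact h.reg x hx.2
    · simp only [Prog.keepsArr, Bool.and_eq_true] at ha
      exact h.arr a ha.2
  | loop_true _ _ _ h₁ h₂ =>
    exact ⟨fun x hx => (h₂.reg x hx).trans (h₁.reg x hx),
      fun a ha => (h₂.arr a ha).trans (h₁.arr a ha)⟩
  | loop_false => exact .refl _ _

theorem Prog.Agree.reg_of_keeps {p : Prog} {s s' : State} (h : p.Agree s s') {R A : List ℕ}
    (hk : p.keeps R A = true) {x : ℕ} (hx : x ∈ R) : s'.reg x = s.reg x := by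
  simp only [Prog.keeps, Bool.and_eq_true, List.all_eq_true] at hk
  exact h.reg x (hk.1 x hx)

theorem Prog.Agree.arr_of_keeps {p : Prog} {s s' : State} (h : p.Agree s s') {R A : List ℕ}
    (hk : p.keeps R A = true) {a : ℕ} (ha : a ∈ A) : s'.arr a = s.arr a := by
  simp only [Prog.keeps, Bool.and_eq_true, List.all_eq_true] at hk
  exact h.arr a (hk.2 a ha)

/-- The states agree on the registers in `R` and on the arrays in `A`. -/
def SameOn (R A : List ℕ) (s s' : State) : Prop :=
  (∀ x ∈ R, s'.reg x = s.reg x) ∧ ∀ a ∈ A, s'.arr a = s.arr a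

theorem Prog.Agree.sameOn {p : Prog} {s s' : State} (h : p.Agree s s') {R A : List ℕ}
    (hk : p.keeps R A = true) : SameOn R A s s' :=
  ⟨fun _ hx => h.reg_of_keeps hk hx, fun _ ha => h.arr_of_keeps hk ha⟩

theorem WP.seq {p q : Prog} {s : State} {Q₁ Q : State → ℕ → Prop} (h : WP p s Q₁)
    (h' : ∀ s₁ t₁, p.Agree s s₁ → Q₁ s₁ t₁ → WP q s₁ fun s₂ t₂ => Q s₂ (t₁ + t₂)) :
    WP (.seq p q) s Q := by
  rw [wp_seq]
  exact h.mono fun s₁ t₁ he hq => h' s₁ t₁ he.agree hq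

theorem WP.imp {p : Prog} {s : State} {Q Q' : State → ℕ → Prop} (h : WP p s Q)
    (hQ : ∀ s' t, p.Agree s s' → Q s' t → Q' s' t) : WP p s Q' :=
  h.mono fun s' t he hq => hQ s' t he.agree hq

/-- The loop rule. The invariant `I s' t` speaks of the time `t` used so far; as every round takes
time, a bound on that time is all that termination needs. -/
theorem WP.loop {b : Test} {p : Prog} {s : State} {Q : State → ℕ → Prop}
    (I : State → ℕ → Prop) (B : ℕ) (h0 : I s 0) (hB : ∀ s' t, p.Agree s s' → I s' t → t ≤ B)
    (hstep : ∀ s' t, p.Agree s s' → I s' t → b.Holds s' →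
      WP p s' fun s'' t' => I s'' (t + t' + 1))
    (hend : ∀ s' t, p.Agree s s' → I s' t → ¬ b.Holds s' → Q s' (t + 1)) :
    WP (.loop b p) s Q := by
  have key : ∀ n s' t, n + t = B + 1 → p.Agree s s' → I s' t →
      ∃ s'' t', Exec (.loop b p) s' s'' t' ∧ Q s'' (t + t') := by
    intro n
    induction n using Nat.strong_induction_on with
    | _ n ih =>
      intro s' t hn ha hI
      have htB := hB s' t ha hI
      by_cases hb : b.Holds s'
      · obtain ⟨s₁, t₁, he, hI₁⟩ := hstep s' t ha hI hb
        have ha₁ := ha.trans he.agree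
        have := hB s₁ _ ha₁ hI₁
        obtain ⟨s₂, t₂, he₂, hq⟩ := ih (n - t₁ - 1) (by omega) s₁ _ (by omega) ha₁ hI₁
        refine ⟨s₂, _, .loop_true hb he he₂, ?_⟩
        rw [show t + (t₁ + t₂ + 1) = t + t₁ + 1 + t₂ by ring]
        exact hq
      · exact ⟨s', 1, .loop_false hb, hend s' t ha hI hb⟩
  obtain ⟨s'', t', he, hq⟩ := key (B + 1) s 0 rfl (.refl _ _) h0
  exact ⟨s'', t', he, by simpa using hq⟩

end RAM

namespace TwoSat

open RAM

local infixr:60 ";;" => Prog.seq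

/-! ### Skew-symmetric networks and their cuts -/

/-- A skew-symmetric network. The nodes `1, …, L` stand for literals, `comp` is negation. The arcs
are split into half-edges `1, …, H`: every arc has a half-edge along it, of capacity one, and one
against it, of capacity zero, and `rev` exchanges the two. The mirror image `mir` of an arc from `u`
to `v` is an arc from `comp v` to `comp u`. -/
structure Net where
  L : ℕ
  H : ℕ
  comp : ℕ → ℕ
  src : ℕ → ℕ
  tgt : ℕ → ℕ
  rev : ℕ → ℕ
  mir : ℕ → ℕ
  cap : ℕ → ℕ
  /-- the half-edges that leave a node -/
  adj : ℕ → List ℕ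
  comp_mem : ∀ v ∈ Finset.Icc 1 L, comp v ∈ Finset.Icc 1 L
  comp_comp : ∀ v ∈ Finset.Icc 1 L, comp (comp v) = v
  comp_ne : ∀ v ∈ Finset.Icc 1 L, comp v ≠ v
  src_mem : ∀ h ∈ Finset.Icc 1 H, src h ∈ Finset.Icc 1 L
  tgt_mem : ∀ h ∈ Finset.Icc 1 H, tgt h ∈ Finset.Icc 1 L
  rev_mem : ∀ h ∈ Finset.Icc 1 H, rev h ∈ Finset.Icc 1 H
  rev_rev : ∀ h ∈ Finset.Icc 1 H, rev (rev h) = h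
  rev_ne : ∀ h ∈ Finset.Icc 1 H, rev h ≠ h
  src_rev : ∀ h ∈ Finset.Icc 1 H, src (rev h) = tgt h
  tgt_rev : ∀ h ∈ Finset.Icc 1 H, tgt (rev h) = src h
  cap_rev : ∀ h ∈ Finset.Icc 1 H, cap h + cap (rev h) = 1
  mir_mem : ∀ h ∈ Finset.Icc 1 H, mir h ∈ Finset.Icc 1 H
  mir_mir : ∀ h ∈ Finset.Icc 1 H, mir (mir h) = h
  src_mir : ∀ h ∈ Finset.Icc 1 H, src (mir h) = comp (tgt h)
  tgt_mir : ∀ h ∈ Finset.Icc 1 H, tgt (mir h) = comp (src h)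
  cap_mir : ∀ h ∈ Finset.Icc 1 H, cap (mir h) = cap h
  mem_adj : ∀ v e, e ∈ adj v ↔ e ∈ Finset.Icc 1 H ∧ src e = v
  sum_adj : ∑ v ∈ Finset.Icc 1 L, (adj v).length ≤ H

namespace Net

variable (G : Net)

/-- The finite set of nodes. -/
abbrev nodes : Finset ℕ := Finset.Icc 1 G.L

/-- The finite set of half-edges. -/
abbrev edges : Finset ℕ := Finset.Icc 1 G.H

open Classical in
/-- The number of half-edges with residual capacity one that leave the set `X`. -/
noncomputable def cut (res : ℕ → ℕ) (X : Set ℕ) : ℕ :=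
  ∑ h ∈ G.edges, if res h = 1 ∧ G.src h ∈ X ∧ G.tgt h ∉ X then 1 else 0

/-- No half-edge with residual capacity one leaves the set `X`. -/
def Closed (res : ℕ → ℕ) (X : Set ℕ) : Prop :=
  ∀ h ∈ G.edges, res h = 1 → G.src h ∈ X → G.tgt h ∈ X

/-- The set `X` contains the literals of `A` and none of their negations. -/
def Sep (A : List ℕ) (X : Set ℕ) : Prop := ∀ a ∈ A, a ∈ X ∧ G.comp a ∉ X

/-- The literals whose negations are not in `X`. -/
def star (X : Set ℕ) : Set ℕ := {v | G.comp v ∉ X}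

/-- `res` is the residual network of a flow of value `val` from the literals of `A` to their
negations. Instead of conservation at the nodes, the effect of the flow on the cuts is recorded. -/
structure Flow (A : List ℕ) (res : ℕ → ℕ) (val : ℕ) : Prop where
  res_rev : ∀ h ∈ G.edges, res h + res (G.rev h) = 1
  cut_add : ∀ X, G.Sep A X → G.cut res X + val = G.cut G.cap X

/-- `Y` contains exactly one literal of each variable, that is, it is a truth assignment. -/
def Complete (Y : Set ℕ) : Prop := ∀ v ∈ G.nodes, (v ∈ Y ↔ G.comp v ∉ Y)

variable {G}

theorem cut_eq_zero_iff {res : ℕ → ℕ} {X : Set ℕ} : G.cut res X = 0 ↔ G.Closed res X := by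
  classical
  simp only [cut, Closed, Finset.sum_eq_zero_iff]
  refine forall₂_congr fun h _ => ?_
  rw [ite_eq_right_iff]
  simp only [one_ne_zero, imp_false]
  tauto

theorem cut_star (X : Set ℕ) : G.cut G.cap (G.star X) = G.cut G.cap X := by
  classical
  refine Finset.sum_nbij' G.mir G.mir G.mir_mem G.mir_mem G.mir_mir G.mir_mir fun h hh => ?_
  rw [G.src_mir h hh, G.tgt_mir h hh, G.cap_mir h hh]
  simp only [star, Set.mem_ofPred_eq, not_not]
  congr 1
  rw [and_comm (a := G.comp (G.tgt h) ∈ X)]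

theorem sep_star {A : List ℕ} (hA : ∀ a ∈ A, a ∈ G.nodes) {X : Set ℕ} (h : G.Sep A X) :
    G.Sep A (G.star X) := by
  intro a ha
  refine ⟨(h a ha).2, ?_⟩
  simp only [star, Set.mem_ofPred_eq, not_not, G.comp_comp a (hA a ha)]
  exact (h a ha).1

theorem flow_zero (A : List ℕ) {res : ℕ → ℕ} (h : ∀ e ∈ G.edges, res e = G.cap e) :
    G.Flow A res 0 := by
  classical
  refine ⟨fun e he => ?_, fun X _ => ?_⟩
  · rw [h e he, h _ (G.rev_mem e he), G.cap_rev e he]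
  · rw [add_zero]
    refine Finset.sum_congr rfl fun e he => ?_
    rw [h e he]

namespace Flow

variable {A : List ℕ} {res : ℕ → ℕ} {val : ℕ}

theorem le_cut (hF : G.Flow A res val) {X : Set ℕ} (hX : G.Sep A X) : val ≤ G.cut G.cap X := by
  have := hF.cut_add X hX
  omega

theorem closed_iff (hF : G.Flow A res val) {X : Set ℕ} (hX : G.Sep A X) :
    G.Closed res X ↔ G.cut G.cap X = val := by
  rw [← cut_eq_zero_iff]
  have := hF.cut_add X hX
  omega

theorem closed_star (hF : G.Flow A res val) (hA : ∀ a ∈ A, a ∈ G.nodes) {X : Set ℕ}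
    (hX : G.Sep A X) (hc : G.Closed res X) : G.Closed res (G.star X) := by
  rw [hF.closed_iff (sep_star hA hX), cut_star]
  exact (hF.closed_iff hX).1 hc

end Flow

open Classical in
/-- Pushing one unit of flow through the half-edge `e`. -/
theorem cut_push {res : ℕ → ℕ} {e : ℕ} (he : e ∈ G.edges) (h1 : res e = 1)
    (h0 : res (G.rev e) = 0) (X : Set ℕ) :
    (G.cut (Function.update (Function.update res e 0) (G.rev e) 1) X : ℤ)
      + (if G.src e ∈ X then 1 else 0) = G.cut res X + (if G.tgt e ∈ X then 1 else 0) := by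
  have hr := G.rev_mem e he
  have hne := G.rev_ne e he
  have hr' : G.rev e ∈ G.edges.erase e := Finset.mem_erase.2 ⟨hne, hr⟩
  unfold cut
  rw [← Finset.add_sum_erase _ _ he, ← Finset.add_sum_erase _ _ hr',
    ← Finset.add_sum_erase G.edges _ he, ← Finset.add_sum_erase _ _ hr']
  have hs : ∀ x ∈ (G.edges.erase e).erase (G.rev e),
      Function.update (Function.update res e 0) (G.rev e) 1 x = res x := by
    intro x hx
    simp only [Finset.mem_erase] at hx
    rw [Function.update_of_ne hx.1, Function.update_of_ne hx.2.1]
  rw [Finset.sum_congr rfl fun x hx => by rw [hs x hx]]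
  rw [Function.update_of_ne hne.symm, Function.update_self, Function.update_self, h1, h0,
    G.src_rev e he, G.tgt_rev e he]
  push_cast
  by_cases ha : G.src e ∈ X <;> by_cases hb : G.tgt e ∈ X <;> simp [ha, hb] <;> ring

theorem push_res_rev {res : ℕ → ℕ} (h : ∀ h ∈ G.edges, res h + res (G.rev h) = 1) {e : ℕ}
    (he : e ∈ G.edges) : ∀ h ∈ G.edges,
      Function.update (Function.update res e 0) (G.rev e) 1 h +
        Function.update (Function.update res e 0) (G.rev e) 1 (G.rev h) = 1 := by
  intro x hx
  by_cases h1 : x = G.rev e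
  · subst h1
    rw [G.rev_rev e he, Function.update_self, Function.update_of_ne (G.rev_ne e he).symm,
      Function.update_self]
  · by_cases h2 : x = e
    · subst h2
      rw [Function.update_self, Function.update_of_ne h1, Function.update_self]
    · have h3 : G.rev x ≠ e := fun h' => h1 (by rw [← h', G.rev_rev x hx])
      have h4 : G.rev x ≠ G.rev e := fun h' => h2 (by
        rw [← G.rev_rev x hx, h', G.rev_rev e he])
      rw [Function.update_of_ne h1, Function.update_of_ne h2, Function.update_of_ne h4,
        Function.update_of_ne h3, h x hx]

/-- The cost of exploring the nodes of a list: one unit for each of them, and one for each half-edge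
that leaves them. -/
def work (G : Net) (l : List ℕ) : ℕ := (l.map fun v => (G.adj v).length + 1).sum

theorem work_append (l l' : List ℕ) : G.work (l ++ l') = G.work l + G.work l' := by
  simp [work]

theorem work_eq_sum {l : List ℕ} (hl : l.Nodup) :
    G.work l = ∑ v ∈ l.toFinset, ((G.adj v).length + 1) := by
  rw [work, List.sum_toFinset _ hl]

theorem work_le {l : List ℕ} (hl : l.Nodup) (hm : ∀ v ∈ l, v ∈ G.nodes) :
    G.work l ≤ G.L + G.H := by
  rw [work_eq_sum hl]
  calc ∑ v ∈ l.toFinset, ((G.adj v).length + 1)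
      ≤ ∑ v ∈ G.nodes, ((G.adj v).length + 1) :=
        Finset.sum_le_sum_of_subset fun v hv => hm v (List.mem_toFinset.1 hv)
    _ ≤ G.L + G.H := by
        rw [Finset.sum_add_distrib]
        have := G.sum_adj
        simp only [Finset.sum_const, Nat.card_Icc, nodes, smul_eq_mul, mul_one,
          Nat.add_sub_cancel]
        omega

theorem length_le {l : List ℕ} (hl : l.Nodup) (hm : ∀ v ∈ l, v ∈ G.nodes) : l.length ≤ G.L := by
  rw [← List.toFinset_card_of_nodup hl]
  calc l.toFinset.card ≤ G.nodes.card :=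
        Finset.card_le_card fun v hv => hm v (List.mem_toFinset.1 hv)
    _ = G.L := by simp

end Net

/-! ### Graph search -/

/-- The state of a graph search: the list `q` of the nodes found so far, in the order in which they
were found, the number `h` of the nodes whose half-edges have been taken up, the half-edges `rem` of
the last of them that are yet to be inspected, the half-edge `par v` through which `v` was found,
and the status `st`: running (`0`), stopped by a conflict (`1`), or exhausted (`2`). -/
structure Srch where
  q : List ℕ
  h : ℕ
  rem : List ℕ
  par : ℕ → ℕ
  st : ℕ

namespace Srch

variable (G : Net) (res asg : ℕ → ℕ) (bad : List ℕ → Set ℕ)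

open Classical in
/-- One step of a search in the residual network `res`, which does not enter the nodes `v` with
`asg v ≠ 0`, and which stops as soon as it finds a literal whose negation is in `bad q`. -/
noncomputable def step (σ : Srch) : Srch :=
  match σ.rem with
  | [] => if h : σ.h < σ.q.length then { σ with h := σ.h + 1, rem := G.adj σ.q[σ.h] }
      else { σ with st := 2 }
  | e :: r =>
      if res e = 1 ∧ asg (G.tgt e) = 0 ∧ G.tgt e ∉ σ.q then
        { σ with
          q := σ.q ++ [G.tgt e]
          rem := r
          par := Function.update σ.par (G.tgt e) e
          st := if G.comp (G.tgt e) ∈ bad (σ.q ++ [G.tgt e]) then 1 else σ.st }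
      else { σ with rem := r }

/-- The invariant of a search from the nodes in `start` after `N` steps. -/
structure Inv (start : List ℕ) (σ : Srch) (N : ℕ) : Prop where
  mem_nodes : ∀ v ∈ σ.q, v ∈ G.nodes
  asg_eq : ∀ v ∈ σ.q, asg v = 0
  nodup : σ.q.Nodup
  h_le : σ.h ≤ σ.q.length
  rem_edges : ∀ e ∈ σ.rem, e ∈ G.edges ∧ ∃ (i : ℕ) (hi : i < σ.q.length), G.src e = σ.q[i]
  explored : ∀ (i : ℕ) (hi : i < σ.q.length), i < σ.h → ∀ e ∈ G.adj σ.q[i], res e = 1 →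
    G.tgt e ∈ σ.q ∨ asg (G.tgt e) ≠ 0 ∨ e ∈ σ.rem
  prefix_q : start <+: σ.q
  parent : ∀ (i : ℕ) (hi : i < σ.q.length), start.length ≤ i →
    σ.par σ.q[i] ∈ G.edges ∧ res (σ.par σ.q[i]) = 1 ∧ G.tgt (σ.par σ.q[i]) = σ.q[i] ∧
      ∃ (j : ℕ) (hj : j < i), G.src (σ.par σ.q[i]) = σ.q[j]
  work_le : N + σ.rem.length + G.work (σ.q.drop σ.h) ≤
    G.work σ.q + if σ.st = 2 then 1 else 0
  exhausted : σ.st = 2 → σ.h = σ.q.length ∧ σ.rem = []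
  st_le : σ.st ≤ 2

/-- The search from the nodes in `start` before its first step. -/
def init (start : List ℕ) (par : ℕ → ℕ) : Srch := ⟨start, 0, [], par, 0⟩

variable {G res asg bad} {start : List ℕ} {σ : Srch} {N : ℕ}

theorem Inv.init (hn : start.Nodup) (hm : ∀ v ∈ start, v ∈ G.nodes)
    (ha : ∀ v ∈ start, asg v = 0) (par : ℕ → ℕ) : Inv G res asg start (init start par) 0 where
  mem_nodes := hm
  asg_eq := ha
  nodup := hn
  h_le := Nat.zero_le _
  rem_edges := by simp [Srch.init]
  explored := by simp [Srch.init]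
  prefix_q := List.prefix_rfl
  parent i hi h := by
    simp only [Srch.init] at hi
    omega
  work_le := by simp [Srch.init]
  exhausted := by simp [Srch.init]
  st_le := by simp [Srch.init]

open Classical in
theorem Inv.step (hI : Inv G res asg start σ N) (h0 : σ.st = 0) :
    Inv G res asg start (σ.step G res asg bad) (N + 1) := by
  obtain ⟨q, h, rem, par, st⟩ := σ
  obtain ⟨h1, h2, h3, h4, h5, h6, h7, h8, h9, h10, h11⟩ := hI
  simp only at h1 h2 h3 h4 h5 h6 h7 h8 h9 h10 h11 h0
  subst h0
  simp only [OfNat.zero_ne_ofNat, ite_false] at h9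
  cases rem with
  | nil =>
    by_cases hh : h < q.length
    · simp only [Srch.step, hh, dite_true]
      refine ⟨h1, h2, h3, hh, ?_, ?_, h7, h8, ?_, by simp, by simp⟩
      · intro e he
        have := (G.mem_adj _ _).1 he
        exact ⟨this.1, h, hh, this.2⟩
      · intro i hi hih e he hr
        rcases Nat.lt_succ_iff_lt_or_eq.1 hih with h' | h'
        · have := h6 i hi h' e he hr
          simp only [List.not_mem_nil, or_false] at this
          tauto
        · subst h'
          exact Or.inr (Or.inr he)
      · simp only [OfNat.zero_ne_ofNat, ite_false]
        rw [List.drop_eq_getElem_cons hh] at h9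
        simp only [Net.work, List.map_cons, List.sum_cons, List.length_nil] at h9 ⊢
        omega
    · simp only [Srch.step, hh, dite_false]
      refine ⟨h1, h2, h3, h4, h5, h6, h7, h8, ?_, fun _ => ⟨le_antisymm h4 (not_lt.1 hh), rfl⟩,
        le_refl _⟩
      simp only [ite_true]
      omega
  | cons e r =>
    obtain ⟨he, i₀, hi₀, hs⟩ := h5 e (by simp)
    by_cases hc : res e = 1 ∧ asg (G.tgt e) = 0 ∧ G.tgt e ∉ q
    · simp only [Srch.step, hc, not_false_eq_true, and_self, ite_true]
      have hst : (if G.comp (G.tgt e) ∈ bad (q ++ [G.tgt e]) then 1 else 0) ≤ 1 := by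
        split_ifs <;> omega
      generalize (if G.comp (G.tgt e) ∈ bad (q ++ [G.tgt e]) then 1 else 0) = st' at hst ⊢
      refine ⟨?_, ?_, ?_, ?_, ?_, ?_, ?_, ?_, ?_, ?_, ?_⟩
      · intro v hv
        rcases List.mem_append.1 hv with hv | hv
        · exact h1 v hv
        · rw [List.mem_singleton.1 hv]
          exact G.tgt_mem e he
      · intro v hv
        rcases List.mem_append.1 hv with hv | hv
        · exact h2 v hv
        · rw [List.mem_singleton.1 hv]
          exact hc.2.1
      · rw [List.nodup_append]
        refine ⟨h3, List.nodup_singleton _, fun a ha b hb => ?_⟩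
        rw [List.mem_singleton.1 hb]
        rintro rfl
        exact hc.2.2 ha
      · simp only [List.length_append]
        omega
      · intro e' he'
        obtain ⟨h, i, hi, hs⟩ := h5 e' (by simp [he'])
        refine ⟨h, i, by simp; omega, ?_⟩
        rw [hs, List.getElem_append_left hi]
      · intro i hi hih e' he' hr
        have hi' : i < q.length := lt_of_lt_of_le hih h4
        rw [List.getElem_append_left hi'] at he'
        rcases h6 i hi' hih e' he' hr with h | h | h
        · exact Or.inl (List.mem_append_left _ h)
        · exact Or.inr (Or.inl h)
        · rcases List.mem_cons.1 h with rfl | h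
          · exact Or.inl (by simp)
          · exact Or.inr (Or.inr h)
      · exact h7.trans (List.prefix_append _ _)
      · intro i hi hsi
        by_cases hi' : i < q.length
        · have hne : q[i] ≠ G.tgt e := fun h => hc.2.2 (h ▸ List.getElem_mem hi')
          obtain ⟨a, b, c, j, hj, d⟩ := h8 i hi' hsi
          simp only [List.getElem_append_left hi', Function.update_of_ne hne]
          refine ⟨a, b, c, j, hj, ?_⟩
          rw [d, List.getElem_append_left]
        · have hi2 : i = q.length := by
            simp at hi
            omega
          subst hi2
          simp only [List.getElem_append_right (le_refl _), Nat.sub_self,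
            List.getElem_cons_zero, Function.update_self, true_and]
          refine ⟨he, hc.1, i₀, hi₀, ?_⟩
          rw [hs, List.getElem_append_left]
      · rw [List.drop_append_of_le_length h4, Net.work_append, Net.work_append]
        simp only [List.length_cons] at h9 ⊢
        rw [if_neg (by omega)]
        omega
      · intro h
        simp only at h
        omega
      · simp only
        omega
    · simp only [Srch.step, hc, ite_false]
      refine ⟨h1, h2, h3, h4, fun e' he' => h5 e' (by simp [he']), ?_, h7, h8, ?_, by simp,
        by simp⟩
      · intro i hi hih e' he' hr
        rcases h6 i hi hih e' he' hr with h | h | h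
        · exact Or.inl h
        · exact Or.inr (Or.inl h)
        · rcases List.mem_cons.1 h with rfl | h
          · by_cases h' : asg (G.tgt e') = 0
            · exact Or.inl (by_contra fun h'' => hc ⟨hr, h', h''⟩)
            · exact Or.inr (Or.inl h')
          · exact Or.inr (Or.inr h)
      · simp only [List.length_cons, OfNat.zero_ne_ofNat, ite_false] at h9 ⊢
        omega

theorem Inv.le_work (hI : Inv G res asg start σ N) : N ≤ G.work σ.q + 1 := by
  have := hI.work_le
  split_ifs at this <;> omega

theorem Inv.lt_work (hI : Inv G res asg start σ N) (h : σ.st ≠ 2) : N ≤ G.work σ.q := by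
  have := hI.work_le
  rw [if_neg h] at this
  omega

theorem Inv.work_le_size (hI : Inv G res asg start σ N) : G.work σ.q ≤ G.L + G.H :=
  Net.work_le hI.nodup hI.mem_nodes

/-- Everything found lies in each closed set that contains the nodes where the search began. -/
theorem Inv.subset_of_closed (hI : Inv G res asg start σ N) {X : Set ℕ} (hX : G.Closed res X)
    (hs : ∀ v ∈ start, v ∈ X) : ∀ v ∈ σ.q, v ∈ X := by
  have key : ∀ (i : ℕ) (hi : i < σ.q.length), σ.q[i] ∈ X := by
    intro i
    induction i using Nat.strong_induction_on with
    | _ i ih =>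
      intro hi
      by_cases h : start.length ≤ i
      · obtain ⟨a, b, c, j, hj, d⟩ := hI.parent i hi h
        rw [← c]
        exact hX _ a b (d ▸ ih j hj (by omega))
      · obtain ⟨t, ht⟩ := hI.prefix_q
        have : σ.q[i] = start[i] := by
          simp only [← ht]
          exact List.getElem_append_left _
        rw [this]
        exact hs _ (List.getElem_mem _)
  intro v hv
  obtain ⟨i, hi, rfl⟩ := List.getElem_of_mem hv
  exact key i hi

theorem Inv.closed (hI : Inv G res asg start σ N) (h : σ.st = 2)
    (hY : G.Closed res {v | asg v ≠ 0}) : G.Closed res {v | asg v ≠ 0 ∨ v ∈ σ.q} := by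
  intro e he hr hs
  obtain ⟨h1, h2⟩ := hI.exhausted h
  rcases hs with hs | hs
  · exact Or.inl (hY e he hr hs)
  · obtain ⟨i, hi, hq⟩ := List.getElem_of_mem hs
    have := hI.explored i hi (by omega) e ((G.mem_adj _ _).2 ⟨he, hq.symm⟩) hr
    simp only [h2, List.not_mem_nil, or_false] at this
    exact this.symm

/-- What a step does to the list of found nodes and to the status. -/
theorem step_cases (h0 : σ.st = 0) :
    ((σ.step G res asg bad).q = σ.q ∧
      ((σ.step G res asg bad).st = 0 ∨ (σ.step G res asg bad).st = 2)) ∨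
    ∃ u, (σ.step G res asg bad).q = σ.q ++ [u] ∧ (∃ e ∈ σ.rem, u = G.tgt e) ∧
      (G.comp u ∈ bad (σ.q ++ [u]) ∧ (σ.step G res asg bad).st = 1 ∨
        G.comp u ∉ bad (σ.q ++ [u]) ∧ (σ.step G res asg bad).st = 0) := by
  obtain ⟨q, h, rem, par, st⟩ := σ
  simp only at h0
  subst h0
  cases rem with
  | nil =>
    left
    simp only [step]
    split_ifs <;> simp
  | cons e r =>
    simp only [step]
    split_ifs with h1 h2
    · exact Or.inr ⟨_, rfl, ⟨e, by simp, rfl⟩, Or.inl ⟨h2, rfl⟩⟩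
    · exact Or.inr ⟨_, rfl, ⟨e, by simp, rfl⟩, Or.inr ⟨h2, rfl⟩⟩
    · simp

/-- A search for a contradiction: `bad q` is `q` itself. As long as it does not stop with a
conflict, the found literals are consistent. -/
theorem consistent_step (hI : Inv G res asg start σ N) (h0 : σ.st = 0)
    (hc : ∀ v ∈ σ.q, G.comp v ∉ σ.q) (σ' : Srch)
    (hσ' : σ' = σ.step G res asg fun q => {v | v ∈ q}) :
    (σ'.st = 1 → ∃ v ∈ σ'.q, G.comp v ∈ σ'.q) ∧
      (σ'.st ≠ 1 → ∀ v ∈ σ'.q, G.comp v ∉ σ'.q) := by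
  rcases step_cases (G := G) (res := res) (asg := asg) (bad := fun q => {v | v ∈ q}) h0 with
    ⟨h1, h2⟩ | ⟨u, h1, ⟨e, he, hu⟩, ⟨h2, h3⟩ | ⟨h2, h3⟩⟩
  · rw [← hσ'] at h1 h2
    rw [h1]
    exact ⟨fun h => by omega, fun _ => hc⟩
  · rw [← hσ'] at h1 h3
    rw [h1, h3]
    exact ⟨fun _ => ⟨u, by simp, h2⟩, fun h => absurd rfl h⟩
  · rw [← hσ'] at h1 h3
    rw [h1, h3]
    refine ⟨fun h => by omega, fun _ v hv hv' => ?_⟩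
    have hun : u ∈ G.nodes := hu ▸ G.tgt_mem e (hI.rem_edges e he).1
    simp only [Set.mem_ofPred_eq] at h2
    rcases List.mem_append.1 hv with hv | hv
    · rcases List.mem_append.1 hv' with hv' | hv'
      · exact hc v hv hv'
      · rw [List.mem_singleton] at hv'
        apply h2
        rw [← hv', G.comp_comp v (hI.mem_nodes v hv)]
        exact List.mem_append_left _ hv
    · rw [List.mem_singleton.1 hv] at hv'
      exact h2 hv'

/-- A search for an augmenting path: `bad q` is `A`. As long as it does not stop with a conflict, no
found literal is the negation of a literal of `A`. -/
theorem avoid_step {A : List ℕ} (h0 : σ.st = 0) (hc : ∀ v ∈ σ.q, G.comp v ∉ A) (σ' : Srch)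
    (hσ' : σ' = σ.step G res asg fun _ => {v | v ∈ A}) :
    (σ'.st = 1 → ∃ u, σ'.q = σ.q ++ [u] ∧ G.comp u ∈ A) ∧
      (σ'.st ≠ 1 → ∀ v ∈ σ'.q, G.comp v ∉ A) := by
  rcases step_cases (G := G) (res := res) (asg := asg) (bad := fun _ => {v | v ∈ A}) h0 with
    ⟨h1, h2⟩ | ⟨u, h1, ⟨e, he, hu⟩, ⟨h2, h3⟩ | ⟨h2, h3⟩⟩
  · rw [← hσ'] at h1 h2
    rw [h1]
    exact ⟨fun h => by omega, fun _ => hc⟩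
  · rw [← hσ'] at h1 h3
    rw [h1, h3]
    exact ⟨fun _ => ⟨u, rfl, h2⟩, fun h => absurd rfl h⟩
  · rw [← hσ'] at h1 h3
    rw [h1, h3]
    refine ⟨fun h => by omega, fun _ v hv => ?_⟩
    rcases List.mem_append.1 hv with hv | hv
    · exact hc v hv
    · rw [List.mem_singleton.1 hv]
      exact h2

end Srch

/-! ### Augmenting paths, closed sets and branching -/

namespace Srch

variable {G : Net} {res asg : ℕ → ℕ} {start : List ℕ} {σ : Srch} {N : ℕ}

open Classical in
/-- The flow `res` has been changed to `res'` along the part of the search path behind the node with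
number `p`. -/
structure Aug (G : Net) (σ : Srch) (res : ℕ → ℕ) (last p : ℕ) (res' : ℕ → ℕ) : Prop where
  lt : p < σ.q.length
  unchanged : ∀ e ∈ G.edges, ∀ (i j : ℕ) (hi : i ≤ p) (hj : j ≤ p),
    G.src e = σ.q[i] → G.tgt e = σ.q[j] → res' e = res e
  res_rev : ∀ h ∈ G.edges, res' h + res' (G.rev h) = 1
  cut_eq : ∀ X : Set ℕ, G.cut res' X + (if σ.q[p] ∈ X then 1 else 0) =
    G.cut res X + if last ∈ X then 1 else 0

theorem Aug.refl (h : ∀ h ∈ G.edges, res h + res (G.rev h) = 1) {p : ℕ} (hp : p < σ.q.length) :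
    Aug G σ res σ.q[p] p res :=
  ⟨hp, fun _ _ _ _ _ _ _ _ => rfl, h, fun _ => rfl⟩

theorem Aug.push {last p : ℕ} {res' : ℕ → ℕ} (hI : Inv G res asg start σ N)
    (ha : Aug G σ res last p res') (hp : start.length ≤ p) :
    σ.par (σ.q[p]'ha.lt) ∈ G.edges ∧ ∃ (j : ℕ) (hj : j < p),
      G.src (σ.par (σ.q[p]'ha.lt)) = σ.q[j]'(hj.trans ha.lt) ∧
      Aug G σ res last j (Function.update (Function.update res' (σ.par (σ.q[p]'ha.lt)) 0)
        (G.rev (σ.par (σ.q[p]'ha.lt))) 1) := by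
  classical
  have hlt := ha.lt
  obtain ⟨he, hr, ht, j, hj, hs⟩ := hI.parent p ha.lt hp
  refine ⟨he, j, hj, hs, hj.trans ha.lt, ?_, Net.push_res_rev ha.res_rev he, ?_⟩
  · intro x hx i k hi hk hsx htx
    have hne : ∀ i (hi : i ≤ j), σ.q[i] ≠ σ.q[p] := by
      intro i hi h
      have := (hI.nodup.getElem_inj_iff).1 h
      omega
    have h1 : x ≠ σ.par σ.q[p] := by
      rintro rfl
      exact hne k hk (htx.symm.trans ht)
    have h2 : x ≠ G.rev (σ.par σ.q[p]) := by
      rintro rfl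
      rw [G.src_rev _ he] at hsx
      exact hne i hi (hsx.symm.trans ht)
    rw [Function.update_of_ne h2, Function.update_of_ne h1]
    exact ha.unchanged x hx i k (by omega) (by omega) hsx htx
  · intro X
    have h1 : res' (σ.par σ.q[p]) = 1 := by
      rw [ha.unchanged _ he j p hj.le le_rfl hs ht, hr]
    have h0 : res' (G.rev (σ.par σ.q[p])) = 0 := by
      have := ha.res_rev _ he
      omega
    have h2 := Net.cut_push he h1 h0 X
    have h3 := ha.cut_eq X
    rw [hs, ht] at h2
    zify at h3 ⊢
    linarith

theorem Inv.mem_start_iff (hI : Inv G res asg start σ N) {p : ℕ} (hp : p < σ.q.length) :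
    σ.q[p] ∈ start ↔ p < start.length := by
  obtain ⟨t, ht⟩ := hI.prefix_q
  have hn := hI.nodup
  constructor
  · intro h
    obtain ⟨i, hi, h⟩ := List.getElem_of_mem h
    have : σ.q[i]'(by rw [← ht]; simp; omega) = σ.q[p] := by
      rw [← h]
      simp only [← ht]
      exact List.getElem_append_left _
    have := (hn.getElem_inj_iff).1 this
    omega
  · intro h
    have : σ.q[p] = start[p] := by
      simp only [← ht]
      exact List.getElem_append_left _
    rw [this]
    exact List.getElem_mem _

/-- Flow that has been pushed along a whole search path has grown by one unit. -/
theorem Aug.flow {A : List ℕ} {val last p : ℕ} {res' : ℕ → ℕ} (hF : G.Flow A res val)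
    (hI : Inv G res asg A σ N) (ha : Aug G σ res last p res') (hp : p < A.length)
    (hl : last ∈ G.nodes) (hA : G.comp last ∈ A) : G.Flow A res' (val + 1) := by
  refine ⟨ha.res_rev, fun X hX => ?_⟩
  have h1 := ha.cut_eq X
  have h2 : σ.q[p]'ha.lt ∈ X := (hX _ ((hI.mem_start_iff ha.lt).2 hp)).1
  have h3 : last ∉ X := by
    have := (hX _ hA).2
    rwa [G.comp_comp _ hl] at this
  rw [if_pos h2, if_neg h3] at h1
  have := hF.cut_add X hX
  omega

end Srch

/-- `Y` is a consistent set of literals that contains `A`, and no half-edge of the residual network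
leaves it; it is thus a minimum cut. -/
structure Net.Partial (G : Net) (A : List ℕ) (res : ℕ → ℕ) (Y : Set ℕ) : Prop where
  closed : G.Closed res Y
  sep : G.Sep A Y
  consistent : ∀ v ∈ G.nodes, v ∈ Y → G.comp v ∉ Y

namespace Srch

variable {G : Net} {A : List ℕ} {res asg : ℕ → ℕ} {val : ℕ} {start : List ℕ} {σ : Srch} {N : ℕ}

/-- The nodes that an exhausted search for an augmenting path has found are consistent, as their
star is also a minimum cut. -/
theorem Inv.partial_found (hI : Inv G res asg A σ N) (hF : G.Flow A res val) (h2 : σ.st = 2)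
    (h0 : ∀ v, asg v = 0 ∨ v ∉ G.nodes) (hc : ∀ v ∈ σ.q, G.comp v ∉ A) :
    G.Partial A res {v | v ∈ σ.q} := by
  have hsub := hI.prefix_q.subset
  have hA : ∀ a ∈ A, a ∈ G.nodes := fun a ha => hI.mem_nodes a (hsub ha)
  have hcl : G.Closed res {v | v ∈ σ.q} := by
    intro e he hr hs
    obtain ⟨h1, h3⟩ := hI.exhausted h2
    obtain ⟨i, hi, hq⟩ := List.getElem_of_mem hs
    have := hI.explored i hi (by omega) e ((G.mem_adj _ _).2 ⟨he, hq.symm⟩) hr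
    rcases h0 (G.tgt e) with h | h
    · simpa [h3, h] using this
    · exact absurd (G.tgt_mem e he) h
  have hsep : G.Sep A {v | v ∈ σ.q} := by
    intro a ha
    refine ⟨hsub ha, fun h => hc _ h ?_⟩
    rwa [G.comp_comp a (hA a ha)]
  refine ⟨hcl, hsep, fun v _ hv => ?_⟩
  exact hI.subset_of_closed (hF.closed_star hA hsep hcl)
    (fun a ha => (Net.sep_star hA hsep a ha).1) v hv

/-- A consistent minimum cut stays one when the result of a successful search is added to it. -/
theorem Inv.partial_union {x : ℕ} (hI : Inv G res asg [x] σ N) (hF : G.Flow A res val)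
    (hA : ∀ a ∈ A, a ∈ G.nodes) (hY : G.Partial A res {v | asg v ≠ 0}) (h2 : σ.st = 2)
    (hx : asg (G.comp x) = 0) (hc : ∀ v ∈ σ.q, G.comp v ∉ σ.q) :
    G.Partial A res {v | asg v ≠ 0 ∨ v ∈ σ.q} := by
  have hst : ∀ v ∈ σ.q, asg (G.comp v) = 0 := by
    intro v hv
    have := hI.subset_of_closed (hF.closed_star hA hY.sep hY.closed) (by simp [Net.star, hx]) v hv
    simpa [Net.star] using this
  refine ⟨hI.closed h2 hY.closed, fun a ha => ⟨Or.inl (hY.sep a ha).1, ?_⟩, ?_⟩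
  · rintro (h | h)
    · exact (hY.sep a ha).2 h
    · have := hst _ h
      rw [G.comp_comp a (hA a ha)] at this
      exact (hY.sep a ha).1 this
  · rintro v hv (h | h) (h' | h')
    · exact hY.consistent v hv h h'
    · have := hst _ h'
      rw [G.comp_comp v hv] at this
      exact h this
    · exact h' (hst v h)
    · exact hc v h h'

/-- If the search from `x` finds a contradiction, then forcing `x` makes the minimum cut larger. -/
theorem Inv.lt_cut {x : ℕ} (hI : Inv G res asg [x] σ N) (hF : G.Flow A res val)
    (hA : ∀ a ∈ A, a ∈ G.nodes) (hc : ∃ v ∈ σ.q, G.comp v ∈ σ.q) {X : Set ℕ} (hX : G.Sep A X)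
    (hx : x ∈ X) (hx' : G.comp x ∉ X) : val + 1 ≤ G.cut G.cap X := by
  have h1 := hF.le_cut hX
  by_contra hlt
  have h2 : G.Closed res X := (hF.closed_iff hX).2 (by omega)
  have h3 := hF.closed_star hA hX h2
  obtain ⟨v, hv, hv'⟩ := hc
  have h4 := hI.subset_of_closed h2 (by simpa using hx) _ hv'
  have h5 := hI.subset_of_closed h3 (by simpa [Net.star] using hx') _ hv
  exact h5 h4

end Srch

/-! ### Registers and arrays -/

/-- The linked list that starts at `e` and continues with `nxt`, where `0` marks the end, is `l`. -/
def IsChain (nxt : ℕ → ℕ) : ℕ → List ℕ → Prop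
  | e, [] => e = 0
  | e, x :: l => e = x ∧ x ≠ 0 ∧ IsChain nxt (nxt x) l

theorem IsChain.congr {nxt nxt' : ℕ → ℕ} : ∀ {e : ℕ} {l : List ℕ}, IsChain nxt e l →
    (∀ x ∈ l, nxt' x = nxt x) → IsChain nxt' e l
  | _, [], h, _ => h
  | _, x :: l, ⟨h1, h2, h3⟩, h => ⟨h1, h2, by
      rw [h x (by simp)]
      exact h3.congr fun y hy => h y (by simp [hy])⟩

/-- The network `G` in the memory of the machine. Registers: `1`, `2`, `3` hold the constants `0`,
`1`, `2`, register `4` holds `L + 1`, register `5` holds `H + 1`. Arrays: `2` is `comp`, `3` and `4`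
are the heads and the links of the lists `adj`, `5` is `tgt`, `6` is `rev`, `8` is `cap`. -/
structure GraphRepr (G : Net) (s : State) : Prop where
  zero : s.reg 1 = 0
  one : s.reg 2 = 1
  two : s.reg 3 = 2
  L : s.reg 4 = G.L + 1
  H : s.reg 5 = G.H + 1
  comp : ∀ v ∈ G.nodes, s.arr 2 v = G.comp v
  tgt : ∀ e ∈ G.edges, s.arr 5 e = G.tgt e
  rev : ∀ e ∈ G.edges, s.arr 6 e = G.rev e
  cap : ∀ e ∈ G.edges, s.arr 8 e = G.cap e
  chain : ∀ v ∈ G.nodes, IsChain (s.arr 4) (s.arr 3 v) (G.adj v)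

theorem GraphRepr.congr {G : Net} {s s' : State} (h : GraphRepr G s)
    (hs : SameOn [1, 2, 3, 4, 5] [2, 3, 4, 5, 6, 8] s s') : GraphRepr G s' := by
  obtain ⟨hr, ha⟩ := hs
  simp only [List.forall_mem_cons, List.not_mem_nil, false_imp_iff, implies_true, and_true] at hr ha
  obtain ⟨r1, r2, r3, r4, r5⟩ := hr
  obtain ⟨a2, a3, a4, a5, a6, a8⟩ := ha
  refine ⟨?_, ?_, ?_, ?_, ?_, ?_, ?_, ?_, ?_, ?_⟩
  · rw [r1, h.zero]
  · rw [r2, h.one]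
  · rw [r3, h.two]
  · rw [r4, h.L]
  · rw [r5, h.H]
  · rw [a2]; exact h.comp
  · rw [a5]; exact h.tgt
  · rw [a6]; exact h.rev
  · rw [a8]; exact h.cap
  · rw [a3, a4]; exact h.chain

/-! ### One step of a search on the machine -/

/-- The search `σ` in the memory of the machine. There is room for two searches, the one with
`d = 0` and the one with `d = 10`. Registers: `40 + d` is the next half-edge, `41 + d` is `σ.h`,
`42 + d` is the number of found nodes, and `43 + d` is the status. Arrays: `40 + d` lists the found
nodes, `41 + d` contains the value `stamp` at exactly these nodes and smaller values elsewhere, and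
`42 + d` is `σ.par`. -/
structure SrchRepr (G : Net) (d stamp : ℕ) (σ : Srch) (s : State) : Prop where
  h : s.reg (41 + d) = σ.h
  len : s.reg (42 + d) = σ.q.length
  st : s.reg (43 + d) = σ.st
  q : ∀ (i : ℕ) (hi : i < σ.q.length), s.arr (40 + d) i = σ.q[i]
  mark : ∀ v ∈ G.nodes, s.arr (41 + d) v = stamp ↔ v ∈ σ.q
  mark_le : ∀ v ∈ G.nodes, s.arr (41 + d) v ≤ stamp
  par : s.arr (42 + d) = σ.par
  chain : IsChain (s.arr 4) (s.reg (40 + d)) σ.rem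

theorem SrchRepr.congr {G : Net} {d stamp : ℕ} {σ : Srch} {s s' : State}
    (h : SrchRepr G d stamp σ s)
    (hs : SameOn [40 + d, 41 + d, 42 + d, 43 + d] [40 + d, 41 + d, 42 + d, 4] s s') :
    SrchRepr G d stamp σ s' := by
  obtain ⟨hr, ha⟩ := hs
  simp only [List.forall_mem_cons, List.not_mem_nil, false_imp_iff, implies_true, and_true] at hr ha
  obtain ⟨r1, r2, r3, r4⟩ := hr
  obtain ⟨a1, a2, a3, a4⟩ := ha
  exact ⟨r2 ▸ h.h, r3 ▸ h.len, r4 ▸ h.st, a1 ▸ h.q, a2 ▸ h.mark, a2 ▸ h.mark_le, a3 ▸ h.par,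
    by rw [a4, r1]; exact h.chain⟩

/-- One step of search `d`. A literal is a conflict if its negation has the value `stamp` (register
`11`) in array `conf`. Array `7` holds the residual capacities, array `9` the assigned literals. -/
def stepProg (d conf : ℕ) : Prog :=
  .ite (.eq (40 + d) 1)
    (.ite (.lt (41 + d) (42 + d))
      (.load 13 (40 + d) (41 + d) ;; .load (40 + d) 3 13 ;; .succ (41 + d))
      (.const (43 + d) 2))
    (.load 16 7 (40 + d) ;; .load 15 5 (40 + d) ;;
      .ite (.eq 16 2)
        (.load 17 9 15 ;;
          .ite (.eq 17 1)
            (.load 17 (41 + d) 15 ;;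
              .ite (.eq 17 11) .skip
                (.store (41 + d) 15 11 ;; .store (40 + d) (42 + d) 15 ;; .succ (42 + d) ;;
                  .store (42 + d) 15 (40 + d) ;; .load 17 2 15 ;; .load 17 conf 17 ;;
                  .ite (.eq 17 11) (.const (43 + d) 1) .skip))
            .skip)
        .skip ;;
      .load (40 + d) 4 (40 + d))

set_option maxHeartbeats 1600000 in
theorem wp_stepProg {G : Net} {s : State} {d conf stamp : ℕ} {σ : Srch} {bad : List ℕ → Set ℕ}
    {start : List ℕ} {N : ℕ} (hd : d = 0 ∨ d = 10) (hG : GraphRepr G s)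
    (hstamp : s.reg 11 = stamp) (hS : SrchRepr G d stamp σ s)
    (hI : Srch.Inv G (s.arr 7) (s.arr 9) start σ N) (hconf : conf = 10 ∨ conf = 41 + d)
    (hbad : ∀ (m : ℕ → ℕ) (q : List ℕ), (∀ v ∈ G.nodes, m v = stamp ↔ v ∈ q) →
      ∀ v ∈ G.nodes, (if conf = 41 + d then m else s.arr conf) v = stamp ↔ v ∈ bad q) :
    WP (stepProg d conf) s fun s' t => t ≤ 20 ∧
      SrchRepr G d stamp (σ.step G (s.arr 7) (s.arr 9) bad) s' := by
  obtain ⟨q, h, rem, par, st⟩ := σ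
  obtain ⟨h1, h2, h3, h4, h5, hle, h6, h7⟩ := hS
  have hz := hG.zero
  have ho := hG.one
  simp only at h1 h2 h3 h4 h5 hle h6 h7
  subst hstamp
  cases rem with
  | nil =>
    simp only [IsChain] at h7
    by_cases hh : h < q.length
    · have hc := hG.chain _ (hI.mem_nodes q[h] (List.getElem_mem hh))
      have h4' := h4 h hh
      rcases hd with rfl | rfl <;>
      · simp only [Nat.add_zero, Nat.reduceAdd] at *
        simp only [stepProg, Srch.step, hh, dite_true]
        simp [hz, h1, h2, h7, hh, h4']
        exact ⟨by simp, by simp [h2], by simp [h3], by simpa using h4, by simpa using h5,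
          by simpa using hle, by simpa using h6, by simpa using hc⟩
    · rcases hd with rfl | rfl <;>
      · simp only [Nat.add_zero, Nat.reduceAdd] at *
        simp only [stepProg, Srch.step, hh, dite_false]
        simp [hz, h1, h2, h7, hh]
        exact ⟨by simp [h1], by simp [h2], by simp, by simpa using h4, by simpa using h5,
          by simpa using hle, by simpa using h6, by simpa [IsChain] using h7⟩
  | cons e r =>
    obtain ⟨h7, he0, h8⟩ := h7
    obtain ⟨he, _⟩ := hI.rem_edges e (by simp)
    have hte := hG.tgt e he
    have htn := G.tgt_mem e he
    have hm := h5 _ htn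
    have hcn := hG.comp _ htn
    have hcm := G.comp_mem _ htn
    by_cases hc : s.arr 7 e = 1 ∧ s.arr 9 (G.tgt e) = 0 ∧ G.tgt e ∉ q
    · have hm' : s.arr (41 + d) (G.tgt e) ≠ s.reg 11 := fun h => hc.2.2 (hm.1 h)
      have hmk : ∀ v ∈ G.nodes, Function.update (s.arr (41 + d)) (G.tgt e) (s.reg 11) v = s.reg 11 ↔
          v ∈ q ++ [G.tgt e] := by
        intro v hv
        rw [Function.update_apply, List.mem_append, List.mem_singleton, ← h5 v hv]
        split_ifs with h <;> simp [h]
      have hmkle : ∀ v ∈ G.nodes,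
          Function.update (s.arr (41 + d)) (G.tgt e) (s.reg 11) v ≤ s.reg 11 := by
        intro v hv
        rw [Function.update_apply]
        split_ifs
        · exact le_rfl
        · exact hle v hv
      have hb := hbad _ _ hmk _ hcm
      have hq : ∀ (i : ℕ) (hi : i < (q ++ [G.tgt e]).length),
          Function.update (s.arr (40 + d)) q.length (G.tgt e) i = (q ++ [G.tgt e])[i] := by
        intro i hi
        rw [Function.update_apply]
        split_ifs with h
        · subst h
          simp
        · have : i < q.length := by
            simp at hi
            omega
          rw [List.getElem_append_left this, h4 i this]
      simp only [Srch.step, hc, not_false_eq_true, and_self, ite_true]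
      by_cases hcf : G.comp (G.tgt e) ∈ bad (q ++ [G.tgt e])
      · have hb' := hb.2 hcf
        rcases hd with rfl | rfl <;> rcases hconf with rfl | rfl <;>
        · simp only [Nat.add_zero, Nat.reduceAdd] at *
          simp [stepProg, hz, ho, h1, h2, h7, he0, hte, hc.1, hc.2.1, hm', hcn, hcf] at hb' ⊢
          simp [hb']
          exact ⟨by simp [h1], by simp, by simp, by simpa using hq, by simpa using hmk,
            by simpa using hmkle, by simp [h6], by simpa using h8⟩
      · have hb' := fun h => hcf (hb.1 h)
        rcases hd with rfl | rfl <;> rcases hconf with rfl | rfl <;>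
        · simp only [Nat.add_zero, Nat.reduceAdd] at *
          simp [stepProg, hz, ho, h1, h2, h7, he0, hte, hc.1, hc.2.1, hm', hcn, hcf] at hb' ⊢
          simp [hb']
          exact ⟨by simp [h1], by simp, by simp [h3], by simpa using hq, by simpa using hmk,
            by simpa using hmkle, by simp [h6], by simpa using h8⟩
    · simp only [Srch.step, hc, ite_false]
      have fin : ∀ s' : State, s'.reg (41 + d) = s.reg (41 + d) → s'.reg (42 + d) = s.reg (42 + d) →
          s'.reg (43 + d) = s.reg (43 + d) → s'.arr = s.arr →
          s'.reg (40 + d) = s.arr 4 e → SrchRepr G d (s.reg 11) ⟨q, h, r, par, st⟩ s' := by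
        intro s' e1 e2 e3 e4 e5
        exact ⟨e1 ▸ h1, e2 ▸ h2, e3 ▸ h3, e4 ▸ h4, e4 ▸ h5, e4 ▸ hle, e4 ▸ h6,
          by rw [e4, e5]; exact h8⟩
      have hcases : s.arr 7 e ≠ 1 ∨ s.arr 9 (G.tgt e) ≠ 0 ∨
          s.arr (41 + d) (G.tgt e) = s.reg 11 := by
        by_contra h
        push Not at h
        exact hc ⟨h.1, h.2.1, fun hq => h.2.2 (hm.2 hq)⟩
      by_cases c1 : s.arr 7 e = 1 <;> by_cases c2 : s.arr 9 (G.tgt e) = 0 <;>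
        by_cases c3 : s.arr (41 + d) (G.tgt e) = s.reg 11 <;>
        first
        | (exfalso; tauto)
        | (rcases hd with rfl | rfl <;>
          · simp only [Nat.add_zero, Nat.reduceAdd] at *
            simp [stepProg, hz, ho, h1, h2, h7, he0, hte, c1, c2, c3]
            exact fin _ (by simp) (by simp) (by simp) (by simp) (by simp))

/-! ### The augmenting path algorithm -/

/-- The literals that have been decided: distinct nodes, and no literal together with its
negation. -/
structure IsDec (G : Net) (A : List ℕ) : Prop where
  mem_nodes : ∀ a ∈ A, a ∈ G.nodes
  nodup : A.Nodup
  consistent : ∀ a ∈ A, G.comp a ∉ A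

/-- The list `A` is stored in the first cells of array `11`, and register `7` holds its length. -/
def DecRepr (A : List ℕ) (s : State) : Prop :=
  s.reg 7 = A.length ∧ ∀ (i : ℕ) (hi : i < A.length), s.arr 11 i = A[i]

theorem DecRepr.congr {A : List ℕ} {s s' : State} (h : DecRepr A s)
    (hs : SameOn [7] [11] s s') : DecRepr A s' := by
  unfold DecRepr
  rw [hs.1 7 (by simp), hs.2 11 (by simp)]
  exact h

/-- Set the cells `1, …, L` of array `a` to zero. -/
def clearProg (a : ℕ) : Prog :=
  .const 12 1 ;; .loop (.lt 12 4) (.store a 12 1 ;; .succ 12)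

theorem wp_clearProg {G : Net} {s : State} (hG : GraphRepr G s) (a : ℕ) :
    WP (clearProg a) s fun s' t => t ≤ 3 * G.L + 2 ∧ ∀ v ∈ G.nodes, s'.arr a v = 0 := by
  have hz := hG.zero
  have hL := hG.L
  rw [clearProg, wp_seq, wp_const]
  refine WP.loop (fun s' t => 1 ≤ s'.reg 12 ∧ s'.reg 12 ≤ G.L + 1 ∧ t + 3 = 3 * s'.reg 12 ∧
      ∀ v, 1 ≤ v → v < s'.reg 12 → s'.arr a v = 0) (3 * G.L) ?_ ?_ ?_ ?_
  · simp
    omega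
  · rintro s' t - ⟨h1, h2, h3, -⟩
    omega
  · rintro s' t ha ⟨h1, h2, h3, h4⟩ hb
    have e1 := ha.reg 1 rfl
    have e4 := ha.reg 4 rfl
    simp only [State.reg_setReg, holds_lt] at e1 e4 hb
    simp at e1 e4
    rw [hz] at e1
    simp [e1]
    refine ⟨by omega, by omega, fun v hv1 hv2 => ?_⟩
    rw [Function.update_apply]
    split_ifs with h
    · rfl
    · exact h4 v hv1 (by omega)
  · rintro s' t ha ⟨h1, h2, h3, h4⟩ hb
    have e4 := ha.reg 4 rfl
    simp only [State.reg_setReg, holds_lt] at e4 hb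
    simp at e4
    refine ⟨by omega, fun v hv => ?_⟩
    rw [Finset.mem_Icc] at hv
    exact h4 v hv.1 (by omega)

/-- Reset the flow to zero: copy the capacities into the residual capacities. -/
def resetProg : Prog :=
  .const 12 1 ;; .loop (.lt 12 5) (.load 13 8 12 ;; .store 7 12 13 ;; .succ 12)

theorem wp_resetProg {G : Net} {s : State} (hG : GraphRepr G s) :
    WP resetProg s fun s' t => t ≤ 4 * G.H + 2 ∧ ∀ e ∈ G.edges, s'.arr 7 e = G.cap e := by
  have hz := hG.zero
  have hH := hG.H
  rw [resetProg, wp_seq, wp_const]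
  refine WP.loop (fun s' t => 1 ≤ s'.reg 12 ∧ s'.reg 12 ≤ G.H + 1 ∧ t + 4 = 4 * s'.reg 12 ∧
      ∀ v, 1 ≤ v → v < s'.reg 12 → s'.arr 7 v = G.cap v) (4 * G.H) ?_ ?_ ?_ ?_
  · simp
    omega
  · rintro s' t - ⟨h1, h2, h3, -⟩
    omega
  · rintro s' t ha ⟨h1, h2, h3, h4⟩ hb
    have e5 := ha.reg 5 rfl
    have e8 := ha.arr 8 rfl
    simp only [State.reg_setReg, State.arr_setReg, holds_lt] at e5 e8 hb
    simp at e5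
    simp [e8]
    refine ⟨by omega, by omega, fun v hv1 hv2 => ?_⟩
    rw [Function.update_apply]
    split_ifs with h
    · rw [h]
      exact hG.cap _ (Finset.mem_Icc.2 ⟨h1, by omega⟩)
    · exact h4 v hv1 (by omega)
  · rintro s' t ha ⟨h1, h2, h3, h4⟩ hb
    have e5 := ha.reg 5 rfl
    simp only [State.reg_setReg, holds_lt] at e5 hb
    simp at e5
    refine ⟨by omega, fun v hv => ?_⟩
    rw [Finset.mem_Icc] at hv
    exact h4 v hv.1 (by omega)

/-- Prepare a search from the decided literals, which are marked in array `10`. -/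
def loadProg : Prog :=
  (.const 12 0 ;; .loop (.lt 12 7)
    (.load 13 11 12 ;; .store 10 13 2 ;; .store 41 13 2 ;; .store 40 12 13 ;; .succ 12)) ;;
  .copy 42 7 ;; .const 41 0 ;; .const 40 0 ;; .const 43 0 ;; .const 11 1

theorem wp_loadProg {G : Net} {s : State} {A : List ℕ} (hG : GraphRepr G s) (hD : DecRepr A s)
    (h41 : ∀ v ∈ G.nodes, s.arr 41 v = 0) (h10 : ∀ v ∈ G.nodes, s.arr 10 v = 0) :
    WP loadProg s fun s' t => t ≤ 6 * A.length + 7 ∧ s'.reg 11 = 1 ∧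
      (∀ v ∈ G.nodes, s'.arr 10 v = if v ∈ A then 1 else 0) ∧
      ∃ par, SrchRepr G 0 1 (Srch.init A par) s' := by
  have ho := hG.one
  obtain ⟨hD1, hD2⟩ := hD
  refine WP.seq (Q₁ := fun s' t => t ≤ 6 * A.length + 2 ∧
    (∀ v ∈ G.nodes, s'.arr 10 v = if v ∈ A then 1 else 0) ∧
    (∀ v ∈ G.nodes, s'.arr 41 v = if v ∈ A then 1 else 0) ∧
    ∀ (i : ℕ) (hi : i < A.length), s'.arr 40 i = A[i]) ?_ ?_
  · rw [wp_seq, wp_const]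
    refine WP.loop (fun s' t => s'.reg 12 ≤ A.length ∧ t = 6 * s'.reg 12 ∧
      (∀ v ∈ G.nodes, s'.arr 10 v = if v ∈ A.take (s'.reg 12) then 1 else 0) ∧
      (∀ v ∈ G.nodes, s'.arr 41 v = if v ∈ A.take (s'.reg 12) then 1 else 0) ∧
      ∀ (i : ℕ) (hi : i < A.length), i < s'.reg 12 → s'.arr 40 i = A[i]) (6 * A.length) ?_ ?_ ?_ ?_
    · refine ⟨by simp, by simp, fun v hv => ?_, fun v hv => ?_, by simp⟩
      · simpa using h10 v hv
      · simpa using h41 v hv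
    · rintro s' t - ⟨h1, h2, -⟩
      omega
    · rintro s' t ha ⟨h1, h2, h3, h4, h5⟩ hb
      have e2 := ha.reg 2 rfl
      have e7 := ha.reg 7 rfl
      have e11 := ha.arr 11 rfl
      simp only [State.reg_setReg, State.arr_setReg, holds_lt] at e2 e7 e11 hb
      simp at e2 e7
      have hlt : s'.reg 12 < A.length := by omega
      have hA := hD2 _ hlt
      have hmem : ∀ v, v ∈ A.take (s'.reg 12 + 1) ↔ v ∈ A.take (s'.reg 12) ∨ v = A[s'.reg 12] := by
        intro v
        rw [List.take_succ_eq_append_getElem hlt, List.mem_append, List.mem_singleton]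
      simp [e11, hA, e2, ho]
      refine ⟨by omega, by omega, ?_, ?_, ?_⟩
      · intro v hv1 hv2
        simp only [Function.update_apply, hmem, h3 v (Finset.mem_Icc.2 ⟨hv1, hv2⟩)]
        by_cases h : v = A[s'.reg 12] <;> simp [h]
      · intro v hv1 hv2
        simp only [Function.update_apply, hmem, h4 v (Finset.mem_Icc.2 ⟨hv1, hv2⟩)]
        by_cases h : v = A[s'.reg 12] <;> simp [h]
      · intro i hi hi'
        rw [Function.update_apply]
        split_ifs with h
        · subst h
          rfl
        · exact h5 i hi (by omega)
    · rintro s' t ha ⟨h1, h2, h3, h4, h5⟩ hb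
      have e7 := ha.reg 7 rfl
      simp only [State.reg_setReg, holds_lt] at e7 hb
      simp at e7
      have : s'.reg 12 = A.length := by omega
      rw [this, List.take_length] at h3 h4
      exact ⟨by omega, h3, h4, fun i hi => h5 i hi (by omega)⟩
  · rintro s₁ t₁ ha ⟨h1, h3, h4, h5⟩
    have e7 := ha.reg 7 rfl
    simp
    refine ⟨by omega, by simpa using h3, s₁.arr 42, ?_⟩
    refine ⟨by simp [Srch.init], by simp [Srch.init, e7, hD1], by simp [Srch.init],
      by simpa [Srch.init] using h5, fun v hv => ?_, fun v hv => ?_, by simp [Srch.init],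
      by simp [Srch.init, IsChain]⟩
    · have := h4 v hv
      simp [Srch.init, this]
    · have := h4 v hv
      simp only [Nat.add_zero, State.arr_setReg, this]
      split_ifs <;> omega

/-- Search for an augmenting path. -/
def searchProg : Prog := .loop (.eq 43 1) (stepProg 0 10)

/-- The outcome of a search for an augmenting path: no negation of a decided literal was found, or
the last found literal is one. -/
def Outcome (G : Net) (A : List ℕ) (σ : Srch) : Prop :=
  (σ.st = 2 ∧ ∀ v ∈ σ.q, G.comp v ∉ A) ∨
  (σ.st = 1 ∧ A.length < σ.q.length ∧
    ∃ hq : σ.q.length - 1 < σ.q.length, G.comp (σ.q[σ.q.length - 1]) ∈ A)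

theorem wp_searchProg {G : Net} {s : State} {A : List ℕ} {par : ℕ → ℕ} (hG : GraphRepr G s)
    (hA : IsDec G A) (hS : SrchRepr G 0 1 (Srch.init A par) s) (h11 : s.reg 11 = 1)
    (h10 : ∀ v ∈ G.nodes, s.arr 10 v = if v ∈ A then 1 else 0)
    (h9 : ∀ v ∈ G.nodes, s.arr 9 v = 0) :
    WP searchProg s fun s' t => t ≤ 21 * (G.L + G.H + 1) + 1 ∧
      ∃ σ N, SrchRepr G 0 1 σ s' ∧ Srch.Inv G (s.arr 7) (s.arr 9) A σ N ∧ Outcome G A σ := by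
  refine WP.loop (fun s' t => ∃ σ N, SrchRepr G 0 1 σ s' ∧
    Srch.Inv G (s.arr 7) (s.arr 9) A σ N ∧ t ≤ 21 * N ∧
    (σ.st = 0 → ∀ v ∈ σ.q, G.comp v ∉ A) ∧ (σ.st ≠ 0 → Outcome G A σ))
    (21 * (G.L + G.H + 1)) ?_ ?_ ?_ ?_
  · exact ⟨_, 0, hS, Srch.Inv.init hA.nodup hA.mem_nodes (fun v hv => h9 v (hA.mem_nodes v hv)) _,
      le_rfl, fun _ => hA.consistent, by simp [Srch.init]⟩
  · rintro s' t - ⟨σ, N, -, hI, ht, -⟩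
    have := hI.le_work
    have := hI.work_le_size
    omega
  · rintro s' t ha ⟨σ, N, hS', hI, ht, h0, -⟩ hb
    have e7 := ha.arr 7 rfl
    have e9 := ha.arr 9 rfl
    have e10 := ha.arr 10 rfl
    have e11 := ha.reg 11 rfl
    have e1 := ha.reg 1 rfl
    have hst : σ.st = 0 := by
      have h := hS'.st
      simp only [Nat.add_zero] at h
      rwa [holds_eq, e1, hG.zero, h] at hb
    have hG' : GraphRepr G s' := hG.congr (ha.sameOn rfl)
    have hI' : Srch.Inv G (s'.arr 7) (s'.arr 9) A σ N := by rwa [e7, e9]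
    refine (wp_stepProg (bad := fun _ => {v | v ∈ A}) (Or.inl rfl) hG' (e11.trans h11) hS' hI'
      (Or.inl rfl) ?_).imp ?_
    · intro m q hm v hv
      rw [if_neg (by omega), e10, h10 v hv]
      simp
    · rintro s'' t' - ⟨ht', hS''⟩
      refine ⟨_, N + 1, hS'', ?_, by omega, ?_, ?_⟩
      · rw [e7, e9]
        exact hI.step hst
      · obtain ⟨-, h⟩ := Srch.avoid_step (G := G) (res := s'.arr 7) (asg := s'.arr 9) hst
          (h0 hst) _ rfl
        exact fun h' => h (by omega)
      · obtain ⟨h1, h2⟩ := Srch.avoid_step (G := G) (res := s'.arr 7) (asg := s'.arr 9) hst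
          (h0 hst) _ rfl
        have hle := (hI'.step (bad := fun _ => {v | v ∈ A}) hst).st_le
        intro hne
        by_cases h : (σ.step G (s'.arr 7) (s'.arr 9) fun _ => {v | v ∈ A}).st = 1
        · obtain ⟨u, hu, hu'⟩ := h1 h
          have := hI.prefix_q.length_le
          refine Or.inr ⟨h, by rw [hu]; simp; omega, by rw [hu]; simp, ?_⟩
          simpa [hu] using hu'
        · exact Or.inl ⟨by omega, h2 h⟩
  · rintro s' t ha ⟨σ, N, hS', hI, ht, -, h0⟩ hb
    have e1 := ha.reg 1 rfl
    have hst : σ.st ≠ 0 := by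
      have h := hS'.st
      simp only [Nat.add_zero] at h
      rwa [holds_eq, e1, hG.zero, h] at hb
    have := hI.le_work
    have := hI.work_le_size
    exact ⟨by omega, σ, N, hS', hI, h0 hst⟩

/-- Push one unit of flow along the search path of the last found node. -/
def augmentProg : Prog :=
  (.copy 12 42 ;; .pred 12 ;; .load 13 40 12 ;; .load 14 10 13) ;;
  .loop (.lt 14 2)
    (.load 15 42 13 ;; .load 16 6 15 ;; .store 7 15 1 ;; .store 7 16 2 ;; .load 13 5 16 ;;
      .load 14 10 13)

theorem wp_augmentProg {G : Net} {s : State} {A : List ℕ} {σ : Srch} {N val : ℕ} {asg : ℕ → ℕ}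
    (hG : GraphRepr G s) (hF : G.Flow A (s.arr 7) val)
    (hS : SrchRepr G 0 1 σ s) (hI : Srch.Inv G (s.arr 7) asg A σ N)
    (h10 : ∀ v ∈ G.nodes, s.arr 10 v = if v ∈ A then 1 else 0)
    (hlen : A.length < σ.q.length)
    (hl : G.comp (σ.q[σ.q.length - 1]) ∈ A) :
    WP augmentProg s fun s' t => t ≤ 7 * G.L + 5 ∧ G.Flow A (s'.arr 7) (val + 1) := by
  have hp0 : σ.q.length - 1 < σ.q.length := by omega
  have hqL := Net.length_le hI.nodup hI.mem_nodes
  refine WP.seq (Q₁ := fun s' t => t = 4 ∧ s'.reg 13 = σ.q[σ.q.length - 1] ∧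
    s'.reg 14 = s.arr 10 (σ.q[σ.q.length - 1]) ∧ s'.arr = s.arr ∧ s'.reg 1 = s.reg 1 ∧
    s'.reg 2 = s.reg 2) ?_ ?_
  · have h1 := hS.len
    have h2 := hS.q _ hp0
    simp only [Nat.add_zero] at h1 h2
    simp [h1, h2]
  · rintro s₁ t₁ - ⟨rfl, h13, h14, harr, e1, e2⟩
    refine WP.loop (fun s' t => ∃ (p : ℕ) (hp : p < σ.q.length), s'.reg 13 = σ.q[p] ∧
      s'.reg 14 = s.arr 10 (σ.q[p]) ∧ t + 7 * p ≤ 7 * (σ.q.length - 1) ∧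
      Srch.Aug G σ (s.arr 7) (σ.q[σ.q.length - 1]) p (s'.arr 7)) (7 * (σ.q.length - 1))
      ?_ ?_ ?_ ?_
    · refine ⟨_, hp0, h13, h14, by omega, ?_⟩
      rw [harr]
      exact Srch.Aug.refl hF.res_rev hp0
    · rintro s' t - ⟨p, hp, -, -, h, -⟩
      omega
    · rintro s' t ha ⟨p, hp, g1, g2, g3, g4⟩ hb
      have k1 := (ha.reg 1 rfl).trans (e1.trans hG.zero)
      have k2 := (ha.reg 2 rfl).trans (e2.trans hG.one)
      have k42 := (ha.arr 42 rfl).trans (congrFun harr 42)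
      have k6 := (ha.arr 6 rfl).trans (congrFun harr 6)
      have k5 := (ha.arr 5 rfl).trans (congrFun harr 5)
      have k10 := (ha.arr 10 rfl).trans (congrFun harr 10)
      have hpar := hS.par
      simp only [Nat.add_zero] at hpar
      simp only [holds_lt, g2, k2, h10 _ (hI.mem_nodes _ (List.getElem_mem hp))] at hb
      have hpA : A.length ≤ p := by
        by_contra h
        rw [if_pos ((hI.mem_start_iff hp).2 (by omega))] at hb
        omega
      obtain ⟨he, j, hj, hsj, haug⟩ := g4.push hI hpA
      have r1 := hG.rev _ he
      have r2 := hG.tgt _ (G.rev_mem _ he)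
      rw [G.tgt_rev _ he, hsj] at r2
      simp [k42, hpar, g1, k6, r1, k5, r2, k10, k1, k2]
      exact ⟨j, by omega, rfl, rfl, by omega, haug⟩
    · rintro s' t ha ⟨p, hp, g1, g2, g3, g4⟩ hb
      have k2 := (ha.reg 2 rfl).trans (e2.trans hG.one)
      simp only [holds_lt, g2, k2, h10 _ (hI.mem_nodes _ (List.getElem_mem hp))] at hb
      have hpA : p < A.length := by
        by_contra h
        rw [if_neg (fun h' => h ((hI.mem_start_iff hp).1 h'))] at hb
        omega
      exact ⟨by omega, g4.flow hF hI hpA (hI.mem_nodes _ (List.getElem_mem _)) hl⟩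

/-- One round of the augmenting path algorithm. Register `8` holds the value of the flow, register
`6` the bound. Register `9` gets the value `0` when the flow reaches the bound, and the value `1`
when the flow is maximum; in both cases register `10` gets the value `1`. -/
def roundProg : Prog :=
  clearProg 41 ;; clearProg 10 ;; loadProg ;; searchProg ;;
  .ite (.eq 43 2)
    (augmentProg ;; .succ 8 ;; .ite (.lt 8 6) .skip (.const 9 0 ;; .const 10 1))
    (.const 9 1 ;; .const 10 1)

/-- What is known when no augmenting path is left. -/
def Maximum (G : Net) (A : List ℕ) (val : ℕ) (s : State) : Prop :=
  G.Flow A (s.arr 7) val ∧ ∃ σ N, SrchRepr G 0 1 σ s ∧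
    Srch.Inv G (s.arr 7) (s.arr 9) A σ N ∧ σ.st = 2 ∧ ∀ v ∈ σ.q, G.comp v ∉ A

theorem wp_roundProg {G : Net} {s : State} {A : List ℕ} {val : ℕ} (hG : GraphRepr G s)
    (hA : IsDec G A) (hD : DecRepr A s) (hF : G.Flow A (s.arr 7) val)
    (h9 : ∀ v ∈ G.nodes, s.arr 9 v = 0) (h10 : s.reg 10 = 0) (h8 : s.reg 8 = val)
    (hB : val < s.reg 6) :
    WP roundProg s fun s' t => t ≤ 60 * (G.L + G.H + 1) ∧
      (s'.reg 10 = 0 ∧ s'.reg 8 = val + 1 ∧ val + 1 < s.reg 6 ∧ G.Flow A (s'.arr 7) (val + 1) ∨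
       s'.reg 10 = 1 ∧ s'.reg 9 = 0 ∧ val + 1 = s.reg 6 ∧ G.Flow A (s'.arr 7) (val + 1) ∨
       s'.reg 10 = 1 ∧ s'.reg 9 = 1 ∧ Maximum G A val s') := by
  refine (wp_clearProg hG 41).seq ?_
  rintro s₁ t₁ a₁ ⟨ht₁, h41⟩
  have hG₁ := hG.congr (a₁.sameOn rfl)
  refine (wp_clearProg hG₁ 10).seq ?_
  rintro s₂ t₂ a₂ ⟨ht₂, hh10⟩
  have hG₂ := hG₁.congr (a₂.sameOn rfl)
  have hD₂ : DecRepr A s₂ := (hD.congr (a₁.sameOn rfl)).congr (a₂.sameOn rfl)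
  rw [← a₂.arr 41 rfl] at h41
  refine (wp_loadProg hG₂ hD₂ h41 hh10).seq ?_
  rintro s₃ t₃ a₃ ⟨ht₃, h11, hin, par, hS⟩
  have hG₃ := hG₂.congr (a₃.sameOn rfl)
  have e9 : s₃.arr 9 = s.arr 9 := by rw [a₃.arr 9 rfl, a₂.arr 9 rfl, a₁.arr 9 rfl]
  have e7 : s₃.arr 7 = s.arr 7 := by rw [a₃.arr 7 rfl, a₂.arr 7 rfl, a₁.arr 7 rfl]
  refine (wp_searchProg hG₃ hA hS h11 hin (by rwa [e9])).seq ?_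
  rintro s₄ t₄ a₄ ⟨ht₄, σ, N, hS₄, hI, hO⟩
  have hG₄ := hG₃.congr (a₄.sameOn rfl)
  rw [← a₄.arr 10 rfl] at hin
  rw [← a₄.arr 7 rfl, ← a₄.arr 9 rfl] at hI
  have hF₄ : G.Flow A (s₄.arr 7) val := by rwa [a₄.arr 7 rfl, e7]
  have e8 : s₄.reg 8 = val := by
    rw [a₄.reg 8 rfl, a₃.reg 8 rfl, a₂.reg 8 rfl, a₁.reg 8 rfl, h8]
  have e6 : s₄.reg 6 = s.reg 6 := by
    rw [a₄.reg 6 rfl, a₃.reg 6 rfl, a₂.reg 6 rfl, a₁.reg 6 rfl]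
  have e10 : s₄.reg 10 = 0 := by
    rw [a₄.reg 10 rfl, a₃.reg 10 rfl, a₂.reg 10 rfl, a₁.reg 10 rfl, h10]
  have hAL := Net.length_le hA.nodup hA.mem_nodes
  have hst := hS₄.st
  simp only [Nat.add_zero] at hst
  rw [wp_ite, holds_eq, hG₄.one, hst]
  rcases hO with ⟨h2, hav⟩ | ⟨h1, hlen, hq, hcf⟩
  · refine ⟨fun h => by omega, fun _ => ?_⟩
    simp
    refine ⟨by omega, ?_, σ, N, ?_, ?_, h2, hav⟩
    · simpa using hF₄
    · exact hS₄.congr ⟨by simp, by simp⟩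
    · simpa using hI
  · refine ⟨fun _ => ?_, fun h => absurd h1 h⟩
    refine (wp_augmentProg hG₄ hF₄ hS₄ hI hin hlen hcf).seq ?_
    rintro s₅ t₅ a₅ ⟨ht₅, hF₅⟩
    have k6 := a₅.reg 6 rfl
    have k8 := a₅.reg 8 rfl
    have k10 := a₅.reg 10 rfl
    simp [k6, k8, e6, e8, k10, e10]
    constructor
    · intro hlt
      exact ⟨by omega, hlt, hF₅⟩
    · intro hle
      exact ⟨by omega, by omega, hF₅⟩

/-- Compute a flow from the decided literals to their negations, up to the bound. -/
def flowProg : Prog :=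
  (resetProg ;; .const 8 0 ;; .const 10 0) ;; .loop (.eq 10 1) roundProg

theorem wp_flowProg {G : Net} {s : State} {A : List ℕ} (hG : GraphRepr G s)
    (hA : IsDec G A) (hD : DecRepr A s)
    (h9 : ∀ v ∈ G.nodes, s.arr 9 v = 0) (hB : 0 < s.reg 6) :
    WP flowProg s fun s' t => t ≤ 70 * ((s.reg 6 + 1) * (G.L + G.H + 1)) ∧
      (s'.reg 9 = 0 ∧ G.Flow A (s'.arr 7) (s.reg 6) ∨
       s'.reg 9 = 1 ∧ ∃ val < s.reg 6, Maximum G A val s') := by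
  refine WP.seq (Q₁ := fun s' t => t ≤ 4 * G.H + 4 ∧ s'.reg 8 = 0 ∧ s'.reg 10 = 0 ∧
    G.Flow A (s'.arr 7) 0) ?_ ?_
  · refine (wp_resetProg hG).seq ?_
    rintro s₁ t₁ a₁ ⟨h1, h2⟩
    simp
    exact ⟨by omega, Net.flow_zero A h2⟩
  rintro s₀ t₀ a₀ ⟨ht₀, h80, h100, hF0⟩
  have hG₀ := hG.congr (a₀.sameOn rfl)
  have hD₀ := hD.congr (a₀.sameOn rfl)
  rw [← a₀.arr 9 rfl] at h9
  have b6 := a₀.reg 6 rfl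
  generalize hW : G.L + G.H + 1 = W
  generalize s.reg 6 = B at *
  refine WP.loop (fun s' t => ∃ val,
    (s'.reg 10 = 0 ∧ s'.reg 8 = val ∧ val < B ∧ G.Flow A (s'.arr 7) val ∧ t ≤ val * (61 * W) ∨
     s'.reg 10 = 1 ∧ s'.reg 9 = 0 ∧ val = B ∧ G.Flow A (s'.arr 7) val ∧ t ≤ val * (61 * W) ∨
     s'.reg 10 = 1 ∧ s'.reg 9 = 1 ∧ val < B ∧ Maximum G A val s' ∧ t ≤ (val + 1) * (61 * W)))
    ((B + 1) * (61 * W)) ?_ ?_ ?_ ?_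
  · exact ⟨0, Or.inl ⟨h100, h80, hB, hF0, by simp⟩⟩
  · rintro s' t - ⟨val, ⟨-, -, h, -, ht⟩ | ⟨-, -, h, -, ht⟩ | ⟨-, -, h, -, ht⟩⟩ <;>
      exact ht.trans (Nat.mul_le_mul_right _ (by omega))
  · rintro s' t ha ⟨val, hv⟩ hb
    have hG' := hG₀.congr (ha.sameOn rfl)
    have hD' := hD₀.congr (ha.sameOn rfl)
    rw [holds_eq, hG'.zero] at hb
    have c6 : s'.reg 6 = B := (ha.reg 6 rfl).trans b6
    rcases hv with ⟨h10, h8, hlt, hF, ht⟩ | ⟨h10, -⟩ | ⟨h10, -⟩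
    · have h9' : ∀ v ∈ G.nodes, s'.arr 9 v = 0 := by rwa [ha.arr 9 rfl]
      refine (wp_roundProg hG' hA hD' hF h9' h10 h8 (by omega)).imp ?_
      rintro s'' t' - ⟨ht', h⟩
      rw [c6] at h
      rw [hW] at ht'
      have key : t + t' + 1 ≤ (val + 1) * (61 * W) := by
        rw [add_mul]
        omega
      rcases h with ⟨i1, i2, i3, i4⟩ | ⟨i1, i2, i3, i4⟩ | ⟨i1, i2, i3⟩
      · exact ⟨val + 1, Or.inl ⟨i1, i2, i3, i4, key⟩⟩
      · exact ⟨val + 1, Or.inr (Or.inl ⟨i1, i2, i3, i4, key⟩)⟩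
      · exact ⟨val, Or.inr (Or.inr ⟨i1, i2, hlt, i3, key⟩)⟩
    · omega
    · omega
  · rintro s' t ha ⟨val, hv⟩ hb
    have hG' := hG₀.congr (ha.sameOn rfl)
    rw [holds_eq, hG'.zero] at hb
    have key : ∀ n, n ≤ B + 1 → t ≤ n * (61 * W) → t₀ + (t + 1) ≤ 70 * ((B + 1) * W) := by
      intro n hn ht
      have h1 : n * (61 * W) ≤ (B + 1) * (61 * W) := Nat.mul_le_mul_right _ hn
      have h2 : W ≤ (B + 1) * W := Nat.le_mul_of_pos_left _ (by omega)
      have h3 : (B + 1) * (61 * W) = 61 * ((B + 1) * W) := by ring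
      omega
    rcases hv with ⟨h10, -⟩ | ⟨-, i1, i2, i3, ht⟩ | ⟨-, i1, i2, i3, ht⟩
    · omega
    · exact ⟨key _ (by omega) ht, Or.inl ⟨i1, i2 ▸ i3⟩⟩
    · exact ⟨key _ (by omega) ht, Or.inr ⟨i1, val, i2, i3⟩⟩

/-! ### Extending a minimum cut by simultaneous searches -/

/-- The work that was needed to find the assigned literals. -/
noncomputable def Net.assigned (G : Net) (asg : ℕ → ℕ) : ℕ :=
  ∑ v ∈ G.nodes.filter fun v => asg v ≠ 0, ((G.adj v).length + 1)

theorem Net.assigned_le (G : Net) (asg : ℕ → ℕ) : G.assigned asg ≤ G.L + G.H := by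
  unfold Net.assigned
  calc _ ≤ ∑ v ∈ G.nodes, ((G.adj v).length + 1) :=
        Finset.sum_le_sum_of_subset (Finset.filter_subset _ _)
    _ ≤ G.L + G.H := by
        rw [Finset.sum_add_distrib]
        have := G.sum_adj
        simp only [Finset.sum_const, Nat.card_Icc, Net.nodes, smul_eq_mul, mul_one,
          Nat.add_sub_cancel]
        omega

theorem Net.assigned_update {G : Net} {asg asg' : ℕ → ℕ} {q : List ℕ} (hn : q.Nodup)
    (hm : ∀ v ∈ q, v ∈ G.nodes) (h0 : ∀ v ∈ q, asg v = 0)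
    (h : ∀ v, asg' v = if v ∈ q then 1 else asg v) :
    G.assigned asg' = G.assigned asg + G.work q := by
  have : (G.nodes.filter fun v => asg' v ≠ 0) =
      (G.nodes.filter fun v => asg v ≠ 0) ∪ q.toFinset := by
    ext v
    simp only [Finset.mem_filter, Finset.mem_union, List.mem_toFinset, h]
    by_cases hv : v ∈ q
    · simp [hv, hm v hv]
    · simp [hv]
  rw [Net.assigned, this, Finset.sum_union, Net.work_eq_sum hn, Net.assigned]
  rw [Finset.disjoint_left]
  intro v hv hv'
  exact (Finset.mem_filter.1 hv).2 (h0 v (List.mem_toFinset.1 hv'))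

theorem Net.Partial.congr {G : Net} {A : List ℕ} {res : ℕ → ℕ} {Y Y' : Set ℕ}
    (h : G.Partial A res Y) (hA : ∀ a ∈ A, a ∈ G.nodes)
    (hY : ∀ v ∈ G.nodes, v ∈ Y' ↔ v ∈ Y) : G.Partial A res Y' := by
  refine ⟨fun e he hr hs => ?_, fun a ha => ?_, fun v hv hv' => ?_⟩
  · rw [hY _ (G.tgt_mem e he)]
    exact h.closed e he hr ((hY _ (G.src_mem e he)).1 hs)
  · rw [hY _ (hA a ha), hY _ (G.comp_mem _ (hA a ha))]
    exact h.sep a ha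
  · rw [hY _ (G.comp_mem _ hv)]
    exact h.consistent v hv ((hY v hv).1 hv')

/-- Assign the literals that search `d` has found. -/
def acceptProg (d : ℕ) : Prog :=
  .const 12 0 ;; .loop (.lt 12 (42 + d)) (.load 13 (40 + d) 12 ;; .store 9 13 2 ;; .succ 12)

theorem wp_acceptProg {G : Net} {s : State} {d stamp : ℕ} {σ : Srch} (hd : d = 0 ∨ d = 10)
    (hG : GraphRepr G s) (hS : SrchRepr G d stamp σ s) :
    WP (acceptProg d) s fun s' t => t ≤ 4 * σ.q.length + 2 ∧
      ∀ v, s'.arr 9 v = if v ∈ σ.q then 1 else s.arr 9 v := by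
  have hlen := hS.len
  have hq := hS.q
  have ho := hG.one
  rw [acceptProg, wp_seq, wp_const]
  refine WP.loop (fun s' t => s'.reg 12 ≤ σ.q.length ∧ t = 4 * s'.reg 12 ∧
    ∀ v, s'.arr 9 v = if v ∈ σ.q.take (s'.reg 12) then 1 else s.arr 9 v) (4 * σ.q.length)
    ?_ ?_ ?_ ?_
  · simp
  · rintro s' t - ⟨h1, h2, -⟩
    omega
  · rintro s' t ha ⟨h1, h2, h3⟩ hb
    have e2 := ha.reg 2 (by rcases hd with rfl | rfl <;> rfl)
    have eA := ha.arr (40 + d) (by rcases hd with rfl | rfl <;> rfl)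
    have eR := ha.reg (42 + d) (by rcases hd with rfl | rfl <;> rfl)
    have hne : 42 + d ≠ 12 := by omega
    simp only [State.reg_setReg, State.arr_setReg, holds_lt, hne, ite_false] at e2 eA eR hb
    simp at e2
    have hlt : s'.reg 12 < σ.q.length := by omega
    have hA := hq _ hlt
    have hmem : ∀ v, v ∈ σ.q.take (s'.reg 12 + 1) ↔
        v ∈ σ.q.take (s'.reg 12) ∨ v = σ.q[s'.reg 12] := by
      intro v
      rw [List.take_succ_eq_append_getElem hlt, List.mem_append, List.mem_singleton]
    simp [eA, hA, e2, ho]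
    refine ⟨by omega, by omega, fun v => ?_⟩
    simp only [Function.update_apply, hmem, h3 v]
    by_cases h : v = σ.q[s'.reg 12] <;> simp [h]
  · rintro s' t ha ⟨h1, h2, h3⟩ hb
    have eR := ha.reg (42 + d) (by rcases hd with rfl | rfl <;> rfl)
    have hne : 42 + d ≠ 12 := by omega
    simp only [State.reg_setReg, holds_lt, hne, ite_false] at eR hb
    have : s'.reg 12 = σ.q.length := by omega
    rw [this, List.take_length] at h3
    exact ⟨by omega, h3⟩

/-- Prepare search `d` from the literal in register `x`. -/
def startProg (d x : ℕ) : Prog :=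
  .store (41 + d) x 11 ;; .const 12 0 ;; .store (40 + d) 12 x ;; .const (41 + d) 0 ;;
  .const (42 + d) 1 ;; .const (40 + d) 0 ;; .const (43 + d) 0

theorem wp_startProg {G : Net} {s : State} {d x : ℕ} (hd : d = 0 ∨ d = 10)
    (hx : x = 18 ∨ x = 15) (h11 : ∀ v ∈ G.nodes, s.arr (41 + d) v < s.reg 11) :
    WP (startProg d x) s fun s' t => t = 7 ∧
      SrchRepr G d (s.reg 11) (Srch.init [s.reg x] (s.arr (42 + d))) s' := by
  have hm : ∀ v ∈ G.nodes, Function.update (s.arr (41 + d)) (s.reg x) (s.reg 11) v = s.reg 11 ↔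
      v = s.reg x := by
    intro v hv
    have := h11 v hv
    rw [Function.update_apply]
    split_ifs with h <;> simp [h]
    omega
  have hle : ∀ v ∈ G.nodes,
      Function.update (s.arr (41 + d)) (s.reg x) (s.reg 11) v ≤ s.reg 11 := by
    intro v hv
    have := h11 v hv
    rw [Function.update_apply]
    split_ifs <;> omega
  rcases hd with rfl | rfl <;> rcases hx with rfl | rfl <;>
  · simp [startProg]
    exact ⟨by simp [Srch.init], by simp [Srch.init], by simp [Srch.init], by simp [Srch.init],
      by simpa [Srch.init] using hm, by simpa using hle, by simp [Srch.init],
      by simp [Srch.init, IsChain]⟩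

/-- One of two simultaneous searches: search `d`, which began in `x`, is in the state `σ` after `N`
steps. -/
structure Side (G : Net) (res asg : ℕ → ℕ) (d stamp x : ℕ) (σ : Srch) (N : ℕ) (s : State) :
    Prop where
  repr : SrchRepr G d stamp σ s
  inv : Srch.Inv G res asg [x] σ N
  conflict : σ.st = 1 → ∃ v ∈ σ.q, G.comp v ∈ σ.q
  consistent : σ.st ≠ 1 → ∀ v ∈ σ.q, G.comp v ∉ σ.q

/-- One step of search `d`, if it is running. -/
def sideProg (d : ℕ) : Prog := .ite (.eq (43 + d) 1) (stepProg d (41 + d)) .skip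

theorem wp_sideProg {G : Net} {s : State} {d stamp x N n : ℕ} {σ : Srch} (hd : d = 0 ∨ d = 10)
    (hG : GraphRepr G s) (h11 : s.reg 11 = stamp)
    (hS : Side G (s.arr 7) (s.arr 9) d stamp x σ N s) (h2 : σ.st ≠ 2) (hn : σ.st = 0 → N = n) :
    WP (sideProg d) s fun s' t => t ≤ 21 ∧ ∃ σ' N',
      Side G (s.arr 7) (s.arr 9) d stamp x σ' N' s' ∧ (σ'.st ≠ 1 → N' = n + 1) := by
  have hst := hS.repr.st
  have hle := hS.inv.st_le
  rw [sideProg, wp_ite, holds_eq, hst, hG.zero]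
  constructor
  · intro h0
    refine (wp_stepProg (bad := fun q => {v | v ∈ q}) hd hG h11 hS.repr hS.inv (Or.inr rfl)
      ?_).imp ?_
    · intro m q hm v hv
      rw [if_pos rfl]
      exact hm v hv
    · rintro s' t - ⟨ht, hS'⟩
      obtain ⟨h3, h4⟩ := Srch.consistent_step hS.inv h0 (hS.consistent (by omega)) _ rfl
      exact ⟨by omega, _, N + 1, ⟨hS', hS.inv.step h0, h3, h4⟩, fun _ => by rw [hn h0]⟩
  · intro h0
    rw [wp_skip]
    exact ⟨by omega, σ, N, hS, fun h => by omega⟩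

/-- One step of either search. Register `19` gets the value `1` or `2` when the first or the second
search is exhausted, and the value `3` when both have found a contradiction. -/
def pairProg : Prog :=
  sideProg 0 ;; sideProg 10 ;;
  .ite (.eq 43 3) (.const 19 1)
    (.ite (.eq 53 3) (.const 19 2)
      (.ite (.eq 43 2) (.ite (.eq 53 2) (.const 19 3) .skip) .skip))

theorem wp_pairLoop {G : Net} {s : State} {stamp x y : ℕ} {σ₀ σ₁ : Srch}
    (hG : GraphRepr G s) (h11 : s.reg 11 = stamp) (h19 : s.reg 19 = 0)
    (h0 : Side G (s.arr 7) (s.arr 9) 0 stamp x σ₀ 0 s) (hs₀ : σ₀.st = 0)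
    (h1 : Side G (s.arr 7) (s.arr 9) 10 stamp y σ₁ 0 s) (hs₁ : σ₁.st = 0) :
    WP (.loop (.eq 19 1) pairProg) s fun s' t => ∃ σ₀ σ₁ N₀ N₁ n,
      Side G (s.arr 7) (s.arr 9) 0 stamp x σ₀ N₀ s' ∧
      Side G (s.arr 7) (s.arr 9) 10 stamp y σ₁ N₁ s' ∧ t ≤ 50 * n + 1 ∧ n ≤ G.L + G.H + 1 ∧
      (s'.reg 19 = 1 ∧ σ₀.st = 2 ∧ N₀ = n ∨ s'.reg 19 = 2 ∧ σ₁.st = 2 ∧ N₁ = n ∨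
        s'.reg 19 = 3 ∧ σ₀.st = 1 ∧ σ₁.st = 1) := by
  refine WP.loop (fun s' t => ∃ σ₀ σ₁ N₀ N₁ n,
    Side G (s.arr 7) (s.arr 9) 0 stamp x σ₀ N₀ s' ∧
    Side G (s.arr 7) (s.arr 9) 10 stamp y σ₁ N₁ s' ∧ t ≤ 50 * n ∧ n ≤ G.L + G.H + 1 ∧
    (s'.reg 19 = 0 ∧ σ₀.st ≠ 2 ∧ σ₁.st ≠ 2 ∧ ¬ (σ₀.st = 1 ∧ σ₁.st = 1) ∧
      (σ₀.st = 0 → N₀ = n) ∧ (σ₁.st = 0 → N₁ = n) ∨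
      s'.reg 19 = 1 ∧ σ₀.st = 2 ∧ N₀ = n ∨ s'.reg 19 = 2 ∧ σ₁.st = 2 ∧ N₁ = n ∨
      s'.reg 19 = 3 ∧ σ₀.st = 1 ∧ σ₁.st = 1)) (50 * (G.L + G.H + 1)) ?_ ?_ ?_ ?_
  · exact ⟨σ₀, σ₁, 0, 0, 0, h0, h1, by omega, by omega,
      Or.inl ⟨h19, by omega, by omega, by omega, fun _ => rfl, fun _ => rfl⟩⟩
  · rintro s' t - ⟨_, _, _, _, n, -, -, h2, h3, -⟩
    omega
  · clear h0 h1 hs₀ hs₁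
    rintro s' t ha ⟨σ₀, σ₁, N₀, N₁, n, h0, h1, ht, hn, hc⟩ hb
    have hG' := hG.congr (ha.sameOn rfl)
    rw [holds_eq, hG'.zero] at hb
    obtain ⟨-, g1, g2, g3, g4, g5⟩ | ⟨_, -⟩ | ⟨_, -⟩ | ⟨_, -⟩ := hc
    on_goal 2 => omega
    on_goal 2 => omega
    on_goal 2 => omega
    -- one of the two searches is running, and so it has made all of the `n` steps
    have hn' : n ≤ G.L + G.H := by
      have l0 := h0.inv.st_le
      have l1 := h1.inv.st_le
      by_cases hh : σ₀.st = 0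
      · have := h0.inv.lt_work g1
        have := h0.inv.work_le_size
        have := g4 hh
        omega
      · have := h1.inv.lt_work g2
        have := h1.inv.work_le_size
        have := g5 (by omega)
        omega
    have e7 := ha.arr 7 rfl
    have e9 := ha.arr 9 rfl
    have e11 := (ha.reg 11 rfl).trans h11
    rw [← e7, ← e9] at h0 h1 ⊢
    refine (wp_sideProg (Or.inl rfl) hG' e11 h0 g1 g4).seq ?_
    rintro s₁ t₁ a₁ ⟨ht₁, σ₀', N₀', h0', hN₀⟩
    have hG₁ := hG'.congr (a₁.sameOn rfl)
    have h1' : Side G (s₁.arr 7) (s₁.arr 9) 10 stamp y σ₁ N₁ s₁ := by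
      rw [a₁.arr 7 rfl, a₁.arr 9 rfl]
      exact ⟨h1.repr.congr (a₁.sameOn rfl), h1.inv, h1.conflict, h1.consistent⟩
    refine (wp_sideProg (Or.inr rfl) hG₁ ((a₁.reg 11 rfl).trans e11) h1' g2 g5).seq ?_
    rintro s₂ t₂ a₂ ⟨ht₂, σ₁', N₁', h1'', hN₁⟩
    rw [a₁.arr 7 rfl, a₁.arr 9 rfl] at h1''
    have hG₂ := hG₁.congr (a₂.sameOn rfl)
    have h0'' : Side G (s'.arr 7) (s'.arr 9) 0 stamp x σ₀' N₀' s₂ :=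
      ⟨h0'.repr.congr (a₂.sameOn rfl), h0'.inv, h0'.conflict, h0'.consistent⟩
    have f0 := h0''.repr.st
    have f1 := h1''.repr.st
    have l0 := h0''.inv.st_le
    have l1 := h1''.inv.st_le
    have e19 : s₂.reg 19 = 0 := by rw [a₂.reg 19 rfl, a₁.reg 19 rfl, hb]
    simp only [Nat.add_zero, Nat.reduceAdd] at f0 f1
    have fin : ∀ s₃ : State, ∀ t₃ ≤ 5, (∀ r, r ≠ 19 → s₃.reg r = s₂.reg r) → s₃.arr = s₂.arr →
        (s₃.reg 19 = 0 ∧ σ₀'.st ≠ 2 ∧ σ₁'.st ≠ 2 ∧ ¬ (σ₀'.st = 1 ∧ σ₁'.st = 1) ∨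
        s₃.reg 19 = 1 ∧ σ₀'.st = 2 ∨ s₃.reg 19 = 2 ∧ σ₁'.st = 2 ∨
        s₃.reg 19 = 3 ∧ σ₀'.st = 1 ∧ σ₁'.st = 1) →
        ∃ σ₀ σ₁ N₀ N₁ n, Side G (s'.arr 7) (s'.arr 9) 0 stamp x σ₀ N₀ s₃ ∧
        Side G (s'.arr 7) (s'.arr 9) 10 stamp y σ₁ N₁ s₃ ∧
        t + (t₁ + (t₂ + t₃)) + 1 ≤ 50 * n ∧ n ≤ G.L + G.H + 1 ∧
        (s₃.reg 19 = 0 ∧ σ₀.st ≠ 2 ∧ σ₁.st ≠ 2 ∧ ¬ (σ₀.st = 1 ∧ σ₁.st = 1) ∧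
          (σ₀.st = 0 → N₀ = n) ∧ (σ₁.st = 0 → N₁ = n) ∨
          s₃.reg 19 = 1 ∧ σ₀.st = 2 ∧ N₀ = n ∨ s₃.reg 19 = 2 ∧ σ₁.st = 2 ∧ N₁ = n ∨
          s₃.reg 19 = 3 ∧ σ₀.st = 1 ∧ σ₁.st = 1) := by
      intro s₃ t₃ ht₃ hr harr hcase
      refine ⟨σ₀', σ₁', N₀', N₁', n + 1,
        ⟨h0''.repr.congr ⟨?_, ?_⟩, h0''.inv, h0''.conflict, h0''.consistent⟩,
        ⟨h1''.repr.congr ⟨?_, ?_⟩, h1''.inv, h1''.conflict, h1''.consistent⟩,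
        by omega, by omega, ?_⟩
      · simp [hr]
      · simp [harr]
      · simp [hr]
      · simp [harr]
      · omega
    simp only [wp_ite, wp_const, wp_skip, holds_eq, f0, f1, hG₂.one, hG₂.two]
    refine ⟨fun c1 => ?_, fun c1 => ⟨fun c2 => ?_, fun c2 => ⟨fun c3 => ⟨fun c4 => ?_,
      fun c4 => ?_⟩, fun c3 => ?_⟩⟩⟩
    · exact fin _ _ (by omega) (by simp +contextual) (by simp) (by simp; omega)
    · exact fin _ _ (by omega) (by simp +contextual) (by simp) (by simp; omega)
    · exact fin _ _ (by omega) (by simp +contextual) (by simp) (by simp; omega)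
    · exact fin _ _ (by omega) (by simp) (by simp) (by omega)
    · exact fin _ _ (by omega) (by simp) (by simp) (by omega)
  · rintro s' t ha ⟨σ₀, σ₁, N₀, N₁, n, h0, h1, ht, hn, hc⟩ hb
    have hG' := hG.congr (ha.sameOn rfl)
    rw [holds_eq, hG'.zero] at hb
    refine ⟨σ₀, σ₁, N₀, N₁, n, h0, h1, by omega, hn, ?_⟩
    omega

/-- Simultaneous searches from the literals in the registers `18` and `15`. The result of a
successful search is assigned. If both searches find a contradiction, then register `9` gets the
value `2`, register `20` the literal, and register `18` the value `L + 1`. -/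
def duelProg : Prog :=
  ((.copy 11 18 ;; .const 19 0) ;; startProg 0 18 ;; startProg 10 15 ;;
    .loop (.eq 19 1) pairProg) ;;
  .ite (.eq 19 2) (acceptProg 0)
    (.ite (.eq 19 3) (acceptProg 10) (.const 9 2 ;; .copy 20 18 ;; .copy 18 4))

/-- Simultaneous searches from the literal in register `18` and from its negation, if none of the
two is assigned. -/
def trialProg : Prog :=
  .load 13 9 18 ;; .load 15 2 18 ;; .load 14 9 15 ;;
  .ite (.eq 13 1) (.ite (.eq 14 1) duelProg .skip) .skip

/-- Either choice for the undecided literal `x` makes the minimum cut larger than `val`. -/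
structure Branch (G : Net) (A : List ℕ) (val x : ℕ) : Prop where
  mem : x ∈ G.nodes
  not_mem : x ∉ A
  comp_not_mem : G.comp x ∉ A
  pos : ∀ X, G.Sep A X → x ∈ X → G.comp x ∉ X → val + 1 ≤ G.cut G.cap X
  neg : ∀ X, G.Sep A X → G.comp x ∈ X → x ∉ X → val + 1 ≤ G.cut G.cap X

theorem wp_duelProg {G : Net} {s : State} {A : List ℕ} {val v : ℕ} (hG : GraphRepr G s)
    (hA : IsDec G A) (hF : G.Flow A (s.arr 7) val) (hP : G.Partial A (s.arr 7) {u | s.arr 9 u ≠ 0})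
    (hv : s.reg 18 = v) (hvn : v ∈ G.nodes) (h9 : s.reg 9 = 1)
    (h41 : ∀ u ∈ G.nodes, s.arr 41 u < v) (h51 : ∀ u ∈ G.nodes, s.arr 51 u < v)
    (h15 : s.reg 15 = G.comp v) (hv0 : s.arr 9 v = 0) (hc0 : s.arr 9 (G.comp v) = 0) :
    WP duelProg s fun s' t =>
      (s'.reg 18 = v ∧ s'.reg 9 = 1 ∧ G.Partial A (s.arr 7) {u | s'.arr 9 u ≠ 0} ∧
        (s'.arr 9 v ≠ 0 ∨ s'.arr 9 (G.comp v) ≠ 0) ∧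
        (∀ u, s.arr 9 u ≠ 0 → s'.arr 9 u ≠ 0) ∧
        (∀ u ∈ G.nodes, s'.arr 41 u ≤ v) ∧ (∀ u ∈ G.nodes, s'.arr 51 u ≤ v) ∧
        t + 10 + 60 * G.assigned (s.arr 9) ≤ 100 + 60 * G.assigned (s'.arr 9)) ∨
      (s'.reg 18 = G.L + 1 ∧ s'.reg 9 = 2 ∧ Branch G A val (s'.reg 20) ∧
        t + 10 ≤ 100 * (G.L + G.H + 1)) := by
  refine WP.seq (Q₁ := fun s' t => ∃ σ₀ σ₁ N₀ N₁ n,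
      Side G (s.arr 7) (s.arr 9) 0 v v σ₀ N₀ s' ∧
      Side G (s.arr 7) (s.arr 9) 10 v (G.comp v) σ₁ N₁ s' ∧ t ≤ 50 * n + 17 ∧
      n ≤ G.L + G.H + 1 ∧
      (s'.reg 19 = 1 ∧ σ₀.st = 2 ∧ N₀ = n ∨ s'.reg 19 = 2 ∧ σ₁.st = 2 ∧ N₁ = n ∨
        s'.reg 19 = 3 ∧ σ₀.st = 1 ∧ σ₁.st = 1)) ?_ ?_
  · refine WP.seq (Q₁ := fun s' t => t = 2 ∧ s'.reg 11 = v ∧ s'.reg 19 = 0) ?_ ?_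
    · simp [hv]
    rintro s₁ _ a₁ ⟨rfl, e11, e19⟩
    have hG₁ := hG.congr (a₁.sameOn rfl)
    have b41 := a₁.arr 41 rfl
    have b51 := a₁.arr 51 rfl
    refine (wp_startProg (G := G) (Or.inl rfl) (Or.inl rfl)
      (by rwa [e11, Nat.add_zero, b41])).seq ?_
    rintro s₂ _ a₂ ⟨rfl, hS₀⟩
    have c51 := (a₂.arr 51 rfl).trans b51
    have c11 := (a₂.reg 11 rfl).trans e11
    refine (wp_startProg (G := G) (Or.inr rfl) (Or.inr rfl)
      (by simpa [c11, c51] using h51)).seq ?_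
    rintro s₃ _ a₃ ⟨rfl, hS₁⟩
    have d7 : s₃.arr 7 = s.arr 7 := by rw [a₃.arr 7 rfl, a₂.arr 7 rfl, a₁.arr 7 rfl]
    have d9 : s₃.arr 9 = s.arr 9 := by rw [a₃.arr 9 rfl, a₂.arr 9 rfl, a₁.arr 9 rfl]
    have d11 := (a₃.reg 11 rfl).trans c11
    have d19 : s₃.reg 19 = 0 := by
      rw [a₃.reg 19 rfl, a₂.reg 19 rfl, e19]
    have hG₃ := (hG₁.congr (a₂.sameOn rfl)).congr (a₃.sameOn rfl)
    have x1 : s₁.reg 18 = v := by rw [a₁.reg 18 rfl, hv]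
    have x2 : s₂.reg 15 = G.comp v := by rw [a₂.reg 15 rfl, a₁.reg 15 rfl, h15]
    rw [e11, x1] at hS₀
    rw [c11, x2] at hS₁
    have hcn := G.comp_mem v hvn
    have hI₀ := Srch.Inv.init (G := G) (res := s.arr 7) (asg := s.arr 9) (start := [v])
      (by simp) (by simpa using hvn) (by simpa using hv0) (s₁.arr (42 + 0))
    have hI₁ := Srch.Inv.init (G := G) (res := s.arr 7) (asg := s.arr 9) (start := [G.comp v])
      (by simp) (by simpa using hcn) (by simpa using hc0) (s₂.arr (42 + 10))
    refine (wp_pairLoop hG₃ d11 d19 (x := v) (y := G.comp v)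
      (σ₀ := Srch.init [v] (s₁.arr (42 + 0))) (σ₁ := Srch.init [G.comp v] (s₂.arr (42 + 10)))
      ?_ rfl ?_ rfl).imp ?_
    · rw [d7, d9]
      refine ⟨hS₀.congr (a₃.sameOn rfl), hI₀, by simp [Srch.init], fun _ u hu => ?_⟩
      simp only [Srch.init, List.mem_singleton] at hu ⊢
      rw [hu]
      exact G.comp_ne v hvn
    · rw [d7, d9]
      refine ⟨hS₁, hI₁, by simp [Srch.init], fun _ u hu => ?_⟩
      simp only [Srch.init, List.mem_singleton] at hu ⊢
      rw [hu]
      exact G.comp_ne _ hcn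
    · rw [d7, d9]
      rintro s₄ t₄ - ⟨σ₀, σ₁, N₀, N₁, n, g1, g2, g3, g4, g5⟩
      exact ⟨σ₀, σ₁, N₀, N₁, n, g1, g2, by omega, g4, g5⟩
  rintro s₁ t₁ a₁ ⟨σ₀, σ₁, N₀, N₁, n, hS₀, hS₁, ht₁, hn, hc⟩
  have hG₁ := hG.congr (a₁.sameOn rfl)
  have e18 : s₁.reg 18 = v := by rw [a₁.reg 18 rfl, hv]
  have e9 : s₁.reg 9 = 1 := by rw [a₁.reg 9 rfl, h9]
  have f9 : s₁.arr 9 = s.arr 9 := by rw [a₁.arr 9 rfl]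
  have m0 := hS₀.repr.mark_le
  have m1 := hS₁.repr.mark_le
  simp only [Nat.add_zero, Nat.reduceAdd] at m0 m1
  -- the searches have cost as much as the winner alone, up to a factor of two
  have accept : ∀ (d x N : ℕ) (σ : Srch), d = 0 ∨ d = 10 → x = v ∨ x = G.comp v →
      Side G (s.arr 7) (s.arr 9) d v x σ N s₁ → σ.st = 2 → N = n →
      WP (acceptProg d) s₁ fun s' t =>
        s'.reg 18 = v ∧ s'.reg 9 = 1 ∧ G.Partial A (s.arr 7) {u | s'.arr 9 u ≠ 0} ∧
        (s'.arr 9 v ≠ 0 ∨ s'.arr 9 (G.comp v) ≠ 0) ∧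
        (∀ u, s.arr 9 u ≠ 0 → s'.arr 9 u ≠ 0) ∧
        (∀ u ∈ G.nodes, s'.arr 41 u ≤ v) ∧ (∀ u ∈ G.nodes, s'.arr 51 u ≤ v) ∧
        t₁ + t + 20 + 60 * G.assigned (s.arr 9) ≤ 100 + 60 * G.assigned (s'.arr 9) := by
    intro d x N σ hd hx hS h2 hN
    refine (wp_acceptProg hd hG₁ hS.repr).imp ?_
    rintro s₂ t₂ a₂ ⟨ht₂, h⟩
    have k18 : s₂.reg 18 = v := by
      rw [a₂.reg 18 (by rcases hd with rfl | rfl <;> rfl), e18]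
    have k9 : s₂.reg 9 = 1 := by
      rw [a₂.reg 9 (by rcases hd with rfl | rfl <;> rfl), e9]
    have k41 : s₂.arr 41 = s₁.arr 41 := a₂.arr 41 (by rcases hd with rfl | rfl <;> rfl)
    have k51 : s₂.arr 51 = s₁.arr 51 := a₂.arr 51 (by rcases hd with rfl | rfl <;> rfl)
    rw [f9] at h
    have hx0 : s.arr 9 (G.comp x) = 0 := by
      rcases hx with rfl | rfl
      · exact hc0
      · rw [G.comp_comp v hvn]
        exact hv0
    have hset : {u | s₂.arr 9 u ≠ 0} = {u | s.arr 9 u ≠ 0 ∨ u ∈ σ.q} := by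
      ext u
      simp only [Set.mem_ofPred_eq, h u]
      by_cases hu : u ∈ σ.q <;> simp [hu]
    have hxq : x ∈ σ.q := hS.inv.prefix_q.subset (by simp)
    have hw := Net.assigned_update hS.inv.nodup hS.inv.mem_nodes hS.inv.asg_eq h
    have hle := hS.inv.le_work
    have hql : σ.q.length ≤ G.work σ.q := by
      have : ∀ l : List ℕ, l.length ≤ G.work l := by
        intro l
        induction l with
        | nil => simp
        | cons a l ih =>
          simp only [Net.work, List.map_cons, List.sum_cons, List.length_cons] at ih ⊢
          omega
      exact this _
    refine ⟨k18, k9, ?_, ?_, ?_, by rwa [k41], by rwa [k51], by omega⟩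
    · rw [hset]
      exact hS.inv.partial_union hF hA.mem_nodes hP h2 hx0 (hS.consistent (by omega))
    · rcases hx with rfl | rfl
      · left
        simp [h, hxq]
      · right
        simp [h, hxq]
    · intro u hu
      rw [h]
      split_ifs
      · omega
      · exact hu
  rw [wp_ite, holds_eq, hG₁.one]
  refine ⟨fun c1 => ?_, fun c1 => ?_⟩
  · obtain ⟨-, h2, hN⟩ | ⟨h, -⟩ | ⟨h, -⟩ := hc
    on_goal 2 => omega
    on_goal 2 => omega
    refine (accept 0 v N₀ σ₀ (Or.inl rfl) (Or.inl rfl) hS₀ h2 hN).imp ?_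
    rintro s₂ t₂ - ⟨g1, g2, g3, g4, g5, g6, g7, g8⟩
    exact Or.inl ⟨g1, g2, g3, g4, g5, g6, g7, by omega⟩
  rw [wp_ite, holds_eq, hG₁.two]
  refine ⟨fun c2 => ?_, fun c2 => ?_⟩
  · obtain ⟨h, -⟩ | ⟨-, h2, hN⟩ | ⟨h, -⟩ := hc
    on_goal 1 => omega
    on_goal 2 => omega
    refine (accept 10 _ N₁ σ₁ (Or.inr rfl) (Or.inr rfl) hS₁ h2 hN).imp ?_
    rintro s₂ t₂ - ⟨g1, g2, g3, g4, g5, g6, g7, g8⟩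
    exact Or.inl ⟨g1, g2, g3, g4, g5, g6, g7, by omega⟩
  obtain ⟨h, -⟩ | ⟨h, -⟩ | ⟨-, h0, h1⟩ := hc
  on_goal 1 => omega
  on_goal 1 => omega
  simp only [wp_seq, wp_const, wp_copy]
  right
  refine ⟨by simp [hG₁.L], by simp, ?_, by omega⟩
  simp only [State.reg_setReg, e18]
  refine ⟨by simpa using hvn, fun h => ?_, fun h => ?_, fun X hX hx hx' => ?_,
    fun X hX hx hx' => ?_⟩
  · exact (hP.sep v h).1 hv0
  · exact (hP.sep _ h).1 hc0
  · exact hS₀.inv.lt_cut hF hA.mem_nodes (hS₀.conflict h0) hX hx hx'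
  · refine hS₁.inv.lt_cut hF hA.mem_nodes (hS₁.conflict h1) hX hx ?_
    rw [G.comp_comp v hvn]
    exact hx'

theorem wp_trialProg {G : Net} {s : State} {A : List ℕ} {val v : ℕ} (hG : GraphRepr G s)
    (hA : IsDec G A) (hF : G.Flow A (s.arr 7) val) (hP : G.Partial A (s.arr 7) {u | s.arr 9 u ≠ 0})
    (hv : s.reg 18 = v) (hvn : v ∈ G.nodes) (h9 : s.reg 9 = 1)
    (h41 : ∀ u ∈ G.nodes, s.arr 41 u < v) (h51 : ∀ u ∈ G.nodes, s.arr 51 u < v) :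
    WP trialProg s fun s' t =>
      (s'.reg 18 = v ∧ s'.reg 9 = 1 ∧ G.Partial A (s.arr 7) {u | s'.arr 9 u ≠ 0} ∧
        (s'.arr 9 v ≠ 0 ∨ s'.arr 9 (G.comp v) ≠ 0) ∧
        (∀ u, s.arr 9 u ≠ 0 → s'.arr 9 u ≠ 0) ∧
        (∀ u ∈ G.nodes, s'.arr 41 u ≤ v) ∧ (∀ u ∈ G.nodes, s'.arr 51 u ≤ v) ∧
        t + 60 * G.assigned (s.arr 9) ≤ 100 + 60 * G.assigned (s'.arr 9)) ∨
      (s'.reg 18 = G.L + 1 ∧ s'.reg 9 = 2 ∧ Branch G A val (s'.reg 20) ∧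
        t ≤ 100 * (G.L + G.H + 1)) := by
  have hz := hG.zero
  have hcv := hG.comp v hvn
  refine WP.seq (p := .load 13 9 18) (Q₁ := fun s' t => t = 1 ∧ s'.reg 13 = s.arr 9 v) ?_ ?_
  · simp [hv]
  rintro s₁ _ a₁ ⟨rfl, h13⟩
  refine WP.seq (Q₁ := fun s' t => t = 1 ∧ s'.reg 15 = G.comp v) ?_ ?_
  · simp [a₁.reg 18 rfl, a₁.arr 2 rfl, hv, hcv]
  rintro s₂ _ a₂ ⟨rfl, h15⟩
  refine WP.seq (Q₁ := fun s' t => t = 1 ∧ s'.reg 14 = s.arr 9 (G.comp v)) ?_ ?_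
  · simp [h15, a₂.arr 9 rfl, a₁.arr 9 rfl]
  rintro s₃ _ a₃ ⟨rfl, h14⟩
  have hG₃ := ((hG.congr (a₁.sameOn rfl)).congr (a₂.sameOn rfl)).congr (a₃.sameOn rfl)
  have e7 : s₃.arr 7 = s.arr 7 := by rw [a₃.arr 7 rfl, a₂.arr 7 rfl, a₁.arr 7 rfl]
  have e9 : s₃.arr 9 = s.arr 9 := by rw [a₃.arr 9 rfl, a₂.arr 9 rfl, a₁.arr 9 rfl]
  have e41 : s₃.arr 41 = s.arr 41 := by rw [a₃.arr 41 rfl, a₂.arr 41 rfl, a₁.arr 41 rfl]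
  have e51 : s₃.arr 51 = s.arr 51 := by rw [a₃.arr 51 rfl, a₂.arr 51 rfl, a₁.arr 51 rfl]
  have f18 : s₃.reg 18 = v := by rw [a₃.reg 18 rfl, a₂.reg 18 rfl, a₁.reg 18 rfl, hv]
  have f9 : s₃.reg 9 = 1 := by rw [a₃.reg 9 rfl, a₂.reg 9 rfl, a₁.reg 9 rfl, h9]
  have f13 : s₃.reg 13 = s.arr 9 v := by rw [a₃.reg 13 rfl, a₂.reg 13 rfl, h13]
  have f15 : s₃.reg 15 = G.comp v := by rw [a₃.reg 15 rfl, h15]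
  have hskip : s.arr 9 v ≠ 0 ∨ s.arr 9 (G.comp v) ≠ 0 → ∀ t ≤ 100,
      s₃.reg 18 = v ∧ s₃.reg 9 = 1 ∧ G.Partial A (s.arr 7) {u | s₃.arr 9 u ≠ 0} ∧
        (s₃.arr 9 v ≠ 0 ∨ s₃.arr 9 (G.comp v) ≠ 0) ∧
        (∀ u, s.arr 9 u ≠ 0 → s₃.arr 9 u ≠ 0) ∧
        (∀ u ∈ G.nodes, s₃.arr 41 u ≤ v) ∧ (∀ u ∈ G.nodes, s₃.arr 51 u ≤ v) ∧
        t + 60 * G.assigned (s.arr 9) ≤ 100 + 60 * G.assigned (s₃.arr 9) := by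
    intro h t ht
    rw [e9, e41, e51]
    exact ⟨f18, f9, hP, h, fun _ h => h, fun u hu => (h41 u hu).le, fun u hu => (h51 u hu).le,
      by omega⟩
  rw [wp_ite, holds_eq, hG₃.zero, f13]
  refine ⟨fun hv0 => ?_, fun hv0 => wp_skip _ _ |>.2 (Or.inl (hskip (Or.inl hv0) _ (by omega)))⟩
  rw [wp_ite, holds_eq, hG₃.zero, h14]
  refine ⟨fun hc0 => ?_, fun hc0 => wp_skip _ _ |>.2 (Or.inl (hskip (Or.inr hc0) _ (by omega)))⟩
  have h := wp_duelProg (val := val) hG₃ hA (by rwa [e7]) (by rwa [e7, e9]) f18 hvn f9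
    (by rwa [e41]) (by rwa [e51]) f15 (by rwa [e9]) (by rwa [e9])
  rw [e7, e9] at h
  refine h.imp ?_
  rintro s₄ t₄ - (⟨g1, g2, g3, g4, g5, g6, g7, g8⟩ | ⟨g1, g2, g3, g4⟩)
  · exact Or.inl ⟨g1, g2, g3, g4, g5, g6, g7, by omega⟩
  · exact Or.inr ⟨g1, g2, g3, by omega⟩

/-- Extend the closed set that the last search has found to a truth assignment, or find a literal to
branch on. -/
def extendProg : Prog :=
  (acceptProg 0 ;; clearProg 41 ;; clearProg 51 ;; .const 18 1) ;;
  .loop (.lt 18 4) (trialProg ;; .succ 18)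

theorem wp_extendProg {G : Net} {s : State} {A : List ℕ} {val : ℕ} (hG : GraphRepr G s)
    (hA : IsDec G A) (hM : Maximum G A val s) (h9 : s.reg 9 = 1)
    (h0 : ∀ v ∈ G.nodes, s.arr 9 v = 0) :
    WP extendProg s fun s' t => t ≤ 400 * (G.L + G.H + 1) ∧
      (s'.reg 9 = 1 ∧ (∃ Y, G.Sep A Y ∧ G.cut G.cap Y = val) ∧
        G.Complete {u | s'.arr 9 u ≠ 0} ∧ G.cut G.cap {u | s'.arr 9 u ≠ 0} = val ∨
       s'.reg 9 = 2 ∧ (∃ Y, G.Sep A Y ∧ G.cut G.cap Y = val) ∧ Branch G A val (s'.reg 20)) := by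
  obtain ⟨hF, σ, N, hS, hI, h2, hc⟩ := hM
  have hP := hI.partial_found hF h2 (fun v => by
    by_cases hv : v ∈ G.nodes
    · exact Or.inl (h0 v hv)
    · exact Or.inr hv) hc
  have hY : ∃ Y, G.Sep A Y ∧ G.cut G.cap Y = val := ⟨_, hP.sep, (hF.closed_iff hP.sep).1 hP.closed⟩
  refine WP.seq (Q₁ := fun s' t => t ≤ 10 * G.L + 7 ∧ s'.reg 18 = 1 ∧
    (∀ u ∈ G.nodes, s'.arr 41 u = 0) ∧ (∀ u ∈ G.nodes, s'.arr 51 u = 0) ∧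
    G.Partial A (s.arr 7) {u | s'.arr 9 u ≠ 0}) ?_ ?_
  · refine (wp_acceptProg (Or.inl rfl) hG hS).seq ?_
    rintro s₁ t₁ a₁ ⟨ht₁, h1⟩
    have hG₁ := hG.congr (a₁.sameOn rfl)
    refine (wp_clearProg hG₁ 41).seq ?_
    rintro s₂ t₂ a₂ ⟨ht₂, h41⟩
    have hG₂ := hG₁.congr (a₂.sameOn rfl)
    refine (wp_clearProg hG₂ 51).seq ?_
    rintro s₃ t₃ a₃ ⟨ht₃, h51⟩
    have hq := Net.length_le hI.nodup hI.mem_nodes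
    rw [wp_const]
    refine ⟨by omega, by simp, ?_, by simpa using h51, ?_⟩
    · rw [State.arr_setReg, a₃.arr 41 rfl]
      exact h41
    · rw [State.arr_setReg, a₃.arr 9 rfl, a₂.arr 9 rfl]
      refine hP.congr hA.mem_nodes fun u hu => ?_
      simp only [Set.mem_ofPred_eq, h1 u, h0 u hu]
      by_cases hu : u ∈ σ.q <;> simp [hu]
  rintro s₀ t₀ a₀ ⟨ht₀, h18, h41, h51, hP₀⟩
  have hG₀ := hG.congr (a₀.sameOn rfl)
  have e7 := a₀.arr 7 rfl
  have e9 := (a₀.reg 9 rfl).trans h9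
  refine WP.loop (fun s' t =>
    (s'.reg 9 = 1 ∧ 1 ≤ s'.reg 18 ∧ s'.reg 18 ≤ G.L + 1 ∧
      G.Partial A (s.arr 7) {u | s'.arr 9 u ≠ 0} ∧
      (∀ u ∈ G.nodes, u < s'.reg 18 → s'.arr 9 u ≠ 0 ∨ s'.arr 9 (G.comp u) ≠ 0) ∧
      (∀ u ∈ G.nodes, s'.arr 41 u < s'.reg 18) ∧ (∀ u ∈ G.nodes, s'.arr 51 u < s'.reg 18) ∧
      t + 102 ≤ 102 * s'.reg 18 + 60 * G.assigned (s'.arr 9)) ∨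
    (s'.reg 9 = 2 ∧ s'.reg 18 = G.L + 2 ∧ Branch G A val (s'.reg 20) ∧
      t ≤ 300 * (G.L + G.H + 1))) (300 * (G.L + G.H + 1)) ?_ ?_ ?_ ?_
  · refine Or.inl ⟨e9, by omega, by omega, hP₀, ?_, ?_, ?_, by omega⟩
    · intro u hu hu'
      rw [Finset.mem_Icc] at hu
      omega
    · intro u hu
      rw [h41 u hu, h18]
      omega
    · intro u hu
      rw [h51 u hu, h18]
      omega
  · rintro s' t - (⟨-, -, h1, -, -, -, -, ht⟩ | ⟨-, -, -, ht⟩)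
    · have := G.assigned_le (s'.arr 9)
      omega
    · exact ht
  · rintro s' t ha (⟨i1, i2, i3, i4, i5, i6, i7, i8⟩ | ⟨i1, i2, -⟩) hb
    · have hG' := hG₀.congr (ha.sameOn rfl)
      have k7 : s'.arr 7 = s.arr 7 := (ha.arr 7 rfl).trans e7
      rw [holds_lt, hG'.L] at hb
      have hvn : s'.reg 18 ∈ G.nodes := Finset.mem_Icc.2 ⟨i2, by omega⟩
      refine (wp_trialProg hG' hA (by rwa [k7]) (by rwa [k7]) rfl hvn i1 i6 i7).seq ?_
      have hbd := G.assigned_le (s'.arr 9)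
      rintro s₁ t₁ a₁ (⟨j1, j2, j3, j4, j5, j6, j7, j8⟩ | ⟨j1, j2, j3, j4⟩)
      · rw [wp_succ]
        left
        simp [j1, j2]
        refine ⟨by omega, by rwa [k7] at j3, ?_, ?_, ?_, by omega⟩
        · intro u hu1 hu2 hu
          have hun : u ∈ G.nodes := Finset.mem_Icc.2 ⟨hu1, hu2⟩
          rcases Nat.lt_or_eq_of_le hu with hu | hu
          · exact (i5 u hun hu).imp (j5 u) (j5 _)
          · rw [hu]
            exact j4
        · intro u hu1 hu2
          have := j6 u (Finset.mem_Icc.2 ⟨hu1, hu2⟩)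
          omega
        · intro u hu1 hu2
          have := j7 u (Finset.mem_Icc.2 ⟨hu1, hu2⟩)
          omega
      · rw [wp_succ]
        right
        simp [j1, j2]
        refine ⟨j3, by omega⟩
    · have hG' := hG₀.congr (ha.sameOn rfl)
      rw [holds_lt, hG'.L] at hb
      omega
  · rintro s' t ha (⟨i1, i2, i3, i4, i5, i6, i7, i8⟩ | ⟨i1, i2, i3, i4⟩) hb
    · have hG' := hG₀.congr (ha.sameOn rfl)
      rw [holds_lt, hG'.L] at hb
      have hbd := G.assigned_le (s'.arr 9)
      refine ⟨by omega, Or.inl ⟨i1, hY, ?_, (hF.closed_iff i4.sep).1 i4.closed⟩⟩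
      intro v hv
      refine ⟨i4.consistent v hv, fun h => ?_⟩
      rw [Finset.mem_Icc] at hv
      rcases i5 v (Finset.mem_Icc.2 hv) (by omega) with h' | h'
      · exact h'
      · exact absurd h' h
    · exact ⟨by omega, Or.inr ⟨i1, hY, i3⟩⟩

/-! ### The search tree -/

/-- Evaluate a node of the search tree. Register `9` gets the value `0` if the minimum cut of the
decided literals reaches the bound, `1` if array `9` holds a solution, and `2` if the literal in
register `20` is to be branched on. -/
def nodeProg : Prog := clearProg 9 ;; flowProg ;; .ite (.eq 9 2) extendProg .skip

theorem wp_nodeProg {G : Net} {s : State} {A : List ℕ} (hG : GraphRepr G s) (hA : IsDec G A)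
    (hD : DecRepr A s) (hB : 0 < s.reg 6) :
    WP nodeProg s fun s' t => t ≤ 500 * ((s.reg 6 + 1) * (G.L + G.H + 1)) ∧
      (s'.reg 9 = 0 ∧ (∀ X, G.Sep A X → s.reg 6 ≤ G.cut G.cap X) ∨
       s'.reg 9 = 1 ∧ G.Complete {u | s'.arr 9 u ≠ 0} ∧
         G.cut G.cap {u | s'.arr 9 u ≠ 0} < s.reg 6 ∨
       s'.reg 9 = 2 ∧ ∃ val < s.reg 6, (∃ Y, G.Sep A Y ∧ G.cut G.cap Y = val) ∧
         Branch G A val (s'.reg 20)) := by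
  have hW : G.L + G.H + 1 ≤ (s.reg 6 + 1) * (G.L + G.H + 1) :=
    Nat.le_mul_of_pos_left _ (by omega)
  refine (wp_clearProg hG 9).seq ?_
  rintro s₁ t₁ a₁ ⟨ht₁, h0⟩
  have hG₁ := hG.congr (a₁.sameOn rfl)
  have e6 := a₁.reg 6 rfl
  refine (wp_flowProg hG₁ hA (hD.congr (a₁.sameOn rfl)) h0 (by omega)).seq ?_
  rintro s₂ t₂ a₂ ⟨ht₂, h⟩
  rw [e6] at ht₂ h
  have hG₂ := hG₁.congr (a₂.sameOn rfl)
  rw [wp_ite, holds_eq, hG₂.one]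
  rcases h with ⟨h9, hF⟩ | ⟨h9, val, hval, hM⟩
  · refine ⟨fun h => by omega, fun _ => ?_⟩
    rw [wp_skip]
    exact ⟨by omega, Or.inl ⟨h9, fun X hX => hF.le_cut hX⟩⟩
  · refine ⟨fun _ => ?_, fun h => absurd h9 h⟩
    rw [← a₂.arr 9 rfl] at h0
    refine (wp_extendProg hG₂ hA hM h9 h0).imp ?_
    rintro s₃ t₃ - ⟨ht₃, ⟨g1, -, g3, g4⟩ | ⟨g1, g2, g3⟩⟩
    · exact ⟨by omega, Or.inr (Or.inl ⟨g1, g3, by omega⟩)⟩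
    · exact ⟨by omega, Or.inr (Or.inr ⟨g1, val, hval, g2, g3⟩)⟩

/-- The decided literals of a stack of decisions, whose top is its first entry. -/
abbrev lits (st : List (ℕ × Bool)) : List ℕ := st.map Prod.fst

/-- The branch of the search tree that the stack of decisions describes. A decision is a literal and
a flag, which says whether the other choice has been refuted. Each decision makes the minimum cut
larger, and so does the other choice. -/
def IsStack (G : Net) (B : ℕ) : List (ℕ × Bool) → Prop
  | [] => True
  | (x, f) :: r => IsStack G B r ∧ x ∈ G.nodes ∧ x ∉ lits r ∧ G.comp x ∉ lits r ∧
      (∀ X, G.Sep (lits r) X → x ∈ X → G.comp x ∉ X → r.length + 1 ≤ G.cut G.cap X) ∧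
      if f then ∀ Y, G.Complete Y → G.Sep (lits r) Y → G.comp x ∈ Y → B ≤ G.cut G.cap Y
      else ∀ X, G.Sep (lits r) X → G.comp x ∈ X → x ∉ X → r.length + 1 ≤ G.cut G.cap X

theorem IsStack.isDec {G : Net} {B : ℕ} : ∀ {st : List (ℕ × Bool)}, IsStack G B st →
    IsDec G (lits st).reverse
  | [], _ => ⟨by simp, by simp, by simp⟩
  | (x, f) :: r, ⟨h, h1, h2, h3, _, _⟩ => by
    obtain ⟨g1, g2, g3⟩ := h.isDec
    simp only [List.mem_reverse, List.nodup_reverse] at g1 g2 g3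
    refine ⟨?_, ?_, ?_⟩
    · simp only [List.mem_reverse, lits, List.map_cons, List.mem_cons]
      rintro a (rfl | ha)
      · exact h1
      · exact g1 a ha
    · simp only [List.nodup_reverse, lits, List.map_cons, List.nodup_cons]
      exact ⟨h2, g2⟩
    · simp only [List.mem_reverse, lits, List.map_cons, List.mem_cons, not_or]
      rintro a (rfl | ha)
      · exact ⟨G.comp_ne a h1, h3⟩
      · refine ⟨?_, g3 a ha⟩
        rintro rfl
        rw [G.comp_comp a (g1 a ha)] at h3
        exact h3 ha

theorem IsStack.length_le_cut {G : Net} {B : ℕ} {st : List (ℕ × Bool)} (h : IsStack G B st)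
    {X : Set ℕ} (hX : G.Sep (lits st) X) : st.length ≤ G.cut G.cap X := by
  cases st with
  | nil => simp
  | cons p r =>
    obtain ⟨x, f⟩ := p
    obtain ⟨-, -, -, -, h4, -⟩ := h
    have hx := hX x (by simp)
    exact h4 X (fun a ha => hX a (List.mem_cons_of_mem _ ha)) hx.1 hx.2

/-- The number of nodes of the search tree below a node of depth `d`, itself included. -/
def treeSize (B d : ℕ) : ℕ := 2 ^ (B + 1 - d) - 1

theorem treeSize_succ {B d : ℕ} (h : d < B) : treeSize B d = 2 * treeSize B (d + 1) + 1 := by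
  unfold treeSize
  obtain ⟨m, hm⟩ : ∃ m, B + 1 - d = m + 1 := ⟨B - d, by omega⟩
  rw [hm, show B + 1 - (d + 1) = m by omega, pow_succ]
  have := Nat.one_le_two_pow (n := m)
  omega

theorem one_le_treeSize {B d : ℕ} (h : d ≤ B) : 1 ≤ treeSize B d := by
  unfold treeSize
  have := Nat.pow_le_pow_right (n := 2) (by omega) (show 1 ≤ B + 1 - d by omega)
  omega

/-- The number of nodes of the search tree in the branches that have been put off. -/
def pending (B : ℕ) : List (ℕ × Bool) → ℕ
  | [] => 0
  | (_, f) :: r => pending B r + if f then 0 else treeSize B (r.length + 1)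

/-- The stack of decisions is stored in the arrays `11` (literals) and `12` (flags). -/
def StackRepr (st : List (ℕ × Bool)) (s : State) : Prop :=
  DecRepr (lits st).reverse s ∧
    ∀ (i : ℕ) (hi : i < st.reverse.length), s.arr 12 i = (st.reverse[i]).2.toNat

theorem StackRepr.congr {st : List (ℕ × Bool)} {s s' : State} (h : StackRepr st s)
    (hs : SameOn [7] [11, 12] s s') : StackRepr st s' := by
  refine ⟨h.1.congr ⟨hs.1, by simpa using hs.2 11 (by simp)⟩, ?_⟩
  rw [hs.2 12 (by simp)]
  exact h.2

theorem StackRepr.push {st : List (ℕ × Bool)} {s s' : State} {x : ℕ} {f : Bool}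
    (h : StackRepr st s) (h7 : s'.reg 7 = st.length + 1)
    (h11 : s'.arr 11 = Function.update (s.arr 11) st.length x)
    (h12 : s'.arr 12 = Function.update (s.arr 12) st.length f.toNat) :
    StackRepr ((x, f) :: st) s' := by
  obtain ⟨⟨-, h2⟩, h3⟩ := h
  refine ⟨⟨by simp [h7], ?_⟩, ?_⟩
  · intro i hi
    simp only [lits, List.map_cons, List.reverse_cons, List.length_append, List.length_reverse,
      List.length_map, List.length_singleton] at hi
    simp only [h11, lits, List.map_cons, List.reverse_cons]
    rw [Function.update_apply]
    split_ifs with h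
    · subst h
      rw [List.getElem_append_right (by simp)]
      simp
    · have hi' : i < (lits st).reverse.length := by
        simp
        omega
      rw [List.getElem_append_left hi', h2 i hi']
  · intro i hi
    simp only [List.reverse_cons, List.length_append, List.length_reverse,
      List.length_singleton] at hi
    simp only [h12, List.reverse_cons]
    rw [Function.update_apply]
    split_ifs with h
    · subst h
      rw [List.getElem_append_right (by simp)]
      simp
    · have hi' : i < st.reverse.length := by
        simp
        omega
      rw [List.getElem_append_left hi', h3 i hi']

theorem StackRepr.pop {st : List (ℕ × Bool)} {s s' : State} {x : ℕ} {f : Bool}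
    (h : StackRepr ((x, f) :: st) s) (h7 : s'.reg 7 = st.length)
    (h11 : s'.arr 11 = s.arr 11) (h12 : s'.arr 12 = s.arr 12) :
    StackRepr st s' ∧ s.arr 11 st.length = x ∧ s.arr 12 st.length = f.toNat := by
  obtain ⟨⟨h1, h2⟩, h3⟩ := h
  refine ⟨⟨⟨by simp [h7], fun i hi => ?_⟩, fun i hi => ?_⟩, ?_, ?_⟩
  · rw [h11, h2 i (by simp at hi ⊢; omega)]
    simp only [lits, List.map_cons, List.reverse_cons]
    exact List.getElem_append_left hi
  · rw [h12, h3 i (by simp at hi ⊢; omega)]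
    simp only [List.reverse_cons]
    rw [List.getElem_append_left hi]
  · rw [h2 _ (by simp)]
    simp only [lits, List.map_cons, List.reverse_cons]
    rw [List.getElem_append_right (by simp)]
    simp
  · rw [h3 _ (by simp)]
    simp only [List.reverse_cons]
    rw [List.getElem_append_right (by simp)]
    simp

/-- No solution agrees with all decisions of the stack. -/
def Refuted (G : Net) (B : ℕ) (st : List (ℕ × Bool)) : Prop :=
  ∀ Y, G.Complete Y → G.Sep (lits st) Y → B ≤ G.cut G.cap Y

/-- Give up the current branch: reverse the last decision whose other choice is still open. If there
is none, registers `21` and `22` get the values `1` and `0`. -/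
def backProg : Prog :=
  .const 23 0 ;;
  .loop (.eq 23 1)
    (.ite (.eq 7 1) (.const 22 0 ;; .const 21 1 ;; .const 23 1)
      (.pred 7 ;; .load 13 12 7 ;;
        .ite (.eq 13 1)
          (.load 13 11 7 ;; .load 13 2 13 ;; .store 11 7 13 ;; .store 12 7 2 ;; .succ 7 ;;
            .const 23 1)
          .skip))

theorem wp_backProg {G : Net} {s : State} {B : ℕ} {st : List (ℕ × Bool)} (hG : GraphRepr G s)
    (hS : IsStack G B st) (hR : StackRepr st s) (href : Refuted G B st) (h21 : s.reg 21 = 0) :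
    WP backProg s fun s' t => t ≤ 12 * st.length + 20 ∧
      (s'.reg 21 = 1 ∧ s'.reg 22 = 0 ∧ Refuted G B [] ∨
       s'.reg 21 = 0 ∧ ∃ st', IsStack G B st' ∧ StackRepr st' s' ∧
        st'.length ≤ st.length ∧ treeSize B st'.length + pending B st' ≤ pending B st) := by
  rw [backProg, wp_seq, wp_const]
  refine WP.loop (fun s' t =>
    (s'.reg 23 = 0 ∧ s'.reg 21 = 0 ∧ ∃ st', IsStack G B st' ∧ StackRepr st' s' ∧
      Refuted G B st' ∧ st'.length ≤ st.length ∧ pending B st' ≤ pending B st ∧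
      t + 12 * st'.length ≤ 12 * st.length) ∨
    (s'.reg 23 = 1 ∧ t ≤ 12 * st.length + 15 ∧
      (s'.reg 21 = 1 ∧ s'.reg 22 = 0 ∧ Refuted G B [] ∨
       s'.reg 21 = 0 ∧ ∃ st', IsStack G B st' ∧ StackRepr st' s' ∧
        st'.length ≤ st.length ∧ treeSize B st'.length + pending B st' ≤ pending B st)))
    (12 * st.length + 15) ?_ ?_ ?_ ?_
  · exact Or.inl ⟨by simp, by simpa using h21, st, hS, hR.congr ⟨by simp, by simp⟩, href,
      le_rfl, le_rfl, by omega⟩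
  · rintro s' t - (⟨-, -, _, -, -, -, -, -, h⟩ | ⟨-, h, -⟩) <;> omega
  · rintro s' t ha (⟨h23, h21, st', hS', hR', href', hlen, hpen, ht⟩ | ⟨h23, -⟩) hb
    · have e1 := ha.reg 1 rfl
      have e2 := ha.reg 2 rfl
      have ea2 := ha.arr 2 rfl
      simp only [State.reg_setReg, State.arr_setReg] at e1 e2 ea2
      rw [hG.zero] at e1
      rw [hG.one] at e2
      simp at e1 e2
      have h7 := hR'.1.1
      cases st' with
      | nil =>
        simp at h7
        simp [h7, e1]
        exact ⟨by omega, href'⟩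
      | cons p r =>
        obtain ⟨x, f⟩ := p
        simp only [List.length_reverse, List.length_map, List.length_cons] at h7
        rw [wp_ite, holds_eq, h7, e1]
        refine ⟨fun h => by omega, fun _ => ?_⟩
        obtain ⟨hr, h11, h12⟩ := hR'.pop (s' := s'.setReg 7 r.length) (by simp) (by simp) (by simp)
        obtain ⟨k0, k1, k2, k3, k4, k5⟩ := hS'
        simp only [List.length_cons] at hlen ht
        cases f with
        | false =>
          simp only [Bool.false_eq_true, ite_false] at k5
          simp [h7, h12, e1, h11, ea2, hG.comp x k1, e2, h21]
          refine ⟨by omega, (G.comp x, true) :: r, ?_, ?_, by simpa using hlen, ?_⟩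
          · refine ⟨k0, G.comp_mem x k1, k3, by rwa [G.comp_comp x k1], ?_, ?_⟩
            · rw [G.comp_comp x k1]
              exact k5
            · rw [if_pos rfl, G.comp_comp x k1]
              intro Y hY hsep hx
              refine href' Y hY ?_
              simp only [Net.Sep, List.map_cons, List.forall_mem_cons]
              exact ⟨⟨hx, (hY x k1).1 hx⟩, hsep⟩
          · exact hr.push (by simp) (by simp) (by simp)
          · simp [pending] at hpen ⊢
            omega
        | true =>
          simp only [ite_true] at k5
          simp [h7, h12, e1, h21]
          left
          refine ⟨by simp [h23], r, k0, hr.congr ⟨by simp, by simp⟩, ?_, by omega,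
            by simpa [pending] using hpen, by omega⟩
          intro Y hY hsep
          by_cases hx : x ∈ Y
          · refine href' Y hY ?_
            simp only [Net.Sep, List.map_cons, List.forall_mem_cons]
            exact ⟨⟨hx, (hY x k1).1 hx⟩, hsep⟩
          · exact k5 Y hY hsep (by_contra fun h => hx ((hY x k1).2 h))
    · have e1 := ha.reg 1 rfl
      simp only [State.reg_setReg] at e1
      rw [hG.zero] at e1
      simp at e1
      rw [holds_eq, e1] at hb
      omega
  · rintro s' t ha (⟨h23, -⟩ | ⟨h23, ht, h⟩) hb
    · have e1 := ha.reg 1 rfl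
      simp only [State.reg_setReg] at e1
      rw [hG.zero] at e1
      simp at e1
      rw [holds_eq, e1] at hb
      omega
    · exact ⟨by omega, h⟩

/-- Explore the search tree. Register `22` gets the value `1` if a solution is found, which then is
in array `9`, and the value `0` if there is none. -/
def solveProg : Prog :=
  (.const 7 0 ;; .const 21 0) ;;
  .loop (.eq 21 1)
    (nodeProg ;;
      .ite (.eq 9 2) (.const 22 1 ;; .const 21 1)
        (.ite (.eq 9 3) (.store 11 7 20 ;; .store 12 7 1 ;; .succ 7) backProg))

theorem wp_solveProg {G : Net} {s : State} {B : ℕ} (hG : GraphRepr G s) (h6 : s.reg 6 = B)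
    (hB : 0 < B) :
    WP solveProg s fun s' t => t ≤ 600 * (2 ^ (B + 1) * ((B + 1) * (G.L + G.H + 1))) ∧
      (s'.reg 22 = 1 ∧ G.Complete {u | s'.arr 9 u ≠ 0} ∧
         G.cut G.cap {u | s'.arr 9 u ≠ 0} < B ∨
       s'.reg 22 = 0 ∧ ∀ Y, G.Complete Y → B ≤ G.cut G.cap Y) := by
  refine WP.seq (Q₁ := fun s' t => t = 2 ∧ s'.reg 7 = 0 ∧ s'.reg 21 = 0) (by simp) ?_
  rintro s₀ _ a₀ ⟨rfl, h7, h21⟩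
  have hG₀ := hG.congr (a₀.sameOn rfl)
  have hb6 := (a₀.reg 6 rfl).trans h6
  obtain ⟨W, hW⟩ : ∃ W, W = (B + 1) * (G.L + G.H + 1) := ⟨_, rfl⟩
  have hWL : G.L + 1 ≤ W := by
    rw [hW]
    exact le_trans (by omega) (Nat.le_mul_of_pos_left _ (by omega))
  have hN : ∀ n, n ≤ treeSize B 0 → n * (590 * W) + 3 ≤ 600 * (2 ^ (B + 1) * W) := by
    intro n hn
    have h1 : 1 ≤ 2 ^ (B + 1) := Nat.one_le_two_pow
    have h2 : n ≤ 2 ^ (B + 1) := hn.trans (by simp [treeSize])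
    have h3 := Nat.mul_le_mul_right (590 * W) h2
    have h4 := Nat.mul_le_mul h1 (show 1 ≤ W by omega)
    have h5 : 2 ^ (B + 1) * (590 * W) = 590 * (2 ^ (B + 1) * W) := by ring
    omega
  rw [← hW]
  refine WP.loop (fun s' t => ∃ n, t ≤ n * (590 * W) ∧
    ((s'.reg 21 = 0 ∧ ∃ st, IsStack G B st ∧ StackRepr st s' ∧ st.length ≤ B ∧
        n + treeSize B st.length + pending B st ≤ treeSize B 0) ∨
     (s'.reg 21 = 1 ∧ n ≤ treeSize B 0 ∧ (s'.reg 22 = 1 ∧ G.Complete {u | s'.arr 9 u ≠ 0} ∧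
         G.cut G.cap {u | s'.arr 9 u ≠ 0} < B ∨
       s'.reg 22 = 0 ∧ ∀ Y, G.Complete Y → B ≤ G.cut G.cap Y))))
    (600 * (2 ^ (B + 1) * W)) ?_ ?_ ?_ ?_
  · refine ⟨0, by simp, Or.inl ⟨h21, [], trivial, ⟨⟨by simp [h7], by simp⟩, by simp⟩, by simp, ?_⟩⟩
    simp [pending]
  · rintro s' t - ⟨n, ht, ⟨-, st, -, -, -, hn⟩ | ⟨-, hn, -⟩⟩
    · have := hN n (by omega)
      omega
    · have := hN n hn
      omega
  · rintro s' t ha ⟨n, ht, ⟨g21, st, hS, hR, hlen, hn⟩ | ⟨g21, -⟩⟩ hb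
    · have hG' := hG₀.congr (ha.sameOn rfl)
      have g6 : s'.reg 6 = B := (ha.reg 6 rfl).trans hb6
      refine (wp_nodeProg hG' hS.isDec hR.1 (by omega)).seq ?_
      rintro s₁ t₁ a₁ ⟨ht₁, h⟩
      rw [g6] at ht₁ h
      rw [← hW] at ht₁
      have hG₁ := hG'.congr (a₁.sameOn rfl)
      have hR₁ := hR.congr (a₁.sameOn rfl)
      have f21 := (a₁.reg 21 rfl).trans g21
      have hstL : st.length ≤ G.L := by
        have := Net.length_le hS.isDec.nodup hS.isDec.mem_nodes
        simpa using this
      have f7 : s₁.reg 7 = st.length := by simpa using hR₁.1.1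
      have hsize := one_le_treeSize hlen
      have hsep : ∀ X, G.Sep (lits st).reverse X ↔ G.Sep (lits st) X := by
        intro X
        simp only [Net.Sep, List.mem_reverse]
      have key : ∀ t₂, t₂ ≤ 12 * st.length + 40 → t + (t₁ + t₂) + 1 ≤ (n + 1) * (590 * W) := by
        intro t₂ ht₂
        rw [add_mul]
        omega
      rw [wp_ite, holds_eq, hG₁.one]
      rcases h with ⟨i1, i2⟩ | ⟨i1, i2, i3⟩ | ⟨i1, val, i2, ⟨Y, i3, i4⟩, i5⟩
      · refine ⟨fun h => by omega, fun _ => ?_⟩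
        rw [wp_ite, holds_eq, hG₁.two]
        refine ⟨fun h => by omega, fun _ => ?_⟩
        refine (wp_backProg hG₁ hS hR₁ (fun Y _ hY => i2 Y ((hsep Y).2 hY)) f21).imp ?_
        rintro s₂ t₂ - ⟨ht₂, ⟨j1, j2, j3⟩ | ⟨j1, st', j2, j3, j4, j5⟩⟩
        · exact ⟨n + 1, key _ (by omega), Or.inr ⟨j1, by omega,
            Or.inr ⟨j2, fun Y hY => j3 Y hY (by simp [Net.Sep])⟩⟩⟩
        · exact ⟨n + 1, key _ (by omega), Or.inl ⟨j1, st', j2, j3, by omega, by omega⟩⟩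
      · refine ⟨fun _ => ?_, fun h => by omega⟩
        simp only [wp_seq, wp_const]
        refine ⟨n + 1, key _ (by omega), Or.inr ⟨by simp, by omega, Or.inl ⟨by simp, ?_, ?_⟩⟩⟩
        · simpa using i2
        · simpa using i3
      · refine ⟨fun h => by omega, fun _ => ?_⟩
        rw [wp_ite, holds_eq, hG₁.two]
        refine ⟨fun _ => ?_, fun h => absurd i1 h⟩
        have hd : st.length < B := by
          have := hS.length_le_cut ((hsep Y).1 i3)
          omega
        have hdv : st.length ≤ val := by
          have := hS.length_le_cut ((hsep Y).1 i3)
          omega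
        have hts := treeSize_succ hd
        simp only [wp_seq, wp_store, wp_succ]
        refine ⟨n + 1, key _ (by omega), Or.inl ⟨by simp [f21], (s₁.reg 20, false) :: st, ?_, ?_,
          by simpa using hd, ?_⟩⟩
        · obtain ⟨b1, b2, b3, b4, b5⟩ := i5
          rw [List.mem_reverse] at b2 b3
          refine ⟨hS, b1, b2, b3, fun X hX hx hx' => ?_, ?_⟩
          · have := b4 X ((hsep X).2 hX) hx hx'
            omega
          · rw [if_neg (by simp)]
            intro X hX hx hx'
            have := b5 X ((hsep X).2 hX) hx hx'
            omega
        · exact hR₁.push (by simp [f7]) (by simp [f7]) (by simp [f7, hG₁.zero])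
        · simp only [pending, List.length_cons, Bool.false_eq_true, ite_false]
          omega
    · have hG' := hG₀.congr (ha.sameOn rfl)
      rw [holds_eq, hG'.zero] at hb
      omega
  · rintro s' t ha ⟨n, ht, ⟨g21, -⟩ | ⟨g21, hn, h⟩⟩ hb
    · have hG' := hG₀.congr (ha.sameOn rfl)
      rw [holds_eq, hG'.zero] at hb
      omega
    · have := hN n hn
      exact ⟨by omega, h⟩

/-! ### The network of a list of clauses -/

/-- The negation of a node: the nodes `2 * i + 1` and `2 * i + 2` stand for opposite literals. -/
def neg (v : ℕ) : ℕ := if v % 2 = 1 then v + 1 else v - 1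

/-- The arcs of a list of clauses: the clause `a ∨ b` contributes the implications from the negation
of `a` to `b` and from the negation of `b` to `a`. -/
def arcs (cl : List (ℕ × ℕ)) : List (ℕ × ℕ) :=
  cl.flatMap fun p => [(neg p.1, p.2), (neg p.2, p.1)]

theorem arcs_append (cl cl' : List (ℕ × ℕ)) : arcs (cl ++ cl') = arcs cl ++ arcs cl' := by
  simp [arcs]

theorem length_arcs (cl : List (ℕ × ℕ)) : (arcs cl).length = 2 * cl.length := by
  induction cl with
  | nil => rfl
  | cons p cl ih =>
    simp only [arcs, List.flatMap_cons, List.length_append, List.length_cons,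
      List.length_nil] at ih ⊢
    omega

theorem getD_arcs (cl : List (ℕ × ℕ)) (i : ℕ) (hi : i < cl.length) :
    (arcs cl).getD (2 * i) (0, 0) = (neg (cl[i]).1, (cl[i]).2) ∧
      (arcs cl).getD (2 * i + 1) (0, 0) = (neg (cl[i]).2, (cl[i]).1) := by
  induction cl generalizing i with
  | nil => simp at hi
  | cons p cl ih =>
    have h : arcs (p :: cl) = (neg p.1, p.2) :: (neg p.2, p.1) :: arcs cl := rfl
    rw [h]
    cases i with
    | zero => simp
    | succ i =>
      have := ih i (by simpa using hi)
      simpa [mul_add] using this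

/-- The tail of a half-edge. The arc with number `i` has the half-edges `2 * i + 1` and
`2 * i + 2`. -/
def edgeSrc (as : List (ℕ × ℕ)) (h : ℕ) : ℕ :=
  if h % 2 = 1 then (as.getD ((h - 1) / 2) (0, 0)).1 else (as.getD ((h - 1) / 2) (0, 0)).2

/-- The head of a half-edge. -/
def edgeTgt (as : List (ℕ × ℕ)) (h : ℕ) : ℕ :=
  if h % 2 = 1 then (as.getD ((h - 1) / 2) (0, 0)).2 else (as.getD ((h - 1) / 2) (0, 0)).1

/-- The mirror image of a half-edge in the network of a list of clauses. -/
def edgeMir (h : ℕ) : ℕ := if (h - 1) / 2 % 2 = 0 then h + 2 else h - 2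

/-- The half-edges that leave a node, the last one first. -/
def edgeAdj (as : List (ℕ × ℕ)) (v : ℕ) : List ℕ :=
  ((List.range' 1 (2 * as.length)).filter fun h => edgeSrc as h = v).reverse

theorem mem_edgeAdj (as : List (ℕ × ℕ)) (v e : ℕ) :
    e ∈ edgeAdj as v ↔ e ∈ Finset.Icc 1 (2 * as.length) ∧ edgeSrc as e = v := by
  simp only [edgeAdj, List.mem_reverse, List.mem_filter, List.mem_range'_1, decide_eq_true_eq,
    Finset.mem_Icc]
  constructor <;> rintro ⟨⟨h1, h2⟩, h3⟩ <;> exact ⟨⟨h1, by omega⟩, h3⟩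

theorem sum_edgeAdj (as : List (ℕ × ℕ)) (L : ℕ) :
    ∑ v ∈ Finset.Icc 1 L, (edgeAdj as v).length ≤ 2 * as.length := by
  have h : ∀ v, (edgeAdj as v).length =
      ((Finset.Icc 1 (2 * as.length)).filter fun h => edgeSrc as h = v).card := by
    intro v
    have hn : (edgeAdj as v).Nodup := by
      rw [edgeAdj, List.nodup_reverse]
      exact (List.nodup_range' (s := 1)).filter _
    rw [← List.toFinset_card_of_nodup hn]
    congr 1
    ext e
    rw [List.mem_toFinset, mem_edgeAdj, Finset.mem_filter]
  simp only [h]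
  calc _ = ∑ v ∈ Finset.Icc 1 L, ∑ e ∈ Finset.Icc 1 (2 * as.length),
        if edgeSrc as e = v then 1 else 0 := by
        simp only [Finset.card_filter]
    _ = ∑ e ∈ Finset.Icc 1 (2 * as.length), ∑ v ∈ Finset.Icc 1 L,
        if edgeSrc as e = v then 1 else 0 := Finset.sum_comm
    _ ≤ ∑ e ∈ Finset.Icc 1 (2 * as.length), 1 := by
        refine Finset.sum_le_sum fun e _ => ?_
        rw [Finset.sum_ite_eq]
        split_ifs <;> omega
    _ = 2 * as.length := by simp

theorem neg_neg' {v : ℕ} (hv : 1 ≤ v) : neg (neg v) = v := by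
  unfold neg
  split_ifs <;> omega

/-- The clauses speak of the nodes `1, …, L`. -/
def ClausesIn (L : ℕ) (cl : List (ℕ × ℕ)) : Prop :=
  ∀ p ∈ cl, p.1 ∈ Finset.Icc 1 L ∧ p.2 ∈ Finset.Icc 1 L

/-- The tails and heads of the four half-edges of a clause. -/
theorem edge_spec (cl : List (ℕ × ℕ)) {h : ℕ}
    (hh : h ∈ Finset.Icc 1 (4 * cl.length)) :
    ∃ p ∈ cl, ∃ i, (h = 4 * i + 1 ∨ h = 4 * i + 2 ∨ h = 4 * i + 3 ∨ h = 4 * i + 4) ∧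
      i < cl.length ∧
      edgeSrc (arcs cl) (4 * i + 1) = neg p.1 ∧ edgeTgt (arcs cl) (4 * i + 1) = p.2 ∧
      edgeSrc (arcs cl) (4 * i + 2) = p.2 ∧ edgeTgt (arcs cl) (4 * i + 2) = neg p.1 ∧
      edgeSrc (arcs cl) (4 * i + 3) = neg p.2 ∧ edgeTgt (arcs cl) (4 * i + 3) = p.1 ∧
      edgeSrc (arcs cl) (4 * i + 4) = p.1 ∧ edgeTgt (arcs cl) (4 * i + 4) = neg p.2 := by
  rw [Finset.mem_Icc] at hh
  have hi : (h - 1) / 4 < cl.length := by omega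
  obtain ⟨h1, h2⟩ := getD_arcs cl _ hi
  refine ⟨_, List.getElem_mem hi, (h - 1) / 4, by omega, hi, ?_⟩
  generalize (h - 1) / 4 = i at *
  simp only [edgeSrc, edgeTgt, show (4 * i + 1) % 2 = 1 by omega,
    show (4 * i + 2) % 2 = 0 by omega, show (4 * i + 3) % 2 = 1 by omega,
    show (4 * i + 4) % 2 = 0 by omega, show (4 * i + 1 - 1) / 2 = 2 * i by omega,
    show (4 * i + 2 - 1) / 2 = 2 * i by omega, show (4 * i + 3 - 1) / 2 = 2 * i + 1 by omega,
    show (4 * i + 4 - 1) / 2 = 2 * i + 1 by omega, h1, h2, if_true, zero_ne_one, if_false, and_self]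

theorem neg_mem {n v : ℕ} (hv : v ∈ Finset.Icc 1 (4 * n + 2)) :
    neg v ∈ Finset.Icc 1 (4 * n + 2) := by
  rw [Finset.mem_Icc] at *
  unfold neg
  split_ifs <;> omega

theorem edgeSrc_neg (as : List (ℕ × ℕ)) {h : ℕ} (hh : 1 ≤ h) :
    edgeSrc as (neg h) = edgeTgt as h := by
  rcases Nat.mod_two_eq_zero_or_one h with h0 | h0
  · have hn : neg h = h - 1 := if_neg (by omega)
    simp only [edgeSrc, edgeTgt, hn, show (h - 1) % 2 = 1 by omega, h0,
      show (h - 1 - 1) / 2 = (h - 1) / 2 by omega, if_true, zero_ne_one, if_false]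
  · have hn : neg h = h + 1 := if_pos h0
    simp only [edgeSrc, edgeTgt, hn, show (h + 1) % 2 = 0 by omega, h0,
      show (h + 1 - 1) / 2 = (h - 1) / 2 by omega, if_true, zero_ne_one, if_false]

theorem edgeTgt_neg (as : List (ℕ × ℕ)) {h : ℕ} (hh : 1 ≤ h) :
    edgeTgt as (neg h) = edgeSrc as h := by
  have h1 : 1 ≤ neg h := by
    unfold neg
    split_ifs <;> omega
  rw [← edgeSrc_neg as h1, neg_neg' hh]

/-- The network of a list of clauses over the nodes `1, …, 4 * n + 2`. -/
def netOf (n : ℕ) (cl : List (ℕ × ℕ)) (hcl : ClausesIn (4 * n + 2) cl) : Net where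
  L := 4 * n + 2
  H := 4 * cl.length
  comp := neg
  src := edgeSrc (arcs cl)
  tgt := edgeTgt (arcs cl)
  rev := neg
  mir := edgeMir
  cap h := h % 2
  adj := edgeAdj (arcs cl)
  comp_mem v hv := neg_mem hv
  comp_comp v hv := neg_neg' (Finset.mem_Icc.1 hv).1
  comp_ne v hv := by
    rw [Finset.mem_Icc] at hv
    unfold neg
    split_ifs <;> omega
  src_mem h hh := by
    obtain ⟨p, hp, i, hi, -, e1, -, e2, -, e3, -, e4, -⟩ := edge_spec cl hh
    obtain ⟨h1, h2⟩ := hcl p hp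
    rcases hi with rfl | rfl | rfl | rfl
    · rw [e1]; exact neg_mem h1
    · rw [e2]; exact h2
    · rw [e3]; exact neg_mem h2
    · rw [e4]; exact h1
  tgt_mem h hh := by
    obtain ⟨p, hp, i, hi, -, -, e1, -, e2, -, e3, -, e4⟩ := edge_spec cl hh
    obtain ⟨h1, h2⟩ := hcl p hp
    rcases hi with rfl | rfl | rfl | rfl
    · rw [e1]; exact h2
    · rw [e2]; exact neg_mem h1
    · rw [e3]; exact h1
    · rw [e4]; exact neg_mem h2
  rev_mem h hh := by
    rw [Finset.mem_Icc] at *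
    unfold neg
    split_ifs <;> omega
  rev_rev h hh := neg_neg' (Finset.mem_Icc.1 hh).1
  rev_ne h hh := by
    rw [Finset.mem_Icc] at hh
    unfold neg
    split_ifs <;> omega
  src_rev h hh := edgeSrc_neg _ (Finset.mem_Icc.1 hh).1
  tgt_rev h hh := edgeTgt_neg _ (Finset.mem_Icc.1 hh).1
  cap_rev h hh := by
    rw [Finset.mem_Icc] at hh
    unfold neg
    split_ifs <;> omega
  mir_mem h hh := by
    rw [Finset.mem_Icc] at *
    unfold edgeMir
    split_ifs <;> omega
  mir_mir h hh := by
    rw [Finset.mem_Icc] at hh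
    unfold edgeMir
    split_ifs <;> omega
  src_mir h hh := by
    obtain ⟨p, hp, i, hi, -, e1, f1, e2, f2, e3, f3, e4, f4⟩ := edge_spec cl hh
    obtain ⟨h1, h2⟩ := hcl p hp
    rw [Finset.mem_Icc] at h1 h2
    rcases hi with rfl | rfl | rfl | rfl
    · rw [show edgeMir (4 * i + 1) = 4 * i + 3 by unfold edgeMir; split_ifs <;> omega, e3, f1]
    · rw [show edgeMir (4 * i + 2) = 4 * i + 4 by unfold edgeMir; split_ifs <;> omega, e4, f2,
        neg_neg' h1.1]
    · rw [show edgeMir (4 * i + 3) = 4 * i + 1 by unfold edgeMir; split_ifs <;> omega, e1, f3]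
    · rw [show edgeMir (4 * i + 4) = 4 * i + 2 by unfold edgeMir; split_ifs <;> omega, e2, f4,
        neg_neg' h2.1]
  tgt_mir h hh := by
    obtain ⟨p, hp, i, hi, -, e1, f1, e2, f2, e3, f3, e4, f4⟩ := edge_spec cl hh
    obtain ⟨h1, h2⟩ := hcl p hp
    rw [Finset.mem_Icc] at h1 h2
    rcases hi with rfl | rfl | rfl | rfl
    · rw [show edgeMir (4 * i + 1) = 4 * i + 3 by unfold edgeMir; split_ifs <;> omega, f3, e1,
        neg_neg' h1.1]
    · rw [show edgeMir (4 * i + 2) = 4 * i + 4 by unfold edgeMir; split_ifs <;> omega, f4, e2]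
    · rw [show edgeMir (4 * i + 3) = 4 * i + 1 by unfold edgeMir; split_ifs <;> omega, f1, e3,
        neg_neg' h2.1]
    · rw [show edgeMir (4 * i + 4) = 4 * i + 2 by unfold edgeMir; split_ifs <;> omega, f2, e4]
  cap_mir h hh := by
    rw [Finset.mem_Icc] at hh
    unfold edgeMir
    split_ifs <;> omega
  mem_adj v e := by
    rw [mem_edgeAdj, length_arcs, show 2 * (2 * cl.length) = 4 * cl.length by ring]
  sum_adj := by
    have := sum_edgeAdj (arcs cl) (4 * n + 2)
    rw [length_arcs] at this
    omega

open Classical in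
/-- The number of clauses in the list `cl` that the set `Y` of literals does not satisfy. -/
noncomputable def cost (Y : Set ℕ) (cl : List (ℕ × ℕ)) : ℕ :=
  (cl.map fun p => if p.1 ∉ Y ∧ p.2 ∉ Y then 1 else 0).sum

theorem edgeSrc_append {as bs : List (ℕ × ℕ)} {h : ℕ} (hh : h ∈ Finset.Icc 1 (2 * as.length)) :
    edgeSrc (as ++ bs) h = edgeSrc as h := by
  rw [Finset.mem_Icc] at hh
  unfold edgeSrc
  rw [List.getD_append _ _ _ _ (by omega)]

theorem edgeTgt_append {as bs : List (ℕ × ℕ)} {h : ℕ} (hh : h ∈ Finset.Icc 1 (2 * as.length)) :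
    edgeTgt (as ++ bs) h = edgeTgt as h := by
  rw [Finset.mem_Icc] at hh
  unfold edgeTgt
  rw [List.getD_append _ _ _ _ (by omega)]

theorem edge_last (as : List (ℕ × ℕ)) (u w : ℕ) :
    edgeSrc (as ++ [(u, w)]) (2 * as.length + 1) = u ∧
      edgeTgt (as ++ [(u, w)]) (2 * as.length + 1) = w ∧
      edgeSrc (as ++ [(u, w)]) (2 * as.length + 2) = w ∧
      edgeTgt (as ++ [(u, w)]) (2 * as.length + 2) = u := by
  have h1 : (2 * as.length + 1) % 2 = 1 := by omega
  have h2 : (2 * as.length + 2) % 2 = 0 := by omega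
  have h3 : (2 * as.length + 1 - 1) / 2 = as.length := by omega
  have h4 : (2 * as.length + 2 - 1) / 2 = as.length := by omega
  simp only [edgeSrc, edgeTgt, h1, h2, h3, h4]
  simp

theorem edgeAdj_append (as : List (ℕ × ℕ)) (u w v : ℕ) :
    edgeAdj (as ++ [(u, w)]) v =
      (if v = w then [2 * as.length + 2] else []) ++
        ((if v = u then [2 * as.length + 1] else []) ++ edgeAdj as v) := by
  obtain ⟨h1, -, h2, -⟩ := edge_last as u w
  have hf : (List.range' 1 (2 * as.length)).filter (fun h => edgeSrc (as ++ [(u, w)]) h = v) =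
      (List.range' 1 (2 * as.length)).filter fun h => edgeSrc as h = v := by
    refine List.filter_congr fun h hh => ?_
    rw [List.mem_range'_1] at hh
    rw [edgeSrc_append (Finset.mem_Icc.2 ⟨hh.1, by omega⟩)]
  have hr : List.range' 1 (2 * (as ++ [(u, w)]).length) =
      List.range' 1 (2 * as.length) ++ [2 * as.length + 1, 2 * as.length + 2] := by
    rw [List.length_append, List.length_singleton, mul_add, mul_one, ← List.range'_append_1]
    simp only [List.range']
    rw [show 1 + 2 * as.length + 1 = 2 * as.length + 2 by omega, add_comm 1]
  rw [edgeAdj, hr, List.filter_append, List.reverse_append, hf, edgeAdj, ← List.append_assoc]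
  congr 1
  by_cases hu : u = v <;> by_cases hw : w = v <;>
    simp only [List.filter_cons, h1, h2] <;> simp [hu, hw, eq_comm (a := v)]

open Classical in
theorem sum_arcs (as : List (ℕ × ℕ)) (Y : Set ℕ) :
    (∑ h ∈ Finset.Icc 1 (2 * as.length),
      if h % 2 = 1 ∧ edgeSrc as h ∈ Y ∧ edgeTgt as h ∉ Y then 1 else 0) =
      (as.map fun p => if p.1 ∈ Y ∧ p.2 ∉ Y then 1 else 0).sum := by
  induction as using List.reverseRecOn with
  | nil => simp
  | append_singleton as p ih =>
    obtain ⟨u, w⟩ := p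
    obtain ⟨h1, h2, h3, h4⟩ := edge_last as u w
    rw [List.length_append, List.length_singleton, mul_add, mul_one,
      Finset.sum_Icc_succ_top (by omega), Finset.sum_Icc_succ_top (by omega), List.map_append,
      List.sum_append, ← ih]
    rw [add_assoc]
    refine congrArg₂ (· + ·) (Finset.sum_congr rfl fun h hh => ?_) ?_
    · rw [edgeSrc_append hh, edgeTgt_append hh]
    · simp [h1, h2, show (2 * as.length + 1) % 2 = 1 by omega,
        show (2 * as.length + 1 + 1) % 2 = 0 by omega]

theorem cut_netOf {n : ℕ} {cl : List (ℕ × ℕ)} (hcl : ClausesIn (4 * n + 2) cl) {Y : Set ℕ}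
    (hY : (netOf n cl hcl).Complete Y) :
    (netOf n cl hcl).cut (netOf n cl hcl).cap Y = 2 * cost Y cl := by
  classical
  have h1 : (netOf n cl hcl).cut (netOf n cl hcl).cap Y =
      ∑ h ∈ Finset.Icc 1 (2 * (arcs cl).length),
        if h % 2 = 1 ∧ edgeSrc (arcs cl) h ∈ Y ∧ edgeTgt (arcs cl) h ∉ Y then 1 else 0 := by
    rw [length_arcs, show 2 * (2 * cl.length) = 4 * cl.length by ring]
    exact Finset.sum_congr rfl fun h _ => by congr
  rw [h1, sum_arcs]
  have key : ∀ l : List (ℕ × ℕ), (∀ p ∈ l, p ∈ cl) →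
      ((arcs l).map fun p => if p.1 ∈ Y ∧ p.2 ∉ Y then 1 else 0).sum = 2 * cost Y l := by
    intro l
    induction l with
    | nil => intro _; rfl
    | cons p l ih =>
      intro hl
      obtain ⟨hp1, hp2⟩ := hcl p (hl p (by simp))
      have e1 : p.1 ∈ Y ↔ neg p.1 ∉ Y := hY p.1 hp1
      have e2 : p.2 ∈ Y ↔ neg p.2 ∉ Y := hY p.2 hp2
      have := ih fun q hq => hl q (by simp [hq])
      rw [show arcs (p :: l) = (neg p.1, p.2) :: (neg p.2, p.1) :: arcs l from rfl]
      simp only [cost, List.map_cons, List.sum_cons] at this ⊢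
      rw [this, e1, e2]
      by_cases a : neg p.1 ∈ Y <;> by_cases b : neg p.2 ∈ Y <;>
        simp [a, b]
      ring
  exact key cl fun p hp => hp

/-! ### Building the network on the machine -/

/-- Prepending a fresh half-edge `e` to the list of the node `u`. -/
theorem IsChain.insert {nxt hd : ℕ → ℕ} {adj : ℕ → List ℕ} {e : ℕ} (u : ℕ) (he : e ≠ 0)
    (hfresh : ∀ v, e ∉ adj v) (h : ∀ v, IsChain nxt (hd v) (adj v)) (v : ℕ) :
    IsChain (Function.update nxt e (hd u)) (Function.update hd u e v)
      ((if v = u then [e] else []) ++ adj v) := by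
  have hold : ∀ w, IsChain (Function.update nxt e (hd u)) (hd w) (adj w) := fun w =>
    (h w).congr fun x hx => Function.update_of_ne (by rintro rfl; exact hfresh w hx) _ _
  by_cases hv : v = u
  · subst hv
    rw [if_pos rfl, Function.update_self]
    refine ⟨rfl, he, ?_⟩
    rw [Function.update_self]
    exact hold v
  · rw [if_neg hv, Function.update_of_ne hv]
    exact hold v

/-- The network with the nodes `1, …, N` and the arcs `as`, in the layout of `GraphRepr`. -/
structure BuildRepr (N : ℕ) (as : List (ℕ × ℕ)) (s : State) : Prop where
  zero : s.reg 1 = 0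
  one : s.reg 2 = 1
  two : s.reg 3 = 2
  L : s.reg 4 = N + 1
  H : s.reg 5 = 2 * as.length + 1
  comp : ∀ v ∈ Finset.Icc 1 N, s.arr 2 v = neg v
  tgt : ∀ e ∈ Finset.Icc 1 (2 * as.length), s.arr 5 e = edgeTgt as e
  rev : ∀ e ∈ Finset.Icc 1 (2 * as.length), s.arr 6 e = neg e
  cap : ∀ e ∈ Finset.Icc 1 (2 * as.length), s.arr 8 e = e % 2
  chain : ∀ v, IsChain (s.arr 4) (s.arr 3 v) (edgeAdj as v)

theorem BuildRepr.congr {N : ℕ} {as : List (ℕ × ℕ)} {s s' : State} (h : BuildRepr N as s)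
    (hs : SameOn [1, 2, 3, 4, 5] [2, 3, 4, 5, 6, 8] s s') : BuildRepr N as s' := by
  obtain ⟨hr, ha⟩ := hs
  simp only [List.forall_mem_cons, List.not_mem_nil, false_imp_iff, implies_true, and_true] at hr ha
  obtain ⟨r1, r2, r3, r4, r5⟩ := hr
  obtain ⟨a2, a3, a4, a5, a6, a8⟩ := ha
  exact ⟨r1 ▸ h.zero, r2 ▸ h.one, r3 ▸ h.two, r4 ▸ h.L, r5 ▸ h.H, a2 ▸ h.comp, a5 ▸ h.tgt,
    a6 ▸ h.rev, a8 ▸ h.cap, a3 ▸ a4 ▸ h.chain⟩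

theorem BuildRepr.graphRepr {n : ℕ} {cl : List (ℕ × ℕ)} (hcl : ClausesIn (4 * n + 2) cl)
    {s : State} (h : BuildRepr (4 * n + 2) (arcs cl) s) : GraphRepr (netOf n cl hcl) s := by
  have hl : 2 * (arcs cl).length = 4 * cl.length := by rw [length_arcs]; ring
  obtain ⟨h1, h2, h3, h4, h5, h6, h7, h8, h9, h10⟩ := h
  rw [hl] at h5 h7 h8 h9
  exact ⟨h1, h2, h3, h4, h5, h6, h7, h8, h9, fun v _ => h10 v⟩

/-- Enters the half-edge in register `5`, from the node in register `u` to the node in register `w`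
and with the capacity in register `c`, except for its reversal. -/
def halfEdgeProg (u w c : ℕ) : Prog :=
  .store 5 5 w ;; .store 8 5 c ;; .load 13 3 u ;; .store 4 5 13 ;; .store 3 u 5

theorem wp_halfEdgeProg (s : State) {u w c : ℕ} (hu13 : u ≠ 13) :
    WP (halfEdgeProg u w c) s fun s' t => t = 5 ∧
      s'.arr 5 = Function.update (s.arr 5) (s.reg 5) (s.reg w) ∧
      s'.arr 8 = Function.update (s.arr 8) (s.reg 5) (s.reg c) ∧
      s'.arr 4 = Function.update (s.arr 4) (s.reg 5) (s.arr 3 (s.reg u)) ∧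
      s'.arr 3 = Function.update (s.arr 3) (s.reg u) (s.reg 5) := by
  simp [halfEdgeProg, hu13]

/-- Adds the arc from the node in register `u` to the node in register `w`. -/
def addArcProg (u w : ℕ) : Prog :=
  halfEdgeProg u w 2 ;;
  (.copy 14 5 ;; .succ 5 ;; .store 6 14 5 ;; .store 6 5 14) ;;
  halfEdgeProg w u 1 ;; .succ 5

theorem wp_addArcProg {N : ℕ} {as : List (ℕ × ℕ)} {s : State} (h : BuildRepr N as s) {u w a b : ℕ}
    (hu : s.reg u = a) (hw : s.reg w = b) (hu5 : u ≠ 5) (hu13 : u ≠ 13) (hu14 : u ≠ 14)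
    (hw5 : w ≠ 5) (hw13 : w ≠ 13) (hw14 : w ≠ 14) :
    WP (addArcProg u w) s fun s' t => t = 15 ∧ BuildRepr N (as ++ [(a, b)]) s' := by
  obtain ⟨h1, h2, h3, h4, h5, h6, h7, h8, h9, h10⟩ := h
  obtain ⟨-, e1, -, e2⟩ := edge_last as a b
  have hmem : ∀ e, e ∈ Finset.Icc 1 (2 * (as ++ [(a, b)]).length) ↔
      e ∈ Finset.Icc 1 (2 * as.length) ∨ e = 2 * as.length + 1 ∨ e = 2 * as.length + 2 := by
    intro e
    simp only [Finset.mem_Icc, List.length_append, List.length_singleton]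
    omega
  have hne : ∀ e ∈ Finset.Icc 1 (2 * as.length), e ≠ 2 * as.length + 1 ∧
      e ≠ 2 * as.length + 2 := by
    intro e he
    rw [Finset.mem_Icc] at he
    omega
  have keep : ∀ (x u' w' c : ℕ), x ≠ 13 → (halfEdgeProg u' w' c).keepsReg x = true := by
    intro x u' w' c hx
    simpa [halfEdgeProg, Prog.keepsReg] using hx.symm
  refine (wp_halfEdgeProg s hu13).seq ?_
  rintro s₁ _ f₁ ⟨rfl, i5, i8, i4, i3⟩
  have i2 : s₁.arr 2 = s.arr 2 := f₁.arr 2 rfl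
  have i6 : s₁.arr 6 = s.arr 6 := f₁.arr 6 rfl
  have r₁ : ∀ x, x ≠ 13 → s₁.reg x = s.reg x := fun x hx => f₁.reg x (keep x _ _ _ hx)
  rw [h5, hw] at i5
  rw [h5, h2] at i8
  rw [h5, hu] at i4 i3
  have hs₂ : WP (.copy 14 5 ;; .succ 5 ;; .store 6 14 5 ;; .store 6 5 14) s₁ fun s' t =>
      t = 4 ∧ (∀ x, x ≠ 14 → x ≠ 5 → s'.reg x = s₁.reg x) ∧ s'.reg 5 = 2 * as.length + 2 ∧
      s'.arr 6 = Function.update (Function.update (s.arr 6) (2 * as.length + 1)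
        (2 * as.length + 2)) (2 * as.length + 2) (2 * as.length + 1) := by
    have := r₁ 5 (by decide)
    simp [this, h5, i6]
    intro x hx hx'
    simp [hx, hx']
  refine hs₂.seq ?_
  rintro s₂ _ f₂ ⟨rfl, r₂, j5, j6⟩
  have k2 := f₂.arr 2 rfl
  have k3 := f₂.arr 3 rfl
  have k4 := f₂.arr 4 rfl
  have k5 := f₂.arr 5 rfl
  have k8 := f₂.arr 8 rfl
  refine (wp_halfEdgeProg s₂ hw13).seq ?_
  rintro s₃ _ f₃ ⟨rfl, l5, l8, l4, l3⟩
  have l2 : s₃.arr 2 = s₂.arr 2 := f₃.arr 2 rfl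
  have l6 : s₃.arr 6 = s₂.arr 6 := f₃.arr 6 rfl
  have r₃ : ∀ x, x ≠ 13 → s₃.reg x = s₂.reg x := fun x hx => f₃.reg x (keep x _ _ _ hx)
  have hr : ∀ x, x ≠ 13 → x ≠ 14 → x ≠ 5 → s₃.reg x = s.reg x := fun x h1 h2 h3 => by
    rw [r₃ x h1, r₂ x h2 h3, r₁ x h1]
  rw [j5, r₂ u hu14 hu5, r₁ u hu13, k5, i5] at l5
  rw [j5, r₂ 1 (by decide) (by decide), r₁ 1 (by decide), k8, i8] at l8
  rw [j5, r₂ w hw14 hw5, r₁ w hw13, k4, k3, i4, i3] at l4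
  rw [j5, r₂ w hw14 hw5, r₁ w hw13, k3, i3] at l3
  rw [j6] at l6
  rw [k2, i2] at l2
  rw [hu] at l5
  rw [h1] at l8
  rw [hw] at l4 l3
  rw [wp_succ]
  refine ⟨rfl, ?_⟩
  constructor
  · simp [hr, h1]
  · simp [hr, h2]
  · simp [hr, h3]
  · simp [hr, h4]
  · simp [r₃ 5 (by decide), j5]
    ring
  · simpa [l2] using h6
  · intro e he
    rw [State.arr_setReg, l5]
    rcases (hmem e).1 he with he' | rfl | rfl
    · have := hne e he'
      simp [this, h7 e he', edgeTgt_append he']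
    · simp [e1]
    · simp [e2]
  · intro e he
    rw [State.arr_setReg, l6]
    rcases (hmem e).1 he with he' | rfl | rfl
    · have := hne e he'
      simp [this, h8 e he']
    · simp [neg]
    · simp [neg]
  · intro e he
    rw [State.arr_setReg, l8]
    rcases (hmem e).1 he with he' | rfl | rfl
    · have := hne e he'
      simp [this, h9 e he']
    · simp
    · simp
  · intro v
    have f1 : ∀ v, 2 * as.length + 1 ∉ edgeAdj as v := by
      intro v hv
      rw [mem_edgeAdj, Finset.mem_Icc] at hv
      omega
    have f2 : ∀ v, 2 * as.length + 2 ∉ (if v = a then [2 * as.length + 1] else []) ++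
        edgeAdj as v := by
      intro v hv
      rw [List.mem_append, mem_edgeAdj, Finset.mem_Icc] at hv
      split_ifs at hv <;> simp at hv
    have := IsChain.insert b (by omega) f2 (IsChain.insert a (by omega) f1 h10) v
    rw [edgeAdj_append, State.arr_setReg, l3, l4]
    exact this

/-- Adds the clause of the nodes in registers `26` and `27`. -/
def addClauseProg : Prog :=
  .load 15 2 26 ;; .load 16 2 27 ;; addArcProg 15 27 ;; addArcProg 16 26

/-- Adds `s.reg c` copies of the clause of the nodes in registers `26` and `27`. -/
def copiesProg (c : ℕ) : Prog :=
  .const 29 0 ;; .loop (.lt 29 c) (addClauseProg ;; .succ 29)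

theorem wp_addClauseProg {N : ℕ} {cl : List (ℕ × ℕ)} {s : State} (h : BuildRepr N (arcs cl) s)
    {a b : ℕ} (ha : s.reg 26 = a) (hb : s.reg 27 = b) (ha' : a ∈ Finset.Icc 1 N)
    (hb' : b ∈ Finset.Icc 1 N) :
    WP addClauseProg s fun s' t => t = 32 ∧ BuildRepr N (arcs (cl ++ [(a, b)])) s' := by
  simp only [addClauseProg]
  rw [wp_seq, wp_load, wp_seq, wp_load]
  have h' : BuildRepr N (arcs cl) ((s.setReg 15 (s.arr 2 (s.reg 26))).setReg 16
      ((s.setReg 15 (s.arr 2 (s.reg 26))).arr 2 ((s.setReg 15 (s.arr 2 (s.reg 26))).reg 27))) :=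
    h.congr (by simp [SameOn])
  have e1 := h.comp a ha'
  have e2 := h.comp b hb'
  refine (wp_addArcProg h' (a := neg a) (b := b) (by simp [ha, e1]) (by simp [hb])
    (by decide) (by decide) (by decide) (by decide) (by decide) (by decide)).seq ?_
  rintro s₁ t₁ f ⟨rfl, h₁⟩
  have f16 := f.reg 16 rfl
  have f26 := f.reg 26 rfl
  refine (wp_addArcProg h₁ (a := neg b) (b := a) (by rw [f16]; simp [hb, e2])
    (by rw [f26]; simp [ha])
    (by decide) (by decide) (by decide) (by decide) (by decide) (by decide)).imp ?_
  rintro s₂ t₂ - ⟨rfl, h₂⟩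
  refine ⟨rfl, ?_⟩
  rw [arcs_append]
  simpa [arcs] using h₂

theorem wp_copiesProg {N : ℕ} {cl : List (ℕ × ℕ)} {s : State} (h : BuildRepr N (arcs cl) s)
    {a b c m : ℕ} (ha : s.reg 26 = a) (hb : s.reg 27 = b) (ha' : a ∈ Finset.Icc 1 N)
    (hb' : b ∈ Finset.Icc 1 N) (hc : c = 30 ∨ c = 31) (hm : s.reg c = m) :
    WP (copiesProg c) s fun s' t => t ≤ 40 * (m + 1) ∧
      BuildRepr N (arcs (cl ++ List.replicate m (a, b))) s' := by
  have hc29 : c ≠ 29 := by omega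
  simp only [copiesProg, wp_seq, wp_const]
  refine WP.loop (fun s' t => ∃ i, i ≤ m ∧ t ≤ 34 * i ∧ s'.reg 29 = i ∧
    BuildRepr N (arcs (cl ++ List.replicate i (a, b))) s') (34 * m) ?_ ?_ ?_ ?_
  · exact ⟨0, by omega, by omega, by simp, by simpa using h.congr (by simp [SameOn])⟩
  · rintro s' t - ⟨i, hi, ht, -⟩
    omega
  · rintro s' t f ⟨i, hi, ht, h29, h'⟩ hlt
    have f26 : s'.reg 26 = a := by simpa [ha] using f.reg 26 rfl
    have f27 : s'.reg 27 = b := by simpa [hb] using f.reg 27 rfl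
    have fc : s'.reg c = m := by
      rcases hc with rfl | rfl
      · simpa [hm] using f.reg 30 rfl
      · simpa [hm] using f.reg 31 rfl
    rw [holds_lt, h29, fc] at hlt
    refine (wp_addClauseProg h' f26 f27 ha' hb').seq ?_
    rintro s₁ t₁ f₁ ⟨rfl, h₁⟩
    rw [wp_succ]
    have := f₁.reg 29 rfl
    refine ⟨i + 1, hlt, by omega, by simp [this, h29], ?_⟩
    rw [List.append_assoc, ← List.replicate_succ'] at h₁
    exact h₁.congr (by simp [SameOn])
  · rintro s' t f ⟨i, hi, ht, h29, h'⟩ hlt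
    have fc : s'.reg c = m := by
      rcases hc with rfl | rfl
      · simpa [hm] using f.reg 30 rfl
      · simpa [hm] using f.reg 31 rfl
    rw [holds_lt, h29, fc] at hlt
    obtain rfl : i = m := by omega
    exact ⟨by omega, h'⟩

/-- Adds two nodes, the negations of each other. -/
def pairNodesProg : Prog :=
  .copy 14 4 ;; .succ 4 ;; .store 2 14 4 ;; .store 2 4 14 ;; .succ 4

theorem wp_pairNodesProg {N : ℕ} {as : List (ℕ × ℕ)} {s : State} (h : BuildRepr N as s)
    (hN : N % 2 = 0) :
    WP pairNodesProg s fun s' t => t = 5 ∧ BuildRepr (N + 2) as s' := by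
  obtain ⟨h1, h2, h3, h4, h5, h6, h7, h8, h9, h10⟩ := h
  simp only [pairNodesProg, wp_seq, wp_store, wp_copy, wp_succ, true_and]
  constructor
  · simp [h1]
  · simp [h2]
  · simp [h3]
  · simp [h4]
  · simp [h5]
  · intro v hv
    have h0 : v ∈ Finset.Icc 1 N ∨ v = N + 1 ∨ v = N + 2 := by
      rw [Finset.mem_Icc] at *
      omega
    rcases h0 with h0 | rfl | rfl
    · have : v ≠ N + 1 ∧ v ≠ N + 2 := by
        rw [Finset.mem_Icc] at h0
        omega
      simp [h4, this, h6 v h0]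
    · have : (N + 1) % 2 = 1 := by omega
      simp [h4, neg, this]
    · simp [h4, neg, hN]
  · simpa using h7
  · simpa using h8
  · simpa using h9
  · simpa using h10

/-! ### Numbering the variables -/

/-- Enters the variable `x` into the list of variables seen so far. -/
def addName (names : List ℕ) (x : ℕ) : List ℕ := if x ∈ names then names else names ++ [x]

/-- The nodes of a literal. The variable with number `i` has the nodes `4 * i + 3` and `4 * i + 5`,
the first for its positive and the second for its negated occurrences, and the nodes `4 * i + 4` and
`4 * i + 6` are their negations. -/
def litNode (names : List ℕ) (l : Literal) : ℕ :=
  4 * names.idxOf l.1 + if l.2 then 3 else 6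

theorem mem_addName {names : List ℕ} {x y : ℕ} : y ∈ addName names x ↔ y ∈ names ∨ y = x := by
  unfold addName
  split_ifs with h
  · exact ⟨Or.inl, fun h' => h'.elim id fun h' => h' ▸ h⟩
  · simp

theorem nodup_addName {names : List ℕ} (h : names.Nodup) (x : ℕ) : (addName names x).Nodup := by
  unfold addName
  split_ifs with hx
  · exact h
  · rw [List.nodup_append]
    exact ⟨h, by simp, by simp; rintro a ha rfl; exact hx ha⟩

theorem length_addName (names : List ℕ) (x : ℕ) : (addName names x).length ≤ names.length + 1 := by
  unfold addName
  split_ifs <;> simp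

theorem litNode_addName {names : List ℕ} {l : Literal} (h : l.1 ∈ names) (x : ℕ) :
    litNode (addName names x) l = litNode names l := by
  unfold litNode addName
  split_ifs <;> simp [List.idxOf_append_of_mem h]

theorem litNode_mem {names : List ℕ} {l : Literal} (h : l.1 ∈ names) :
    litNode names l ∈ Finset.Icc 1 (4 * names.length + 2) := by
  have := List.idxOf_lt_length_of_mem h
  rw [Finset.mem_Icc]
  unfold litNode
  split_ifs <;> omega

/-- The variables seen so far in the memory of the machine: array `13` maps them to their first
node, and array `14` maps this node back. -/
structure VarRepr (names : List ℕ) (s : State) : Prop where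
  nodup : names.Nodup
  idx : ∀ x, s.arr 13 x = if x ∈ names then 4 * names.idxOf x + 3 else 0
  name : ∀ (i : ℕ) (hi : i < names.length), s.arr 14 (4 * i + 3) = names[i]

theorem VarRepr.congr {names : List ℕ} {s s' : State} (h : VarRepr names s)
    (hs : SameOn [] [13, 14] s s') : VarRepr names s' := by
  obtain ⟨-, ha⟩ := hs
  simp only [List.forall_mem_cons, List.not_mem_nil, false_imp_iff, implies_true, and_true] at ha
  exact ⟨h.nodup, ha.1 ▸ h.idx, ha.2 ▸ h.name⟩

/-- The part of the input that starts at the position in register `32` is `rest`. -/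
def ReadAt (rest : List ℕ) (s : State) : Prop := ∀ i, s.arr 0 (s.reg 32 + i) = rest.getD i 0

theorem ReadAt.congr {rest : List ℕ} {s s' : State} (h : ReadAt rest s)
    (hs : SameOn [32] [0] s s') : ReadAt rest s' := by
  obtain ⟨hr, ha⟩ := hs
  simp only [List.forall_mem_cons, List.not_mem_nil, false_imp_iff, implies_true, and_true] at hr ha
  intro i
  rw [hr, ha]
  exact h i

/-- What has been built after reading a part of the input: the variables `names`, the clauses `cl`,
and the unread part `rest` of the input. -/
structure Parsed (names : List ℕ) (cl : List (ℕ × ℕ)) (rest : List ℕ) (s : State) : Prop where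
  build : BuildRepr (4 * names.length + 2) (arcs cl) s
  var : VarRepr names s
  read : ReadAt rest s

theorem Parsed.congr {names : List ℕ} {cl : List (ℕ × ℕ)} {rest : List ℕ} {s s' : State}
    (h : Parsed names cl rest s)
    (hs : SameOn [1, 2, 3, 4, 5, 32] [0, 2, 3, 4, 5, 6, 8, 13, 14] s s') :
    Parsed names cl rest s' :=
  have hr : ∀ {R : List ℕ}, R ⊆ [1, 2, 3, 4, 5, 32] → ∀ x ∈ R, s'.reg x = s.reg x :=
    fun h x hx => hs.1 x (h hx)
  have ha : ∀ {A : List ℕ}, A ⊆ [0, 2, 3, 4, 5, 6, 8, 13, 14] → ∀ a ∈ A, s'.arr a = s.arr a :=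
    fun h a hx => hs.2 a (h hx)
  ⟨h.build.congr ⟨hr (by decide), ha (by decide)⟩, h.var.congr ⟨hr (by decide), ha (by decide)⟩,
    h.read.congr ⟨hr (by decide), ha (by decide)⟩⟩

/-- Reads a number into register `d`. -/
def readProg (d : ℕ) : Prog := .load d 0 32 ;; .succ 32

theorem wp_readProg {names : List ℕ} {cl : List (ℕ × ℕ)} {a : ℕ} {rest : List ℕ} {s : State}
    (h : Parsed names cl (a :: rest) s) {d : ℕ} (hd : 5 < d) (hd' : d ≠ 32) :
    WP (readProg d) s fun s' t => t = 2 ∧ s'.reg d = a ∧ Parsed names cl rest s' := by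
  have h0 := h.read 0
  simp only [add_zero, List.getD_cons_zero] at h0
  simp only [readProg, wp_seq, wp_load, wp_succ, true_and]
  refine ⟨by simp [hd', h0], ?_, h.var.congr (by simp [SameOn]), ?_⟩
  · refine h.build.congr ⟨fun x hx => ?_, fun x hx => by simp⟩
    have : x ≠ 32 ∧ x ≠ d := by
      simp at hx
      omega
    simp [this]
  · intro i
    have := h.read (i + 1)
    simp only [List.getD_cons_succ] at this
    simpa [hd'.symm, add_assoc, add_comm 1] using this

/-- Enters the variable in register `15`, whose first node will be the one in register `4`. -/
def newVarProg : Prog :=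
  (.copy 17 4 ;; .store 13 15 17 ;; .store 14 17 15) ;; pairNodesProg ;; pairNodesProg

theorem wp_newVarProg {names : List ℕ} {cl : List (ℕ × ℕ)} {rest : List ℕ} {s : State}
    (h : Parsed names cl rest s) {x : ℕ} (hx : s.reg 15 = x) (hx' : x ∉ names) :
    WP newVarProg s fun s' t => t = 13 ∧ s'.reg 17 = 4 * (addName names x).idxOf x + 3 ∧
      Parsed (addName names x) cl rest s' := by
  have hadd : addName names x = names ++ [x] := if_neg hx'
  have hidx : (names ++ [x]).idxOf x = names.length := by
    rw [List.idxOf_append_of_notMem hx']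
    simp
  have h4 := h.build.L
  have hfirst : WP (.copy 17 4 ;; .store 13 15 17 ;; .store 14 17 15) s fun s' t => t = 3 ∧
      s'.reg 17 = 4 * names.length + 3 ∧ VarRepr (names ++ [x]) s' := by
    simp only [wp_seq, wp_copy, wp_store, true_and]
    refine ⟨by simp [h4], nodup_addName h.var.nodup x |> hadd.subst, fun y => ?_, fun i hi => ?_⟩
    · have := h.var.idx y
      by_cases hy : y = x
      · subst hy
        simp [hidx, h4, hx]
      · by_cases hy' : y ∈ names
        · simp [hx, hy, hy', List.idxOf_append_of_mem hy', this]
        · simp [hx, hy, hy', this]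
    · rw [List.length_append, List.length_singleton] at hi
      rcases Nat.lt_succ_iff_lt_or_eq.1 hi with hi | rfl
      · have := h.var.name i hi
        simp [h4, hi, hi.ne, this]
      · simp [h4, hx]
  refine hfirst.seq ?_
  rintro s₁ _ f₁ ⟨rfl, h17, hv⟩
  have hb₁ : BuildRepr (4 * names.length + 2) (arcs cl) s₁ := h.build.congr (f₁.sameOn rfl)
  refine (wp_pairNodesProg hb₁ (by omega)).seq ?_
  rintro s₂ _ f₂ ⟨rfl, hb₂⟩
  refine (wp_pairNodesProg hb₂ (by omega)).imp ?_
  rintro s₃ _ f₃ ⟨rfl, hb₃⟩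
  refine ⟨rfl, ?_, ?_, ?_, ?_⟩
  · rw [f₃.reg 17 rfl, f₂.reg 17 rfl, h17, hadd, hidx]
  · rw [hadd, List.length_append, List.length_singleton, mul_add]
    exact hb₃
  · rw [hadd]
    exact (hv.congr (f₂.sameOn rfl)).congr (f₃.sameOn rfl)
  · exact ((h.read.congr (f₁.sameOn rfl)).congr (f₂.sameOn rfl)).congr (f₃.sameOn rfl)

/-- Reads a literal and puts its node into register `d`. -/
def readLitProg (d : ℕ) : Prog :=
  readProg 15 ;; readProg 16 ;; .load 17 13 15 ;; .ite (.eq 17 1) newVarProg .skip ;;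
  .ite (.eq 16 2) .skip (.succ 17 ;; .succ 17 ;; .succ 17) ;; .copy d 17

theorem wp_readLitProg {names : List ℕ} {cl : List (ℕ × ℕ)} {l : Literal} {rest : List ℕ}
    {s : State} (h : Parsed names cl (l.1 :: l.2.toNat :: rest) s) {d : ℕ} (hd : d = 26 ∨ d = 27) :
    WP (readLitProg d) s fun s' t => t ≤ 25 ∧ s'.reg d = litNode (addName names l.1) l ∧
      Parsed (addName names l.1) cl rest s' := by
  refine (wp_readProg h (by decide) (by decide)).seq ?_
  rintro s₁ _ - ⟨rfl, h15, h₁⟩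
  refine (wp_readProg h₁ (by decide) (by decide)).seq ?_
  rintro s₂ _ f₂ ⟨rfl, h16, h₂⟩
  have h15' : s₂.reg 15 = l.1 := (f₂.reg 15 rfl).trans h15
  have hidx := h₂.var.idx l.1
  rw [wp_seq, wp_load]
  have h₃ : Parsed names cl rest (s₂.setReg 17 (s₂.arr 13 (s₂.reg 15))) :=
    h₂.congr (by simp [SameOn])
  have hvar : WP (.ite (.eq 17 1) newVarProg .skip) (s₂.setReg 17 (s₂.arr 13 (s₂.reg 15)))
      fun s' t => t ≤ 14 ∧ s'.reg 17 = 4 * (addName names l.1).idxOf l.1 + 3 ∧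
      Parsed (addName names l.1) cl rest s' := by
    rw [wp_ite, holds_eq]
    simp only [State.reg_setReg, if_true, show ((1 : ℕ) = 17) = False by simp, if_false,
      h15', hidx, h₂.build.zero]
    refine ⟨fun h0 => ?_, fun h0 => ?_⟩
    · have hx : l.1 ∉ names := by
        intro hx
        rw [if_pos hx] at h0
        omega
      rw [h15', hidx] at h₃
      refine (wp_newVarProg h₃ (by simp [h15']) hx).imp ?_
      rintro s₄ _ - ⟨rfl, a, b⟩
      exact ⟨by omega, a, b⟩
    · have hx : l.1 ∈ names := by
        by_contra hx
        rw [if_neg hx] at h0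
        omega
      have hadd : addName names l.1 = names := if_pos hx
      rw [h15', hidx] at h₃
      rw [wp_skip, hadd]
      exact ⟨by omega, by simp [hx], h₃⟩
  refine hvar.seq ?_
  rintro s₄ t₄ f₄ ⟨ht₄, h17, h₄⟩
  have h16' : s₄.reg 16 = l.2.toNat := by
    rw [f₄.reg 16 rfl]
    simpa using h16
  rw [wp_seq, wp_ite, holds_eq, h16', h₄.build.one]
  unfold litNode
  refine ⟨fun hl => ?_, fun hl => ?_⟩
  · rw [wp_skip, wp_copy]
    rw [Bool.toNat_eq_one] at hl
    refine ⟨by omega, by simp [h17, hl], h₄.congr ?_⟩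
    rcases hd with rfl | rfl <;> simp [SameOn]
  · simp only [wp_seq, wp_succ, wp_copy]
    have hl : l.2 = false := by
      cases h : l.2 <;> simp_all
    refine ⟨by omega, by simp [h17, hl], h₄.congr ?_⟩
    rcases hd with rfl | rfl <;> simp [SameOn]

/-! ### Reading the formula -/

/-- The node clauses of a clause. The empty clause becomes two clauses of which every complete set
of nodes violates exactly one. -/
def pairs (names : List ℕ) : List Literal → List (ℕ × ℕ)
  | [] => [(1, 1), (2, 2)]
  | [l] => [(litNode names l, litNode names l)]
  | l :: l' :: _ => [(litNode names l, litNode names l')]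

/-- Enters the variables of a clause into the list of variables seen so far. -/
def addNames (names : List ℕ) (C : List Literal) : List ℕ :=
  C.foldl (fun ns l => addName ns l.1) names

/-- The variables of a list of clauses, in the order of their first occurrences. -/
def namesOf (L : List (List Literal)) : List ℕ := L.foldl addNames []

/-- The node clauses of a list of clauses, each with multiplicity `c`. -/
def pairsOf (names : List ℕ) (c : ℕ) (L : List (List Literal)) : List (ℕ × ℕ) :=
  L.flatMap fun C => (pairs names C).flatMap (List.replicate c)

/-- For each of the first `n` variables, the clause saying that the first node of the variable
implies the second one, with multiplicity `c`. -/
def links (c n : ℕ) : List (ℕ × ℕ) :=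
  (List.range n).flatMap fun i => List.replicate c (4 * i + 4, 4 * i + 5)

theorem mem_addNames {names : List ℕ} {C : List Literal} {y : ℕ} :
    y ∈ addNames names C ↔ y ∈ names ∨ ∃ l ∈ C, l.1 = y := by
  unfold addNames
  induction C generalizing names with
  | nil => simp
  | cons l C ih =>
    rw [List.foldl_cons, ih, mem_addName]
    simp [or_assoc, eq_comm (a := y)]

theorem nodup_addNames {names : List ℕ} (h : names.Nodup) (C : List Literal) :
    (addNames names C).Nodup := by
  unfold addNames
  induction C generalizing names with
  | nil => exact h
  | cons l C ih => exact ih (nodup_addName h _)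

theorem length_addNames (names : List ℕ) (C : List Literal) :
    (addNames names C).length ≤ names.length + C.length := by
  unfold addNames
  induction C generalizing names with
  | nil => simp
  | cons l C ih =>
    have := ih (addName names l.1)
    have := length_addName names l.1
    simp only [List.foldl_cons, List.length_cons]
    omega

theorem litNode_addNames {names : List ℕ} {l : Literal} (h : l.1 ∈ names) (C : List Literal) :
    litNode (addNames names C) l = litNode names l := by
  unfold addNames
  induction C generalizing names with
  | nil => rfl
  | cons l' C ih =>
    rw [List.foldl_cons, ih (mem_addName.2 (Or.inl h)), litNode_addName h]

theorem pairs_addNames {names : List ℕ} {C : List Literal} (h : ∀ l ∈ C, l.1 ∈ names)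
    (C' : List Literal) : pairs (addNames names C') C = pairs names C := by
  match C with
  | [] => rfl
  | [l] => rw [pairs, pairs, litNode_addNames (h l (by simp))]
  | l :: l' :: _ =>
    rw [pairs, pairs, litNode_addNames (h l (by simp)), litNode_addNames (h l' (by simp))]

theorem namesOf_append (L : List (List Literal)) (C : List Literal) :
    namesOf (L ++ [C]) = addNames (namesOf L) C := by
  simp [namesOf, List.foldl_append]

theorem mem_namesOf {L : List (List Literal)} {y : ℕ} :
    y ∈ namesOf L ↔ ∃ C ∈ L, ∃ l ∈ C, l.1 = y := by
  induction L using List.reverseRecOn with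
  | nil => simp [namesOf]
  | append_singleton L C ih => simp [namesOf_append, mem_addNames, ih, or_and_right, exists_or]

theorem nodup_namesOf (L : List (List Literal)) : (namesOf L).Nodup := by
  induction L using List.reverseRecOn with
  | nil => simp [namesOf]
  | append_singleton L C ih => rw [namesOf_append]; exact nodup_addNames ih C

theorem length_namesOf (L : List (List Literal)) :
    (namesOf L).length ≤ (L.map List.length).sum := by
  induction L using List.reverseRecOn with
  | nil => simp [namesOf]
  | append_singleton L C ih =>
    have := length_addNames (namesOf L) C
    rw [namesOf_append, List.map_append, List.sum_append]
    simp only [List.map_cons, List.map_nil, List.sum_cons, List.sum_nil]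
    omega

theorem pairsOf_append (L : List (List Literal)) (C : List Literal) (c : ℕ) :
    pairsOf (namesOf (L ++ [C])) c (L ++ [C]) = pairsOf (namesOf L) c L ++
      (pairs (addNames (namesOf L) C) C).flatMap (List.replicate c) := by
  rw [namesOf_append, pairsOf, pairsOf, List.flatMap_append]
  congr 1
  · refine List.flatMap_congr fun C' hC' => ?_
    rw [pairs_addNames fun l hl => mem_namesOf.2 ⟨C', hC', l, hl, rfl⟩]
  · simp

theorem pairs_mem {names : List ℕ} {C : List Literal} (h : ∀ l ∈ C, l.1 ∈ names) :
    ClausesIn (4 * names.length + 2) (pairs names C) := by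
  intro p hp
  match C with
  | [] =>
    simp only [pairs, List.mem_cons, List.not_mem_nil, or_false] at hp
    rcases hp with rfl | rfl <;> simp
  | [l] =>
    simp only [pairs, List.mem_singleton] at hp
    subst hp
    exact ⟨litNode_mem (h l (by simp)), litNode_mem (h l (by simp))⟩
  | l :: l' :: _ =>
    simp only [pairs, List.mem_singleton] at hp
    subst hp
    exact ⟨litNode_mem (h l (by simp)), litNode_mem (h l' (by simp))⟩

theorem Parsed.copies {names : List ℕ} {cl : List (ℕ × ℕ)} {rest : List ℕ} {s : State}
    (h : Parsed names cl rest s)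
    {a b c m : ℕ} (ha : s.reg 26 = a) (hb : s.reg 27 = b)
    (ha' : a ∈ Finset.Icc 1 (4 * names.length + 2))
    (hb' : b ∈ Finset.Icc 1 (4 * names.length + 2)) (hc : c = 30 ∨ c = 31) (hm : s.reg c = m) :
    WP (copiesProg c) s fun s' t => t ≤ 40 * (m + 1) ∧
      Parsed names (cl ++ List.replicate m (a, b)) rest s' := by
  refine (wp_copiesProg h.build ha hb ha' hb' hc hm).imp ?_
  rintro s' t f ⟨ht, hb⟩
  exact ⟨ht, hb, h.var.congr (f.sameOn rfl), h.read.congr (f.sameOn rfl)⟩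

/-- Reads a clause and enters its node clauses with the multiplicity in register `30`. -/
def clauseProg : Prog :=
  readProg 18 ;;
  .ite (.eq 18 1)
    ((.const 26 1 ;; .const 27 1) ;; copiesProg 30 ;; (.const 26 2 ;; .const 27 2) ;;
      copiesProg 30)
    (readLitProg 26 ;; .ite (.eq 18 2) (.copy 27 26) (readLitProg 27) ;; copiesProg 30)

theorem wp_clauseProg {names : List ℕ} {cl : List (ℕ × ℕ)} {C : List Literal} {rest : List ℕ}
    {s : State} (h : Parsed names cl (encodeClause C ++ rest) s) (hC : C.length ≤ 2) {c : ℕ}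
    (hc : s.reg 30 = c) :
    WP clauseProg s fun s' t => t ≤ 150 * (c + 1) ∧ Parsed (addNames names C)
      (cl ++ (pairs (addNames names C) C).flatMap (List.replicate c)) rest s' := by
  refine (wp_readProg h (by decide) (by decide)).seq ?_
  rintro s₁ _ f₁ ⟨rfl, h18, h₁⟩
  have hc₁ : s₁.reg 30 = c := (f₁.reg 30 rfl).trans hc
  rw [wp_ite, holds_eq, h18, h₁.build.zero, List.length_eq_zero_iff]
  have hin := pairs_mem (names := addNames names C) (C := C)
    fun l hl => mem_addNames.2 (Or.inr ⟨l, hl, rfl⟩)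
  refine ⟨?_, fun hne => ?_⟩
  · rintro rfl
    have hset : ∀ (s : State) (j : ℕ) (cl' : List (ℕ × ℕ)), Parsed names cl' rest s →
        WP (.const 26 j ;; .const 27 j) s fun s' t => t = 2 ∧ s'.reg 26 = j ∧ s'.reg 27 = j ∧
          Parsed names cl' rest s' := by
      intro s j cl' h
      simp only [wp_seq, wp_const, true_and]
      exact ⟨by simp, by simp, h.congr (by simp [SameOn])⟩
    refine (hset s₁ 1 cl h₁).seq ?_
    rintro s₂ _ f₂ ⟨rfl, h26, h27, h₂⟩
    have hc₂ : s₂.reg 30 = c := (f₂.reg 30 rfl).trans hc₁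
    refine (h₂.copies h26 h27 (by simp) (by simp) (Or.inl rfl) hc₂).seq ?_
    rintro s₃ t₃ f₃ ⟨ht₃, h₃⟩
    have hc₃ : s₃.reg 30 = c := (f₃.reg 30 rfl).trans hc₂
    refine (hset s₃ 2 _ h₃).seq ?_
    rintro s₄ _ f₄ ⟨rfl, h26, h27, h₄⟩
    have hc₄ : s₄.reg 30 = c := (f₄.reg 30 rfl).trans hc₃
    refine (h₄.copies h26 h27 (by simp) (by simp) (Or.inl rfl) hc₄).imp ?_
    rintro s₅ t₅ - ⟨ht₅, h₅⟩
    refine ⟨by omega, ?_⟩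
    simpa [addNames, pairs] using h₅
  · obtain ⟨l, C, rfl⟩ := List.exists_cons_of_ne_nil hne
    have h₁' : Parsed names cl (l.1 :: l.2.toNat :: (C.flatMap (fun l => [l.1, l.2.toNat]) ++ rest))
      s₁ := by simpa using h₁
    refine (wp_readLitProg h₁' (Or.inl rfl)).seq ?_
    rintro s₂ t₂ f₂ ⟨ht₂, h26, h₂⟩
    have h18' : s₂.reg 18 = C.length + 1 := (f₂.reg 18 rfl).trans h18
    have hc₂ : s₂.reg 30 = c := (f₂.reg 30 rfl).trans hc₁
    rw [wp_seq, wp_ite, holds_eq, h18', h₂.build.one]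
    refine ⟨fun h0 => ?_, fun h0 => ?_⟩
    · obtain rfl : C = [] := List.length_eq_zero_iff.1 (by omega)
      rw [wp_copy]
      have h₃ : Parsed (addNames names [l]) cl rest (s₂.setReg 27 (s₂.reg 26)) :=
        h₂.congr (by simp [SameOn])
      obtain ⟨i1, i2⟩ := hin _ (List.mem_singleton_self _)
      have h26' : s₂.reg 26 = litNode (addNames names [l]) l := h26
      refine (h₃.copies (c := 30) (m := c) (by simpa using h26') (by simpa using h26') i1 i2
        (Or.inl rfl) (by simpa using hc₂)).imp ?_
      rintro s₄ t₄ - ⟨ht₄, h₄⟩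
      refine ⟨by omega, ?_⟩
      simpa [pairs] using h₄
    · obtain ⟨l', C, rfl⟩ := List.exists_cons_of_ne_nil (l := C) (by rintro rfl; simp at h0)
      obtain rfl : C = [] := List.length_eq_zero_iff.1 (by simpa using hC)
      have h₂' : Parsed (addName names l.1) cl (l'.1 :: l'.2.toNat :: rest) s₂ := by
        simpa using h₂
      refine (wp_readLitProg h₂' (Or.inr rfl)).imp ?_
      rintro s₃ t₃ f₃ ⟨ht₃, h27, h₃⟩
      have h26' : s₃.reg 26 = litNode (addNames names [l, l']) l := by
        rw [f₃.reg 26 rfl, h26]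
        exact (litNode_addName (mem_addName.2 (Or.inr rfl)) _).symm
      have h27' : s₃.reg 27 = litNode (addNames names [l, l']) l' := h27
      have hc₃ : s₃.reg 30 = c := (f₃.reg 30 rfl).trans hc₂
      obtain ⟨i1, i2⟩ := hin _ (List.mem_singleton_self _)
      refine (Parsed.copies (names := addNames names [l, l']) h₃ h26' h27' i1 i2 (Or.inl rfl)
        hc₃).imp ?_
      rintro s₄ t₄ - ⟨ht₄, h₄⟩
      refine ⟨by omega, ?_⟩
      simpa [pairs] using h₄

/-- Reads as many clauses as register `34` says. -/
def clausesProg : Prog := .const 33 0 ;; .loop (.lt 33 34) (clauseProg ;; .succ 33)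

theorem wp_clausesProg {L : List (List Literal)} {s : State}
    (h : Parsed [] [] (L.flatMap encodeClause) s) (hL : ∀ C ∈ L, C.length ≤ 2) {c : ℕ}
    (hc : s.reg 30 = c) (hM : s.reg 34 = L.length) :
    WP clausesProg s fun s' t => t ≤ 152 * (c + 1) * L.length + 2 ∧
      Parsed (namesOf L) (pairsOf (namesOf L) c L) [] s' := by
  simp only [clausesProg, wp_seq, wp_const]
  refine WP.loop (fun s' t => ∃ D R, L = D ++ R ∧ s'.reg 33 = D.length ∧
    t ≤ 152 * (c + 1) * D.length ∧
    Parsed (namesOf D) (pairsOf (namesOf D) c D) (R.flatMap encodeClause) s')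
    (152 * (c + 1) * L.length) ?_ ?_ ?_ ?_
  · exact ⟨[], L, rfl, by simp, by simp, h.congr (by simp [SameOn])⟩
  · rintro s' t - ⟨D, R, rfl, -, ht, -⟩
    refine ht.trans (Nat.mul_le_mul_left _ ?_)
    simp
  · rintro s' t f ⟨D, R, rfl, h33, ht, h'⟩ hlt
    have f34 : s'.reg 34 = (D ++ R).length := by simpa [hM] using f.reg 34 rfl
    have f30 : s'.reg 30 = c := by simpa [hc] using f.reg 30 rfl
    rw [holds_lt, h33, f34, List.length_append] at hlt
    obtain ⟨C, R, rfl⟩ := List.exists_cons_of_ne_nil (l := R) (by rintro rfl; simp at hlt)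
    rw [List.flatMap_cons] at h'
    refine (wp_clauseProg h' (hL C (by simp)) f30).seq ?_
    rintro s₁ t₁ f₁ ⟨ht₁, h₁⟩
    have := f₁.reg 33 rfl
    rw [wp_succ]
    refine ⟨D ++ [C], R, by simp, by simp [this, h33], ?_, ?_⟩
    · rw [List.length_append, List.length_singleton, mul_add]
      omega
    · rw [pairsOf_append, namesOf_append]
      exact h₁.congr (by simp [SameOn])
  · rintro s' t f ⟨D, R, rfl, h33, ht, h'⟩ hlt
    have f34 : s'.reg 34 = (D ++ R).length := by simpa [hM] using f.reg 34 rfl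
    rw [holds_lt, h33, f34, List.length_append] at hlt
    obtain rfl : R = [] := List.length_eq_zero_iff.1 (by omega)
    rw [List.append_nil] at *
    exact ⟨by omega, h'⟩

/-- Enters the clauses `links`, with the multiplicity in register `31`. -/
def linksProg : Prog :=
  .const 33 3 ;; .loop (.lt 33 4)
    ((.copy 26 33 ;; .succ 26 ;; .copy 27 26 ;; .succ 27) ;; copiesProg 31 ;;
      (.succ 33 ;; .succ 33 ;; .succ 33 ;; .succ 33))

theorem wp_linksProg {n : ℕ} {cl : List (ℕ × ℕ)} {s : State}
    (h : BuildRepr (4 * n + 2) (arcs cl) s) {c : ℕ} (hc : s.reg 31 = c) :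
    WP linksProg s fun s' t => t ≤ 50 * (c + 1) * n + 2 ∧
      BuildRepr (4 * n + 2) (arcs (cl ++ links c n)) s' := by
  simp only [linksProg]
  rw [wp_seq, wp_const]
  refine WP.loop (fun s' t => ∃ i, i ≤ n ∧ s'.reg 33 = 4 * i + 3 ∧ t ≤ 50 * (c + 1) * i ∧
    BuildRepr (4 * n + 2) (arcs (cl ++ links c i)) s') (50 * (c + 1) * n) ?_ ?_ ?_ ?_
  · exact ⟨0, by omega, by simp, by simp, by simpa [links] using h.congr (by simp [SameOn])⟩
  · rintro s' t - ⟨i, hi, -, ht, -⟩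
    exact ht.trans (Nat.mul_le_mul_left _ hi)
  · rintro s' t f ⟨i, hi, h33, ht, h'⟩ hlt
    have f31 : s'.reg 31 = c := by simpa [hc] using f.reg 31 rfl
    rw [holds_lt, h33, h'.L] at hlt
    have hset : WP (.copy 26 33 ;; .succ 26 ;; .copy 27 26 ;; .succ 27) s' fun s₁ t₁ => t₁ = 4 ∧
        s₁.reg 26 = 4 * i + 4 ∧ s₁.reg 27 = 4 * i + 5 := by
      simp [h33]
    refine hset.seq ?_
    rintro s₁ _ f₁ ⟨rfl, h26, h27⟩
    have f31' : s₁.reg 31 = c := (f₁.reg 31 rfl).trans f31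
    refine (wp_copiesProg (h'.congr (f₁.sameOn rfl)) h26 h27 (Finset.mem_Icc.2 (by omega))
      (Finset.mem_Icc.2 (by omega)) (Or.inr rfl) f31').seq ?_
    rintro s₂ t₂ f₂ ⟨ht₂, h₂⟩
    have f33 : s₂.reg 33 = 4 * i + 3 := (f₂.reg 33 rfl).trans ((f₁.reg 33 rfl).trans h33)
    simp only [wp_seq, wp_succ]
    refine ⟨i + 1, by omega, by simp [f33]; ring, ?_, ?_⟩
    · rw [mul_add]
      omega
    · rw [links, List.range_succ, List.flatMap_append, ← List.append_assoc]
      refine BuildRepr.congr (s := s₂) ?_ (by simp [SameOn])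
      simpa [links] using h₂
  · rintro s' t f ⟨i, hi, h33, ht, h'⟩ hlt
    rw [holds_lt, h33, h'.L] at hlt
    obtain rfl : i = n := by omega
    exact ⟨by omega, h'⟩

/-- The constants, and the network with two nodes and without arcs. -/
def constProg : Prog :=
  (.const 2 1 ;; .const 3 2 ;; .const 4 1 ;; .const 5 1) ;; pairNodesProg

/-- Reads `k` into register `35` and the number of clauses into register `34`, sets register `6` to
`2 * k + 1`, register `a` to `1` and register `b` to `k + 1`. -/
def headProg (a b : ℕ) : Prog :=
  .load 35 0 1 ;; .load 34 0 2 ;; .copy 32 3 ;; .const a 1 ;; .copy b 35 ;; .succ b ;;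
  .const 6 1 ;; .const 33 0 ;; .loop (.lt 33 35) (.succ 6 ;; .succ 6 ;; .succ 33)

/-- Reads the input and builds the network. The clauses get the multiplicity in register `30` and
the links the one in register `31`. -/
def buildProg (a b : ℕ) : Prog := constProg ;; headProg a b ;; clausesProg ;; linksProg

/-- The node clauses of an instance. -/
def instClauses (cC cL : ℕ) (L : List (List Literal)) : List (ℕ × ℕ) :=
  pairsOf (namesOf L) cC L ++ links cL (namesOf L).length

theorem wp_constProg (inp : List ℕ) :
    WP constProg (initState inp) fun s' t => t = 9 ∧ BuildRepr 2 (arcs []) s' := by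
  have h : WP (.const 2 1 ;; .const 3 2 ;; .const 4 1 ;; .const 5 1) (initState inp) fun s' t =>
      t = 4 ∧ BuildRepr 0 (arcs []) s' := by
    simp only [wp_seq, wp_const, true_and]
    refine ⟨by simp [initState], by simp, by simp, by simp, by simp [arcs], by simp,
      by simp [arcs], by simp [arcs], by simp [arcs], fun v => ?_⟩
    simp [initState, arcs, edgeAdj, IsChain]
  refine h.seq ?_
  rintro s₁ _ - ⟨rfl, h₁⟩
  refine (wp_pairNodesProg h₁ (by omega)).imp ?_
  rintro s₂ _ - ⟨rfl, h₂⟩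
  exact ⟨rfl, h₂⟩

theorem wp_headProg {L : List (List Literal)} {k : ℕ} {s : State} (hb : BuildRepr 2 (arcs []) s)
    (h0 : s.arr 0 = (initState (encode L k)).arr 0) (h13 : s.arr 13 = fun _ => 0) {a b : ℕ}
    (hab : a = 30 ∧ b = 31 ∨ a = 31 ∧ b = 30) :
    WP (headProg a b) s fun s' t => t ≤ 4 * k + 9 ∧ s'.reg 6 = 2 * k + 1 ∧ s'.reg 34 = L.length ∧
      s'.reg a = 1 ∧ s'.reg b = k + 1 ∧ Parsed [] [] (L.flatMap encodeClause) s' := by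
  have e0 : s.arr 0 0 = k := by simp [h0, initState, encode]
  have e1 : s.arr 0 1 = L.length := by simp [h0, initState, encode]
  have hne : a ≠ b := by omega
  have h1 := hb.zero
  have h2 := hb.one
  have h3 := hb.two
  simp only [headProg, wp_seq, wp_load, wp_copy, wp_const, wp_succ]
  refine WP.loop (fun s' t => ∃ i, i ≤ k ∧ t ≤ 4 * i ∧ s'.reg 33 = i ∧ s'.reg 6 = 2 * i + 1)
    (4 * k) ?_ ?_ ?_ ?_
  · exact ⟨0, by simp⟩
  · rintro s' t - ⟨i, hi, ht, -⟩
    omega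
  · rintro s' t f ⟨i, hi, ht, i33, i6⟩ hlt
    have f35 := f.reg 35 rfl
    rw [holds_lt, i33, f35] at hlt
    have hlt : i < k := by rcases hab with ⟨rfl, rfl⟩ | ⟨rfl, rfl⟩ <;> simpa [h1, e0] using hlt
    simp only [wp_seq, wp_succ]
    exact ⟨i + 1, hlt, by omega, by simp [i33], by simp [i6]; ring⟩
  · rintro s' t f ⟨i, hi, ht, i33, i6⟩ hlt
    have f35 := f.reg 35 rfl
    rw [holds_lt, i33, f35] at hlt
    have hlt : k ≤ i := by rcases hab with ⟨rfl, rfl⟩ | ⟨rfl, rfl⟩ <;> simpa [h1, e0] using hlt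
    obtain rfl : i = k := by omega
    have f1 := f.reg 1 rfl
    have f2 := f.reg 2 rfl
    have f3 := f.reg 3 rfl
    have f4 := f.reg 4 rfl
    have f5 := f.reg 5 rfl
    have f30 := f.reg 30 rfl
    have f31 := f.reg 31 rfl
    have f32 := f.reg 32 rfl
    have f34 := f.reg 34 rfl
    have g : ∀ a, s'.arr a = s.arr a := fun a => f.arr a rfl
    have hb' : BuildRepr 2 (arcs []) s' := by
      refine hb.congr ⟨?_, fun x _ => g x⟩
      rcases hab with ⟨rfl, rfl⟩ | ⟨rfl, rfl⟩ <;> simp [f1, f2, f3, f4, f5]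
    have h32 : s'.reg 32 = 2 := by
      rcases hab with ⟨rfl, rfl⟩ | ⟨rfl, rfl⟩ <;> simp [f32, h3]
    refine ⟨by omega, i6, ?_, ?_, ?_, hb', ⟨List.nodup_nil, ?_, ?_⟩, ?_⟩
    · rcases hab with ⟨rfl, rfl⟩ | ⟨rfl, rfl⟩ <;> simp [f34, h2, e1]
    · rcases hab with ⟨rfl, rfl⟩ | ⟨rfl, rfl⟩ <;> simp [f30, f31]
    · rcases hab with ⟨rfl, rfl⟩ | ⟨rfl, rfl⟩ <;> simp [f30, f31, h1, e0]
    · simp [g, h13]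
    · simp
    · intro i
      simp [g, h0, h32, initState, encode, add_comm 2]

theorem wp_buildProg {L : List (List Literal)} (hL : ∀ C ∈ L, C.length ≤ 2) {k a b cC cL : ℕ}
    (hab : a = 30 ∧ b = 31 ∧ cC = 1 ∧ cL = k + 1 ∨ a = 31 ∧ b = 30 ∧ cC = k + 1 ∧ cL = 1) :
    WP (buildProg a b) (initState (encode L k)) fun s' t =>
      t ≤ 310 * (k + 2) * (L.length + (namesOf L).length + 1) ∧ s'.reg 6 = 2 * k + 1 ∧
      BuildRepr (4 * (namesOf L).length + 2) (arcs (instClauses cC cL L)) s' ∧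
      VarRepr (namesOf L) s' := by
  refine (wp_constProg _).seq ?_
  rintro s₁ _ f₁ ⟨rfl, h₁⟩
  refine (wp_headProg h₁ (f₁.arr 0 rfl) ((f₁.arr 13 rfl).trans (by simp [initState])) (a := a)
    (b := b) (by omega)).seq ?_
  rintro s₂ t₂ - ⟨ht₂, h6, h34, ha, hb, h₂⟩
  have h30 : s₂.reg 30 = cC := by
    rcases hab with ⟨rfl, rfl, rfl, rfl⟩ | ⟨rfl, rfl, rfl, rfl⟩ <;> assumption
  have h31 : s₂.reg 31 = cL := by
    rcases hab with ⟨rfl, rfl, rfl, rfl⟩ | ⟨rfl, rfl, rfl, rfl⟩ <;> assumption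
  refine (wp_clausesProg h₂ hL h30 h34).seq ?_
  rintro s₃ t₃ f₃ ⟨ht₃, h₃⟩
  refine (wp_linksProg h₃.build ((f₃.reg 31 rfl).trans h31)).imp ?_
  rintro s₄ t₄ f₄ ⟨ht₄, h₄⟩
  refine ⟨?_, (f₄.reg 6 rfl).trans ((f₃.reg 6 rfl).trans h6), h₄, h₃.var.congr (f₄.sameOn rfl)⟩
  have hc : cC ≤ k + 1 ∧ cL ≤ k + 1 := by omega
  have e1 : 152 * (cC + 1) * L.length ≤ 152 * (k + 2) * L.length :=
    Nat.mul_le_mul_right _ (by omega)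
  have e2 : 50 * (cL + 1) * (namesOf L).length ≤ 50 * (k + 2) * (namesOf L).length :=
    Nat.mul_le_mul_right _ (by omega)
  generalize L.length = x at *
  generalize (namesOf L).length = y at *
  nlinarith [Nat.zero_le ((k + 2) * x), Nat.zero_le ((k + 2) * y)]

theorem clausesIn_instClauses (cC cL : ℕ) (L : List (List Literal)) :
    ClausesIn (4 * (namesOf L).length + 2) (instClauses cC cL L) := by
  intro p hp
  simp only [instClauses, pairsOf, links, List.mem_append, List.mem_flatMap, List.mem_replicate,
    List.mem_range] at hp
  rcases hp with ⟨C, hC, q, hq, -, rfl⟩ | ⟨i, hi, -, rfl⟩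
  · exact pairs_mem (fun l hl => mem_namesOf.2 ⟨C, hC, l, hl, rfl⟩) p hq
  · simp only [Finset.mem_Icc]
    omega

theorem length_instClauses (cC cL : ℕ) (L : List (List Literal)) :
    (instClauses cC cL L).length ≤ 2 * cC * L.length + cL * (namesOf L).length := by
  rw [instClauses, List.length_append]
  refine Nat.add_le_add ?_ ?_
  · have key : ∀ names C, ((pairs names C).flatMap (List.replicate cC)).length ≤ 2 * cC := by
      intro names C
      match C with
      | [] => simp [pairs, two_mul]
      | [l] => simp [pairs, two_mul]
      | l :: l' :: _ => simp [pairs, two_mul]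
    generalize namesOf L = names
    induction L with
    | nil => simp [pairsOf]
    | cons C L ih =>
      have := key names C
      rw [pairsOf, List.flatMap_cons, List.length_append, List.length_cons, mul_add, ← pairsOf]
      omega
  · simp [links, mul_comm]

/-! ### Sets of nodes and solutions -/

theorem cost_append (Y : Set ℕ) (cl cl' : List (ℕ × ℕ)) :
    cost Y (cl ++ cl') = cost Y cl + cost Y cl' := by
  simp [cost]

theorem cost_replicate (Y : Set ℕ) (c : ℕ) (p : ℕ × ℕ) :
    cost Y (List.replicate c p) = c * cost Y [p] := by
  simp [cost]

theorem cost_flatMap {α : Type*} (Y : Set ℕ) (l : List α) (f : α → List (ℕ × ℕ)) :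
    cost Y (l.flatMap f) = (l.map fun a => cost Y (f a)).sum := by
  induction l with
  | nil => rfl
  | cons a l ih => rw [List.flatMap_cons, cost_append, ih, List.map_cons, List.sum_cons]

theorem cost_flatMap_replicate (Y : Set ℕ) (c : ℕ) (cl : List (ℕ × ℕ)) :
    cost Y (cl.flatMap (List.replicate c)) = c * cost Y cl := by
  induction cl with
  | nil => rfl
  | cons p cl ih =>
    rw [List.flatMap_cons, cost_append, ih, cost_replicate, ← mul_add, ← cost_append,
      List.singleton_append]

/-- A complete set of nodes contains exactly one of any two opposite literals. -/
def CompleteSet (n : ℕ) (Y : Set ℕ) : Prop := ∀ v ∈ Finset.Icc 1 (4 * n + 2), v ∈ Y ↔ neg v ∉ Y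

theorem CompleteSet.odd {n : ℕ} {Y : Set ℕ} (hY : CompleteSet n Y) {v : ℕ} (hv : v < 4 * n + 2)
    (h : v % 2 = 1) : v ∈ Y ↔ v + 1 ∉ Y := by
  have := hY v (Finset.mem_Icc.2 (by omega))
  rwa [neg, if_pos h] at this

open Classical in
theorem cost_pairs {names : List ℕ} {Y : Set ℕ} (hY : CompleteSet names.length Y)
    {C : List Literal} (hC : C.length ≤ 2) :
    cost Y (pairs names C) = if ∃ l ∈ C, litNode names l ∈ Y then 0 else 1 := by
  match C with
  | [] =>
    have := hY.odd (v := 1) (by omega) rfl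
    by_cases h : 1 ∈ Y
    · simp [cost, pairs, h, this.1 h]
    · have h2 : 2 ∈ Y := by
        by_contra h2
        exact h (this.2 h2)
      simp [cost, pairs, h, h2]
  | [l] => by_cases h : litNode names l ∈ Y <;> simp [cost, pairs, h]
  | [l, l'] =>
    by_cases h : litNode names l ∈ Y <;> by_cases h' : litNode names l' ∈ Y <;>
      simp [cost, pairs, h, h']

/-- The variable with number `i` is broken: its first and second node have different values, and
the link between them is violated. -/
def Broken (Y : Set ℕ) (i : ℕ) : Prop := 4 * i + 3 ∈ Y ∧ 4 * i + 6 ∈ Y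

open Classical in
/-- The cost of an instance: the unsatisfied clauses and the broken variables. -/
theorem cost_instClauses {L : List (List Literal)} {Y : Set ℕ}
    (hY : CompleteSet (namesOf L).length Y) (hL : ∀ C ∈ L, C.length ≤ 2) (cC cL : ℕ) :
    cost Y (instClauses cC cL L) =
      cC * (L.map fun C => if ∃ l ∈ C, litNode (namesOf L) l ∈ Y then 0 else 1).sum +
      cL * ((List.range (namesOf L).length).map fun i => if Broken Y i then 1 else 0).sum := by
  rw [instClauses, cost_append, pairsOf, cost_flatMap, links, cost_flatMap]
  congr 1
  · rw [← List.sum_map_mul_left]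
    refine congrArg List.sum (List.map_congr_left fun C hC => ?_)
    rw [cost_flatMap_replicate, cost_pairs hY (hL C hC)]
  · rw [← List.sum_map_mul_left]
    refine congrArg List.sum (List.map_congr_left fun i hi => ?_)
    rw [List.mem_range] at hi
    rw [cost_replicate]
    congr 1
    have h1 := hY.odd (v := 4 * i + 3) (by omega) (by omega)
    have h2 := hY.odd (v := 4 * i + 5) (by omega) (by omega)
    simp [cost, Broken, h1, h2]

theorem map_idxOf {names : List ℕ} (h : names.Nodup) {β : Type*} (f : ℕ → β) :
    names.map (fun x => f (names.idxOf x)) = (List.range names.length).map f := by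
  refine List.ext_getElem (by simp) fun i h1 h2 => ?_
  simp [h.idxOf_getElem]

theorem sum_ite_eq_length {α : Type*} (p : α → Prop) [DecidablePred p] (l : List α) :
    (l.map fun a => if p a then 1 else 0).sum = (l.filter fun a => p a).length := by
  induction l with
  | nil => rfl
  | cons a l ih =>
    by_cases h : p a <;> simp [h, ih, add_comm]

open Classical in
/-- The variables whose first node and the node `d` steps further are in `Y`: the true variables for
`d = 0`, and the broken ones for `d = 3`. -/
noncomputable def chosen (names : List ℕ) (Y : Set ℕ) (d : ℕ) : List ℕ :=
  names.filter fun x => 4 * names.idxOf x + 3 ∈ Y ∧ 4 * names.idxOf x + 3 + d ∈ Y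

theorem mem_chosen {names : List ℕ} {Y : Set ℕ} {d x : ℕ} :
    x ∈ chosen names Y d ↔
      x ∈ names ∧ 4 * names.idxOf x + 3 ∈ Y ∧ 4 * names.idxOf x + 3 + d ∈ Y := by
  simp [chosen]

/-- Literals over variables that are not broken have the same value in the node set and in the
assignment. -/
theorem assignmentOf_chosen {names : List ℕ} {Y : Set ℕ} {l : Literal} (hl : l.1 ∈ names)
    (hb : ¬ Broken Y (names.idxOf l.1)) (h : litNode names l ∈ Y) :
    assignmentOf (chosen names Y 0) l.1 = l.2 := by
  obtain ⟨x, b⟩ := l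
  simp only [assignmentOf, litNode, Broken] at *
  cases b with
  | true =>
    rw [decide_eq_true_eq, mem_chosen]
    exact ⟨hl, h, h⟩
  | false =>
    rw [decide_eq_false_iff_not, mem_chosen]
    rintro ⟨-, h', -⟩
    exact hb ⟨h', h⟩

section

variable {F : CNF} {L : List (List Literal)}

theorem IsListing.length_le (hL : IsListing L F) (hF : Is2CNF F) : ∀ C ∈ L, C.length ≤ 2 := by
  intro C hC
  rw [← List.toFinset_card_of_nodup (hL.1 C hC)]
  refine hF _ ?_
  rw [← hL.2.2]
  simpa using ⟨C, hC, rfl⟩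

theorem IsListing.mem (hL : IsListing L F) {C : Clause} : C ∈ F ↔ ∃ C' ∈ L, C'.toFinset = C := by
  rw [← hL.2.2]
  simp

theorem IsListing.sum (hL : IsListing L F) (f : Clause → ℕ) :
    ∑ C ∈ F, f C = (L.map fun C => f C.toFinset).sum := by
  rw [← hL.2.2, List.sum_toFinset _ hL.2.1, List.map_map]
  rfl

theorem IsListing.sum_length (hL : IsListing L F) : (L.map List.length).sum = len F := by
  rw [len, hL.sum]
  exact congrArg List.sum (List.map_congr_left fun C hC =>
    (List.toFinset_card_of_nodup (hL.1 C hC)).symm)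

theorem IsListing.length_le_len (hL : IsListing L F) : L.length ≤ len F + 1 := by
  have h1 : L.length = F.card := by
    rw [← hL.2.2, List.toFinset_card_of_nodup hL.2.1, List.length_map]
  have h2 : (F.erase ∅).card ≤ len F := by
    rw [Finset.card_eq_sum_ones]
    calc _ ≤ ∑ C ∈ F.erase ∅, C.card := Finset.sum_le_sum fun C hC =>
          Finset.card_pos.2 (Finset.nonempty_iff_ne_empty.2 (Finset.ne_of_mem_erase hC))
      _ ≤ _ := Finset.sum_le_sum_of_subset (Finset.erase_subset _ _)
  have := Finset.pred_card_le_card_erase (s := F) (a := ∅)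
  omega

theorem mem_vars_iff (hL : IsListing L F) {x : ℕ} : x ∈ vars F ↔ x ∈ namesOf L := by
  rw [mem_namesOf, vars, Finset.mem_biUnion]
  simp only [hL.mem, Finset.mem_image]
  constructor
  · rintro ⟨_, ⟨C, hC, rfl⟩, l, hl, h⟩
    exact ⟨C, hC, l, List.mem_toFinset.1 hl, h⟩
  · rintro ⟨C, hC, l, hl, h⟩
    exact ⟨_, ⟨C, hC, rfl⟩, l, List.mem_toFinset.2 hl, h⟩

open Classical in
theorem card_violated (hL : IsListing L F) (τ : ℕ → Bool) : (violated τ F).card =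
    (L.map fun C => if SatClause τ C.toFinset then 0 else 1).sum := by
  rw [violated, Finset.card_filter, hL.sum]
  refine congrArg List.sum (List.map_congr_left fun C _ => ?_)
  by_cases h : SatClause τ C.toFinset <;> simp [h]

/-- Breaking a variable is too expensive, so the clauses that are violated are among the violated
clauses of the network. -/
theorem clauseSolution_of_cost (hF : Is2CNF F) (hL : IsListing L F) {k : ℕ} {Y : Set ℕ}
    (hY : CompleteSet (namesOf L).length Y) (hc : cost Y (instClauses 1 (k + 1) L) ≤ k) :
    ClauseSolution F k (assignmentOf (chosen (namesOf L) Y 0)) := by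
  classical
  rw [cost_instClauses hY (hL.length_le hF), one_mul] at hc
  have h0 : ((List.range (namesOf L).length).map fun i => if Broken Y i then 1 else 0).sum = 0 := by
    by_contra h0
    have := Nat.mul_le_mul_left (k + 1) (Nat.pos_of_ne_zero h0)
    omega
  rw [List.sum_eq_zero_iff] at h0
  rw [ClauseSolution, card_violated hL]
  refine le_trans (List.sum_le_sum fun C hC => ?_) ((Nat.le_add_right _ _).trans hc)
  by_cases h : ∃ l ∈ C, litNode (namesOf L) l ∈ Y
  · obtain ⟨l, hl, h⟩ := h
    have hn : l.1 ∈ namesOf L := mem_namesOf.2 ⟨C, hC, l, hl, rfl⟩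
    have hb : ¬ Broken Y ((namesOf L).idxOf l.1) := by
      intro hb
      have := h0 1 (List.mem_map.2 ⟨(namesOf L).idxOf l.1,
        List.mem_range.2 (List.idxOf_lt_length_of_mem hn), by simp [hb]⟩)
      omega
    rw [if_pos ⟨l, List.mem_toFinset.2 hl, assignmentOf_chosen hn hb h⟩]
    exact Nat.zero_le _
  · rw [if_neg h]
    split_ifs <;> omega

/-- Violating a clause is too expensive, so the broken variables form the set `S` of a solution. -/
theorem varSolution_of_cost (hF : Is2CNF F) (hL : IsListing L F) {k : ℕ} {Y : Set ℕ}
    (hY : CompleteSet (namesOf L).length Y) (hc : cost Y (instClauses (k + 1) 1 L) ≤ k) :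
    VarSolution F k (chosen (namesOf L) Y 3).toFinset (assignmentOf (chosen (namesOf L) Y 0)) := by
  classical
  rw [cost_instClauses hY (hL.length_le hF), one_mul] at hc
  have h0 : (L.map fun C => if ∃ l ∈ C, litNode (namesOf L) l ∈ Y then 0 else 1).sum = 0 := by
    by_contra h0
    have := Nat.mul_le_mul_left (k + 1) (Nat.pos_of_ne_zero h0)
    omega
  rw [List.sum_eq_zero_iff] at h0
  refine ⟨fun x hx => ?_, ?_, ?_⟩
  · rw [List.mem_toFinset, mem_chosen] at hx
    exact (mem_vars_iff hL).2 hx.1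
  · refine (List.toFinset_card_le _).trans (le_trans (le_of_eq ?_) ((Nat.le_add_left _ _).trans hc))
    rw [← map_idxOf (nodup_namesOf L) fun i => if Broken Y i then 1 else 0, sum_ite_eq_length]
    exact congrArg List.length (List.filter_congr fun x _ =>
      decide_eq_decide.2 Iff.rfl)
  · intro C hC
    rw [deleteVars, Finset.mem_filter, hL.mem] at hC
    obtain ⟨⟨C, hC, rfl⟩, hS⟩ := hC
    have h : ∃ l ∈ C, litNode (namesOf L) l ∈ Y := by
      by_contra h
      have := h0 1 (List.mem_map.2 ⟨C, hC, by simp [h]⟩)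
      omega
    obtain ⟨l, hl, h⟩ := h
    have hn : l.1 ∈ namesOf L := mem_namesOf.2 ⟨C, hC, l, hl, rfl⟩
    refine ⟨l, List.mem_toFinset.2 hl, assignmentOf_chosen hn (fun hb => ?_) h⟩
    refine hS l (List.mem_toFinset.2 hl) ?_
    rw [List.mem_toFinset, mem_chosen]
    exact ⟨hn, hb⟩

/-- The complete set of nodes in which the first and the second node of the variable `x` have the
values `f x` and `g x`. -/
def nodeSet (names : List ℕ) (f g : ℕ → Bool) : Set ℕ :=
  {v | v = 1 ∨ ∃ i, (v = 4 * i + 3 ∧ f (names.getD i 0) = true) ∨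
    (v = 4 * i + 4 ∧ f (names.getD i 0) = false) ∨ (v = 4 * i + 5 ∧ g (names.getD i 0) = true) ∨
    (v = 4 * i + 6 ∧ g (names.getD i 0) = false)}

theorem mem_nodeSet (names : List ℕ) (f g : ℕ → Bool) (i : ℕ) :
    (4 * i + 3 ∈ nodeSet names f g ↔ f (names.getD i 0) = true) ∧
    (4 * i + 4 ∈ nodeSet names f g ↔ f (names.getD i 0) = false) ∧
    (4 * i + 5 ∈ nodeSet names f g ↔ g (names.getD i 0) = true) ∧
    (4 * i + 6 ∈ nodeSet names f g ↔ g (names.getD i 0) = false) := by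
  refine ⟨⟨?_, fun h => Or.inr ⟨i, Or.inl ⟨rfl, h⟩⟩⟩,
    ⟨?_, fun h => Or.inr ⟨i, Or.inr (Or.inl ⟨rfl, h⟩)⟩⟩,
    ⟨?_, fun h => Or.inr ⟨i, Or.inr (Or.inr (Or.inl ⟨rfl, h⟩))⟩⟩,
    ⟨?_, fun h => Or.inr ⟨i, Or.inr (Or.inr (Or.inr ⟨rfl, h⟩))⟩⟩⟩ <;>
  · rintro (h | ⟨j, ⟨h, h'⟩ | ⟨h, h'⟩ | ⟨h, h'⟩ | ⟨h, h'⟩⟩)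
    all_goals first | omega | (obtain rfl : i = j := by omega); exact h'

theorem completeSet_nodeSet (names : List ℕ) (f g : ℕ → Bool) (n : ℕ) :
    CompleteSet n (nodeSet names f g) := by
  intro v hv
  rw [Finset.mem_Icc] at hv
  have h1 : 1 ∈ nodeSet names f g := Or.inl rfl
  have h2 : 2 ∉ nodeSet names f g := by
    rintro (h | ⟨i, h | h | h | h⟩) <;> omega
  by_cases hv2 : v ≤ 2
  · obtain rfl | rfl : v = 1 ∨ v = 2 := by omega
    all_goals simp [neg, h1, h2]
  · obtain ⟨i, hi⟩ : ∃ i, v = 4 * i + 3 ∨ v = 4 * i + 4 ∨ v = 4 * i + 5 ∨ v = 4 * i + 6 :=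
      ⟨(v - 3) / 4, by omega⟩
    obtain ⟨e3, e4, e5, e6⟩ := mem_nodeSet names f g i
    rcases hi with rfl | rfl | rfl | rfl
    · rw [show neg (4 * i + 3) = 4 * i + 4 by unfold neg; split_ifs <;> omega, e3, e4]
      simp
    · rw [show neg (4 * i + 4) = 4 * i + 3 by unfold neg; split_ifs <;> omega, e3, e4]
      simp
    · rw [show neg (4 * i + 5) = 4 * i + 6 by unfold neg; split_ifs <;> omega, e5, e6]
      simp
    · rw [show neg (4 * i + 6) = 4 * i + 5 by unfold neg; split_ifs <;> omega, e5, e6]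
      simp

theorem litNode_mem_nodeSet {names : List ℕ} (f g : ℕ → Bool) {l : Literal} (hl : l.1 ∈ names) :
    litNode names l ∈ nodeSet names f g ↔ (if l.2 then f l.1 = true else g l.1 = false) := by
  obtain ⟨x, b⟩ := l
  obtain ⟨e3, -, -, e6⟩ := mem_nodeSet names f g (names.idxOf x)
  have hx : names.getD (names.idxOf x) 0 = x := by
    rw [List.getD_eq_getElem _ _ (List.idxOf_lt_length_of_mem hl), List.getElem_idxOf]
  rw [hx] at e3 e6
  cases b with
  | true => simpa [litNode] using e3
  | false => simpa [litNode] using e6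

theorem exists_cost_of_clauseSolution (hF : Is2CNF F) (hL : IsListing L F) {k : ℕ} {τ : ℕ → Bool}
    (h : ClauseSolution F k τ) : ∃ Y, CompleteSet (namesOf L).length Y ∧
      cost Y (instClauses 1 (k + 1) L) ≤ k := by
  classical
  have hY := completeSet_nodeSet (namesOf L) τ τ (namesOf L).length
  refine ⟨_, hY, ?_⟩
  rw [cost_instClauses hY (hL.length_le hF), one_mul]
  have h0 : ((List.range (namesOf L).length).map fun i =>
      if Broken (nodeSet (namesOf L) τ τ) i then 1 else 0).sum = 0 := by
    rw [List.sum_eq_zero_iff]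
    intro y hy
    obtain ⟨i, -, rfl⟩ := List.mem_map.1 hy
    obtain ⟨e3, -, -, e6⟩ := mem_nodeSet (namesOf L) τ τ i
    rw [if_neg]
    rintro ⟨h3, h6⟩
    rw [e3] at h3
    rw [e6, h3] at h6
    exact absurd h6 (by simp)
  rw [h0, mul_zero, add_zero]
  rw [ClauseSolution, card_violated hL] at h
  refine le_trans (List.sum_le_sum fun C hC => ?_) h
  by_cases hs : SatClause τ C.toFinset
  · obtain ⟨l, hl, hs⟩ := hs
    rw [List.mem_toFinset] at hl
    rw [if_pos]
    · exact Nat.zero_le _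
    · refine ⟨l, hl, ?_⟩
      rw [litNode_mem_nodeSet _ _ (mem_namesOf.2 ⟨C, hC, l, hl, rfl⟩), hs]
      cases l.2 <;> simp
  · rw [if_neg hs]
    split_ifs <;> omega

theorem exists_cost_of_varSolution (hF : Is2CNF F) (hL : IsListing L F) {k : ℕ} {S : Finset ℕ}
    {τ : ℕ → Bool} (h : VarSolution F k S τ) : ∃ Y, CompleteSet (namesOf L).length Y ∧
      cost Y (instClauses (k + 1) 1 L) ≤ k := by
  classical
  obtain ⟨-, hk, hs⟩ := h
  -- The first node of a variable in `S` is true and the second one false, so that the variable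
  -- satisfies all clauses in which it occurs.
  set f : ℕ → Bool := fun x => τ x || decide (x ∈ S) with hf
  set g : ℕ → Bool := fun x => τ x && decide (x ∉ S) with hg
  have hY := completeSet_nodeSet (namesOf L) f g (namesOf L).length
  refine ⟨_, hY, ?_⟩
  rw [cost_instClauses hY (hL.length_le hF), one_mul]
  have h0 : (L.map fun C => if ∃ l ∈ C, litNode (namesOf L) l ∈ nodeSet (namesOf L) f g
      then 0 else 1).sum = 0 := by
    rw [List.sum_eq_zero_iff]
    intro y hy
    obtain ⟨C, hC, rfl⟩ := List.mem_map.1 hy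
    have key : ∃ l ∈ C, litNode (namesOf L) l ∈ nodeSet (namesOf L) f g := by
      by_cases hS : ∀ l ∈ C.toFinset, l.1 ∉ S
      · obtain ⟨l, hl, h⟩ := hs C.toFinset (Finset.mem_filter.2 ⟨hL.mem.2 ⟨C, hC, rfl⟩, hS⟩)
        rw [List.mem_toFinset] at hl
        refine ⟨l, hl, ?_⟩
        rw [litNode_mem_nodeSet _ _ (mem_namesOf.2 ⟨C, hC, l, hl, rfl⟩)]
        cases hb : l.2 <;> simp [hf, hg, h, hb]
      · push Not at hS
        obtain ⟨l, hl, h⟩ := hS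
        rw [List.mem_toFinset] at hl
        refine ⟨l, hl, ?_⟩
        rw [litNode_mem_nodeSet _ _ (mem_namesOf.2 ⟨C, hC, l, hl, rfl⟩)]
        cases hb : l.2 <;> simp [hf, hg, h]
    rw [if_pos key]
  rw [h0, mul_zero, zero_add, ← map_idxOf (nodup_namesOf L), sum_ite_eq_length,
    ← List.toFinset_card_of_nodup ((nodup_namesOf L).filter _)]
  refine (Finset.card_le_card fun x hx => ?_).trans hk
  rw [List.mem_toFinset, List.mem_filter, decide_eq_true_eq] at hx
  obtain ⟨hx, h3, h6⟩ := hx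
  have e3 := litNode_mem_nodeSet f g (l := (x, true)) hx
  have e6 := litNode_mem_nodeSet f g (l := (x, false)) hx
  have h3' := e3.1 (by simpa [litNode] using h3)
  have h6' := e6.1 (by simpa [litNode] using h6)
  by_contra hxS
  simp [hf, hg, hxS] at h3' h6'
  simp [h3'] at h6'

end

/-! ### Writing the answer -/

/-- The list `l` has been written into array `1`, and register `36` is the next position. -/
structure OutRepr (l : List ℕ) (s : State) : Prop where
  len : s.reg 36 = l.length
  get : ∀ (i : ℕ) (hi : i < l.length), s.arr 1 i = l[i]

theorem OutRepr.congr {l : List ℕ} {s s' : State} (h : OutRepr l s) (hs : SameOn [36] [1] s s') :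
    OutRepr l s' := by
  obtain ⟨hr, ha⟩ := hs
  simp only [List.forall_mem_cons, List.not_mem_nil, false_imp_iff, implies_true, and_true] at hr ha
  exact ⟨hr ▸ h.len, ha ▸ h.get⟩

theorem OutRepr.push {l : List ℕ} {s : State} (h : OutRepr l s) {x y : ℕ} (hx : s.reg x = y) :
    WP (.store 1 36 x ;; .succ 36) s fun s' t => t = 2 ∧ OutRepr (l ++ [y]) s' := by
  simp only [wp_seq, wp_store, wp_succ, true_and]
  refine ⟨by simp [h.len], fun i hi => ?_⟩
  rw [List.length_append, List.length_singleton] at hi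
  rcases Nat.lt_succ_iff_lt_or_eq.1 hi with hi | rfl
  · simp [h.len, hi, hi.ne, h.get i hi]
  · simp [h.len, hx]

theorem OutRepr.output {l : List ℕ} {s : State} (h : OutRepr l s) :
    output (s.setReg 0 (s.reg 36)) = l := by
  refine List.ext_getElem (by simp [RAM.output, h.len]) fun i h1 h2 => ?_
  simp [RAM.output, h.get i h2]

/-- Writes the variables `chosen names Y d`, where `Y` is the support of array `9`. -/
def emitProg (d : ℕ) : Prog :=
  (.const 33 3 ;; .const 37 (3 + d)) ;; .loop (.lt 33 4)
    ((.load 14 9 33 ;; .load 16 9 37 ;; .load 15 14 33) ;;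
      .ite (.eq 14 1) .skip (.ite (.eq 16 1) .skip (.store 1 36 15 ;; .succ 36)) ;;
      (.succ 33 ;; .succ 33 ;; .succ 33 ;; .succ 33) ;;
      (.succ 37 ;; .succ 37 ;; .succ 37 ;; .succ 37))

theorem wp_emitProg {names : List ℕ} {l : List ℕ} {Y : Set ℕ} {s : State} (hv : VarRepr names s)
    (h1 : s.reg 1 = 0) (h4 : s.reg 4 = 4 * names.length + 3) (hY : Y = {u | s.arr 9 u ≠ 0})
    (hl : OutRepr l s) (d : ℕ) :
    WP (emitProg d) s fun s' t =>
      t ≤ 20 * names.length + 3 ∧ OutRepr (l ++ chosen names Y d) s' := by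
  classical
  simp only [emitProg]
  rw [wp_seq, wp_seq, wp_const, wp_const]
  set P : ℕ → Bool := fun x => decide (4 * names.idxOf x + 3 ∈ Y ∧ 4 * names.idxOf x + 3 + d ∈ Y)
    with hP
  refine WP.loop (fun s' t => ∃ i, i ≤ names.length ∧ t ≤ 20 * i ∧ s'.reg 33 = 4 * i + 3 ∧
    s'.reg 37 = 4 * i + 3 + d ∧ OutRepr (l ++ (names.take i).filter P) s') (20 * names.length)
    ?_ ?_ ?_ ?_
  · refine ⟨0, by omega, by omega, by simp, by simp, ?_⟩
    simpa using hl.congr (by simp [SameOn])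
  · rintro s' t - ⟨i, hi, ht, -⟩
    omega
  · rintro s' t f ⟨i, hi, ht, h33, h37, hl'⟩ hlt
    have f4 : s'.reg 4 = 4 * names.length + 3 := by simpa [h4] using f.reg 4 rfl
    have f1 : s'.reg 1 = 0 := by simpa [h1] using f.reg 1 rfl
    have f9 : s'.arr 9 = s.arr 9 := f.arr 9 rfl
    have f14 : s'.arr 14 = s.arr 14 := f.arr 14 rfl
    rw [holds_lt, h33, f4] at hlt
    have hi' : i < names.length := by omega
    have hload : WP (.load 14 9 33 ;; .load 16 9 37 ;; .load 15 14 33) s' fun s₁ t₁ => t₁ = 3 ∧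
        (s₁.reg 14 = 0 ↔ 4 * i + 3 ∉ Y) ∧ (s₁.reg 16 = 0 ↔ 4 * i + 3 + d ∉ Y) ∧
        s₁.reg 15 = names[i] := by
      simp [h33, h37, f9, f14, hv.name i hi', hY]
    refine hload.seq ?_
    rintro s₁ _ f₁ ⟨rfl, h14, h16, h15⟩
    have hPi : P names[i] = decide (4 * i + 3 ∈ Y ∧ 4 * i + 3 + d ∈ Y) := by
      simp [hP, hv.nodup.idxOf_getElem]
    have hl₁ := hl'.congr (f₁.sameOn rfl)
    have hmid : WP (.ite (.eq 14 1) .skip (.ite (.eq 16 1) .skip (.store 1 36 15 ;; .succ 36))) s₁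
        fun s₂ t₂ => t₂ ≤ 4 ∧ OutRepr (l ++ (names.take (i + 1)).filter P) s₂ := by
      rw [List.take_succ_eq_append_getElem hi', List.filter_append, ← List.append_assoc]
      rw [wp_ite, wp_skip, wp_ite, wp_skip, holds_eq, holds_eq, f₁.reg 1 rfl, f1, h14, h16]
      refine ⟨fun h => ⟨by omega, ?_⟩, fun h => ⟨fun h' => ⟨by omega, ?_⟩, fun h' => ?_⟩⟩
      · simpa [hPi, h] using hl₁
      · simpa [hPi, h'] using hl₁
      · refine (hl₁.push h15).imp ?_
        rintro s₂ _ - ⟨rfl, h₂⟩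
        refine ⟨by omega, ?_⟩
        rw [not_not] at h h'
        simpa [hPi, h, h'] using h₂
    refine hmid.seq ?_
    rintro s₂ t₂ f₂ ⟨ht₂, h₂⟩
    have g33 : s₂.reg 33 = 4 * i + 3 := (f₂.reg 33 rfl).trans ((f₁.reg 33 rfl).trans h33)
    have g37 : s₂.reg 37 = 4 * i + 3 + d := (f₂.reg 37 rfl).trans ((f₁.reg 37 rfl).trans h37)
    simp only [wp_seq, wp_succ]
    refine ⟨i + 1, hi', by omega, by simp [g33]; ring, by simp [g37]; ring, ?_⟩
    exact h₂.congr (by simp [SameOn])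
  · rintro s' t f ⟨i, hi, ht, h33, h37, hl'⟩ hlt
    have f4 : s'.reg 4 = 4 * names.length + 3 := by simpa [h4] using f.reg 4 rfl
    rw [holds_lt, h33, f4] at hlt
    obtain rfl : i = names.length := by omega
    rw [List.take_length] at hl'
    exact ⟨by omega, hl'⟩

/-- Writes the answer `0`. -/
def noProg : Prog := .store 1 1 1 ;; .const 0 1

/-- Writes the answer of the clause version that is read off the complete set in array `9`. -/
def clauseAnswerProg : Prog :=
  .const 36 0 ;; (.store 1 36 2 ;; .succ 36) ;; emitProg 0 ;; .copy 0 36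

/-- Writes the answer of the variable version that is read off the complete set in array `9`. Cell
`1` is reserved for the number of broken variables, which is known only after they are written. -/
def varAnswerProg : Prog :=
  .const 36 0 ;; (.store 1 36 2 ;; .succ 36) ;; (.store 1 36 1 ;; .succ 36) ;; emitProg 3 ;;
  (.copy 15 36 ;; .pred 15 ;; .pred 15 ;; .store 1 2 15) ;; emitProg 0 ;; .copy 0 36

theorem wp_noProg {s : State} (h1 : s.reg 1 = 0) :
    WP noProg s fun s' t => t = 2 ∧ output s' = [0] := by
  simp [noProg, output, h1]

section

variable {names : List ℕ} {Y : Set ℕ} {s : State}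

theorem wp_clauseAnswerProg (hv : VarRepr names s) (h1 : s.reg 1 = 0) (h2 : s.reg 2 = 1)
    (h4 : s.reg 4 = 4 * names.length + 3) (hY : Y = {u | s.arr 9 u ≠ 0}) :
    WP clauseAnswerProg s fun s' t => t ≤ 20 * names.length + 10 ∧
      output s' = 1 :: chosen names Y 0 := by
  rw [clauseAnswerProg, wp_seq, wp_const]
  have h₀ : OutRepr [] (s.setReg 36 0) := ⟨by simp, by simp⟩
  have hv₀ : VarRepr names (s.setReg 36 0) := hv.congr (by simp [SameOn])
  refine (h₀.push (x := 2) (y := 1) (by simp [h2])).seq ?_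
  rintro s₁ _ f₁ ⟨rfl, h₁⟩
  refine (wp_emitProg (hv₀.congr (f₁.sameOn rfl)) ((f₁.reg 1 rfl).trans h1)
    ((f₁.reg 4 rfl).trans h4) (Y := Y) ?_ h₁ 0).seq ?_
  · rw [f₁.arr 9 rfl]
    exact hY
  rintro s₂ t₂ - ⟨ht₂, h₂⟩
  rw [wp_copy, h₂.output]
  exact ⟨by omega, rfl⟩

theorem wp_varAnswerProg (hv : VarRepr names s) (h1 : s.reg 1 = 0) (h2 : s.reg 2 = 1)
    (h4 : s.reg 4 = 4 * names.length + 3) (hY : Y = {u | s.arr 9 u ≠ 0}) :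
    WP varAnswerProg s fun s' t => t ≤ 40 * names.length + 20 ∧
      output s' = 1 :: (chosen names Y 3).length :: (chosen names Y 3 ++ chosen names Y 0) := by
  rw [varAnswerProg, wp_seq, wp_const]
  have h₀ : OutRepr [] (s.setReg 36 0) := ⟨by simp, by simp⟩
  have hv₀ : VarRepr names (s.setReg 36 0) := hv.congr (by simp [SameOn])
  refine (h₀.push (x := 2) (y := 1) (by simp [h2])).seq ?_
  rintro s₁ _ f₁ ⟨rfl, h₁⟩
  have g1 : s₁.reg 1 = 0 := (f₁.reg 1 rfl).trans h1
  refine (h₁.push (x := 1) (y := 0) g1).seq ?_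
  rintro s₂ _ f₂ ⟨rfl, h₂⟩
  have g1 : s₂.reg 1 = 0 := (f₂.reg 1 rfl).trans g1
  have g2 : s₂.reg 2 = 1 := (f₂.reg 2 rfl).trans ((f₁.reg 2 rfl).trans h2)
  have g4 : s₂.reg 4 = 4 * names.length + 3 := (f₂.reg 4 rfl).trans ((f₁.reg 4 rfl).trans h4)
  have g9 : s₂.arr 9 = s.arr 9 := (f₂.arr 9 rfl).trans (f₁.arr 9 rfl)
  have gv : VarRepr names s₂ :=
    VarRepr.congr (s := s₁) (hv₀.congr (f₁.sameOn rfl)) (f₂.sameOn rfl)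
  refine (wp_emitProg gv g1 g4 (Y := Y) (by rw [g9, hY]) h₂ 3).seq ?_
  rintro s₃ t₃ f₃ ⟨ht₃, h₃⟩
  have k2 : s₃.reg 2 = 1 := (f₃.reg 2 rfl).trans g2
  have hcount : WP (.copy 15 36 ;; .pred 15 ;; .pred 15 ;; .store 1 2 15) s₃ fun s' t => t = 4 ∧
      OutRepr ([1, (chosen names Y 3).length] ++ chosen names Y 3) s' := by
    simp only [wp_seq, wp_copy, wp_pred, wp_store, true_and]
    have e := h₃.len
    refine ⟨by simp [e], fun i hi => ?_⟩
    have hg := h₃.get i (by simpa using hi)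
    rcases i with _ | _ | i
    · simpa [k2] using hg
    · simp [k2, e]
    · simpa [k2] using hg
  refine hcount.seq ?_
  rintro s₄ _ f₄ ⟨rfl, h₄⟩
  refine (wp_emitProg ((gv.congr (f₃.sameOn rfl)).congr (f₄.sameOn rfl))
    ((f₄.reg 1 rfl).trans ((f₃.reg 1 rfl).trans g1))
    ((f₄.reg 4 rfl).trans ((f₃.reg 4 rfl).trans g4)) (Y := Y) ?_ h₄ 0).seq ?_
  · rw [f₄.arr 9 rfl, f₃.arr 9 rfl, g9, hY]
  rintro s₅ t₅ - ⟨ht₅, h₅⟩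
  rw [wp_copy, h₅.output]
  exact ⟨by omega, rfl⟩

end

/-! ### The algorithms -/

/-- Reads the instance, solves it, and writes an answer with `ans`. -/
def mainProg (a b : ℕ) (ans : Prog) : Prog :=
  buildProg a b ;; solveProg ;; .ite (.eq 22 2) ans noProg

/-- The times for building the network, solving the cut problem and writing the answer add up to
`O(4 ^ k * K ^ 2 * ℓ)`, where `m` is the number of clauses, `n` the number of variables, and `c` the
number of node clauses. -/
theorem time_bound {k K ℓ m n c t₁ t₂ t₃ : ℕ} (hK : k ≤ K) (hK1 : 1 ≤ K) (hℓ : 1 ≤ ℓ)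
    (hm : m ≤ ℓ + 1) (hn : n ≤ ℓ) (hc : c ≤ 2 * (k + 1) * m + (k + 1) * n)
    (ht₁ : t₁ ≤ 310 * (k + 2) * (m + n + 1))
    (ht₂ : t₂ ≤ 600 * (2 ^ (2 * k + 1 + 1) * ((2 * k + 1 + 1) * (4 * n + 2 + 4 * c + 1))))
    (ht₃ : t₃ ≤ 40 * n + 21) :
    t₁ + (t₂ + t₃) ≤ 500000 * (4 ^ k * K ^ 4 * ℓ) := by
  have hc' : c ≤ 10 * (K * ℓ) := by
    calc c ≤ 2 * (k + 1) * m + (k + 1) * n := hc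
      _ ≤ 2 * (2 * K) * (2 * ℓ) + (2 * K) * ℓ := by gcongr <;> omega
      _ = _ := by ring
  have hKl : ℓ ≤ K * ℓ := Nat.le_mul_of_pos_left _ hK1
  have h2 : 2 ^ (2 * k + 1 + 1) = 4 * 4 ^ k := by
    rw [show 2 * k + 1 + 1 = 2 * (k + 1) by ring, pow_mul, pow_succ]
    norm_num
    ring
  have h4 : 1 ≤ 4 ^ k := Nat.one_le_pow _ _ (by norm_num)
  have hK4 : K * K ≤ K ^ 4 := by
    calc K * K = K ^ 2 := (sq K).symm
      _ ≤ K ^ 4 := Nat.pow_le_pow_right hK1 (by norm_num)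
  have hK4' : K ≤ K * K := Nat.le_mul_of_pos_left _ hK1
  have hW : K * ℓ ≤ 4 ^ k * K ^ 4 * ℓ := by
    calc K * ℓ ≤ K ^ 4 * ℓ := Nat.mul_le_mul_right _ (hK4'.trans hK4)
      _ = 1 * K ^ 4 * ℓ := by ring
      _ ≤ _ := by gcongr
  have e₁ : t₁ ≤ 310 * (12 * (4 ^ k * K ^ 4 * ℓ)) := by
    calc t₁ ≤ 310 * (k + 2) * (m + n + 1) := ht₁
      _ ≤ 310 * (3 * K) * (4 * ℓ) := by gcongr <;> omega
      _ = 310 * (12 * (K * ℓ)) := by ring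
      _ ≤ _ := by gcongr
  have e₂ : t₂ ≤ 600 * (4 * (4 * 47)) * (4 ^ k * K ^ 4 * ℓ) := by
    calc t₂ ≤ 600 * (2 ^ (2 * k + 1 + 1) * ((2 * k + 1 + 1) * (4 * n + 2 + 4 * c + 1))) := ht₂
      -- The network has size `4 * n + 2 + 4 * c + 1 ≤ 7 * ℓ + 40 * (K * ℓ)`.
      _ ≤ 600 * (4 * 4 ^ k * ((4 * K) * (47 * (K * ℓ)))) := by rw [h2]; gcongr <;> omega
      _ = 600 * (4 * (4 * 47)) * (4 ^ k * (K * K) * ℓ) := by ring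
      _ ≤ _ := by gcongr
  omega

/-- The common part of both versions: if complete sets of cost at most `k` exist exactly for the
solvable instances, and answers can be read off them, then `mainProg` is correct. -/
theorem computes_mainProg {F : CNF} {L : List (List Literal)} {k a b cC cL : ℕ} {ans : Prog}
    (hF : Is2CNF F) (hL : IsListing L F)
    (hab : a = 30 ∧ b = 31 ∧ cC = 1 ∧ cL = k + 1 ∨ a = 31 ∧ b = 30 ∧ cC = k + 1 ∧ cL = 1)
    {Good : List ℕ → Prop}
    (hans : ∀ (Y : Set ℕ) (s : State), CompleteSet (namesOf L).length Y →
      cost Y (instClauses cC cL L) ≤ k → VarRepr (namesOf L) s → s.reg 1 = 0 → s.reg 2 = 1 →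
      s.reg 4 = 4 * (namesOf L).length + 3 → Y = {u | s.arr 9 u ≠ 0} →
      WP ans s fun s' t => t ≤ 40 * (namesOf L).length + 20 ∧ Good (output s'))
    (hno : (∀ Y, CompleteSet (namesOf L).length Y → k < cost Y (instClauses cC cL L)) →
      Good [0]) :
    ∃ (out : List ℕ) (t : ℕ), Computes (mainProg a b ans) (encode L k) out t ∧
      t ≤ 500000 * (4 ^ k * max k 1 ^ 4 * max (len F) 1) ∧ Good out := by
  have hcl := clausesIn_instClauses cC cL L
  have hlen := length_instClauses cC cL L
  have hm := hL.length_le_len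
  have hn := length_namesOf L
  rw [hL.sum_length] at hn
  have hlen' : (instClauses cC cL L).length ≤
      2 * (k + 1) * L.length + (k + 1) * (namesOf L).length := by
    refine hlen.trans ?_
    gcongr <;> omega
  suffices h : WP (mainProg a b ans) (initState (encode L k)) fun s' t =>
      t ≤ 500000 * (4 ^ k * max k 1 ^ 4 * max (len F) 1) ∧ Good (output s') by
    obtain ⟨s', t, he, ht, hg⟩ := h
    exact ⟨_, t, ⟨s', he, rfl⟩, ht, hg⟩
  refine (wp_buildProg (hL.length_le hF) hab).seq ?_
  rintro s₁ t₁ - ⟨ht₁, h6, hb, hv⟩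
  have hG := hb.graphRepr hcl
  refine (wp_solveProg hG h6 (by omega)).seq ?_
  rintro s₂ t₂ f₂ ⟨ht₂, hres⟩
  have hb₂ := hG.congr (f₂.sameOn rfl)
  have hcut : ∀ Y, CompleteSet (namesOf L).length Y →
      (netOf _ _ hcl).cut (netOf _ _ hcl).cap Y = 2 * cost Y (instClauses cC cL L) :=
    fun Y hY => cut_netOf hcl hY
  have hbound : ∀ t₃, t₃ ≤ 40 * (namesOf L).length + 21 →
      t₁ + (t₂ + t₃) ≤ 500000 * (4 ^ k * max k 1 ^ 4 * max (len F) 1) := fun t₃ ht₃ =>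
    time_bound (le_max_left _ _) (le_max_right _ _) (le_max_right _ _)
      (hm.trans (Nat.add_le_add_right (le_max_left _ _) 1)) (hn.trans (le_max_left _ _)) hlen' ht₁
      ht₂ ht₃
  rw [wp_ite, holds_eq, hb₂.one]
  rcases hres with ⟨h22, hY, hc⟩ | ⟨h22, hall⟩
  · refine ⟨fun _ => ?_, fun h => absurd h22 h⟩
    refine (hans _ s₂ hY ?_ (hv.congr (f₂.sameOn rfl)) hb₂.zero hb₂.one hb₂.L rfl).imp ?_
    · rw [hcut _ hY] at hc
      omega
    · rintro s₃ t₃ - ⟨ht₃, hg⟩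
      exact ⟨hbound _ (by omega), hg⟩
  · refine ⟨fun h => by omega, fun _ => ?_⟩
    refine (wp_noProg hb₂.zero).imp ?_
    rintro s₃ t₃ - ⟨rfl, ho⟩
    refine ⟨hbound _ (by omega), ?_⟩
    rw [ho]
    refine hno fun Y hY => ?_
    have := hall Y hY
    rw [hcut Y hY] at this
    omega

end TwoSat

theorem mainTheorem2 :
    (∃ (P : RAM.Prog) (c : ℕ), ∀ (F : TwoSat.CNF) (k : ℕ) (L : List (List TwoSat.Literal)),
      TwoSat.Is2CNF F → TwoSat.IsListing L F →
        ∃ (out : List ℕ) (t : ℕ),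
          RAM.Computes P (TwoSat.encode L k) out t ∧
          t ≤ c * (4 ^ k * max k 1 ^ 4 * max (TwoSat.len F) 1) ∧
          TwoSat.CorrectClauseAnswer F k out) ∧
    (∃ (P : RAM.Prog) (c : ℕ), ∀ (F : TwoSat.CNF) (k : ℕ) (L : List (List TwoSat.Literal)),
      TwoSat.Is2CNF F → TwoSat.IsListing L F →
        ∃ (out : List ℕ) (t : ℕ),
          RAM.Computes P (TwoSat.encode L k) out t ∧
          t ≤ c * (4 ^ k * max k 1 ^ 4 * max (TwoSat.len F) 1) ∧
          TwoSat.CorrectVarAnswer F k out) := by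
  refine ⟨⟨TwoSat.mainProg 30 31 TwoSat.clauseAnswerProg, 500000, fun F k L hF hL => ?_⟩,
    ⟨TwoSat.mainProg 31 30 TwoSat.varAnswerProg, 500000, fun F k L hF hL => ?_⟩⟩
  · refine TwoSat.computes_mainProg hF hL (Or.inl ⟨rfl, rfl, rfl, rfl⟩) ?_ ?_
    · intro Y s hY hc hv h1 h2 h4 h9
      refine (TwoSat.wp_clauseAnswerProg hv h1 h2 h4 h9).imp ?_
      rintro s' t - ⟨ht, ho⟩
      exact ⟨by omega, Or.inl ⟨_, ho, TwoSat.clauseSolution_of_cost hF hL hY hc⟩⟩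
    · intro h
      refine Or.inr ⟨rfl, ?_⟩
      rintro ⟨τ, hτ⟩
      obtain ⟨Y, hY, hc⟩ := TwoSat.exists_cost_of_clauseSolution hF hL hτ
      exact absurd hc (not_le.2 (h Y hY))
  · refine TwoSat.computes_mainProg hF hL (Or.inr ⟨rfl, rfl, rfl, rfl⟩) ?_ ?_
    · intro Y s hY hc hv h1 h2 h4 h9
      refine (TwoSat.wp_varAnswerProg hv h1 h2 h4 h9).imp ?_
      rintro s' t - ⟨ht, ho⟩
      exact ⟨by omega, Or.inl ⟨_, _, ho, TwoSat.varSolution_of_cost hF hL hY hc⟩⟩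
    · intro h
      refine Or.inr ⟨rfl, ?_⟩
      rintro ⟨S, τ, hS⟩
      obtain ⟨Y, hY, hc⟩ := TwoSat.exists_cost_of_varSolution hF hL hS
      exact absurd hc (not_le.2 (h Y hY))
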